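/- Let $\mu$ be a probability measure on $\mathbb{R}$ with compact support $\mathrm{Supp}(\mu)\subset[a,b]$, where $b-a>1$ and $a,b\in\mathrm{Supp}(\mu)$, which is the weak limit of $\frac1n\sum_{i=1}^n\delta_{x_i^{(n)}/n}$ for some integers $x_1^{(n)}>\dots>x_n^{(n)}$, $n\ge1$ (so $\mu\le\lambda$, Lebesgue measure). Let $C(w)=\int\frac{\mu[dx]}{w-x}$. The liquid region $\mathcal L\subset\mathbb{R}^2$ is the set of all $(\chi,\eta)\in[a,b]\times[0,1]$ with $b\ge\chi\ge\chi+\eta-1\ge a$ for which $$f'_{(\chi,\eta)}(w)=C(w)-\int_{\chi+\eta-1}^{\chi}\frac{dx}{w-x}$$ has a root in $\mathbb{C}\setminus\mathbb{R}$. For $w\in\mathbb{H}=\{\mathrm{Im}\,w>0\}$ let $$\chi_{\mathcal L}(w)=w+\frac{(w-\bar w)(e^{C(\bar w)}-1)}{e^{C(w)}-e^{C(\bar w)}},\qquad \eta_{\mathcal L}(w)=1+\frac{(w-\bar w)(e^{C(w)}-1)(e^{C(\bar w)}-1)}{e^{C(w)}-e^{C(\bar w)}}.$$ Let $U_0=\mathbb{R}\setminus\mathrm{Supp}(\mu)$,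 $U_1=\mathbb{R}\setminus\mathrm{Supp}(\lambda-\mu)$ and $R=\big(\overline{U_0\cup U_1}\big)^\circ$. Let $R_1$ (resp. $R_2$) be the set of $t$ for which there are $t_2<t<t_1$ with $(t,t_1)\subset U_0$ and $(t_2,t)\subset U_1$ (resp. $(t,t_1)\subset U_1$ and $(t_2,t)\subset U_0$), and let $D=U_0\cup U_1\cup R_1\cup R_2\subset R$. For an interval $I=(t_2,t_1)$ let $C_I(t)=\int_{\mathbb{R}\setminus I}\frac{\mu[dx]}{t-x}$. The edge curve $(\chi_{\mathcal E},\eta_{\mathcal E})$ on $D$ is given by $$\chi_{\mathcal E}(t)=t+\frac{e^{C(t)}-1}{e^{C(t)}C'(t)},\qquad \eta_{\mathcal E}(t)=1+\frac{(e^{C(t)}-1)^2}{e^{C(t)}C'(t)}\qquad(t\in U_0\cup U_1),$$ where for $t\in I=(t_2,t_1)\subset U_1$ one reads $e^{C(t)}:=e^{C_I(t)}\frac{t-t_2}{t-t_1}$ and $C'(t):=C_I'(t)-\frac1{t-t_1}+\frac1{t-t_2}$; by $(t,\;1-e^{C_I(t)}(t-t_2))$ for $t\in R_1$; and by $(t-e^{-C_I(t)}(t-t_1),\;1+e^{-C_I(t)}(t-t_1))$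 for $t\in R_2$, with $I=(t_2,t_1)$ as in the definition of $R_1$, $R_2$. Let $\mathcal E$ be the image of this curve and $p_0=(\frac12+\int x\,\mu[dx],\,0)$. Consider the statements: (L0) $(\chi_{\mathcal L}(w),\eta_{\mathcal L}(w))\to p_0$ as $|w|\to\infty$, $w\in\mathbb{H}$. (L1) For all $t\in R$ the edge curve is defined at $t$, its value does not depend on the choice of $I$, and $(\chi_{\mathcal L}(w),\eta_{\mathcal L}(w))\to(\chi_{\mathcal E}(t),\eta_{\mathcal E}(t))$ as $w\to t$, $w\in\mathbb{H}$. (L2) For all $t\in\mathbb{R}\setminus R$, $(\chi_{\mathcal L}(w),\eta_{\mathcal L}(w))\to(t,1)$ as $w\to t$, $w\in\mathbb{H}$. Then the following hold. (1) Suppose that $\mu=\sum_k\lambda|_{A_k}$ for a countable family of mutually disjoint intervals $A_k$. Then $R=\mathbb{R}$. If the family is finite then also $D=\mathbb{R}$. Whenever $D=\mathbb{R}$, the boundary is completely described by $\partial\mathcal L=\{p_0\}\cup\mathcal E$, and (L0) and (L1) hold. (2) Let $\varphi:\mathbb{R}\to[0,1]$ be a density of $\mu$ vanishing outside $[a,b]$.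 Suppose that for every $t\in\mathbb{R}\setminus D$ there is an $\epsilon>0$ for which one of the following holds: (i) $\sup\varphi<1$ and $\inf\varphi>0$ on $(t-\epsilon,t+\epsilon)$; (ii) $\sup\varphi<1$ and $\inf\varphi>0$ on $(t-\epsilon,t)$, and $\varphi=0$ on $(t,t+\epsilon)$; (iii) $\sup\varphi<1$ and $\inf\varphi>0$ on $(t-\epsilon,t)$, and $\varphi=1$ on $(t,t+\epsilon)$; (iv) $\sup\varphi<1$ and $\inf\varphi>0$ on $(t,t+\epsilon)$, and $\varphi=0$ on $(t-\epsilon,t)$; (v) $\sup\varphi<1$ and $\inf\varphi>0$ on $(t,t+\epsilon)$, and $\varphi=1$ on $(t-\epsilon,t)$. Then $R=D$, the boundary is completely described by $\partial\mathcal L=\{p_0\}\cup\mathcal E\cup\{(t,1):t\in\mathbb{R}\setminus R\}$, and (L0), (L1) and (L2) hold. -/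

import Mathlib

open Filter Topology MeasureTheory Set
open scoped ComplexConjugate BoundedContinuousFunction

noncomputable section

/-! ### The limiting measure -/

/-- The rescaled empirical distribution `(1/n) ∑ᵢ δ_{yᵢ/n}` of `n` integer positions. -/
def empiricalDist (n : ℕ) (y : Fin n → ℤ) : Measure ℝ :=
  ((n : ENNReal)⁻¹) • ∑ i : Fin n, Measure.dirac ((y i : ℝ) / (n : ℝ))

/-- `μ` is a probability measure with support in `[a,b]`, the end-points `a`, `b` belong to the
support, `b - a > 1`, and `μ` is the weak limit of the rescaled empirical distributions of
strictly decreasing integer configurations `x n 0 > x n 1 > ⋯ > x n (n-1)`. -/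
structure IsLimitOfTopRows (μ : Measure ℝ) (a b : ℝ) (x : (n : ℕ) → Fin n → ℤ) : Prop where
  isProbabilityMeasure : IsProbabilityMeasure μ
  support_subset : μ.support ⊆ Icc a b
  left_mem : a ∈ μ.support
  right_mem : b ∈ μ.support
  one_lt : 1 < b - a
  strictAnti : ∀ n : ℕ, StrictAnti (x n)
  weak_limit : ∀ g : ℝ →ᵇ ℝ,
    Tendsto (fun n : ℕ => ∫ s, g s ∂(empiricalDist n (x n))) atTop (𝓝 (∫ s, g s ∂μ))

/-! ### The liquid region -/

/-- The Cauchy transform `C(w) = ∫ μ[dx] / (w - x)`. -/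
def cauchyT (μ : Measure ℝ) (w : ℂ) : ℂ := ∫ x : ℝ, 1 / (w - (x : ℂ)) ∂μ

/-- `f'_{(χ,η)}(w) = ∫ μ[dx] / (w - x) - ∫_{χ+η-1}^χ dx / (w - x)`, for non-real `w`. -/
def fDeriv (μ : Measure ℝ) (χ η : ℝ) (w : ℂ) : ℂ :=
  cauchyT μ w - ∫ x in (χ + η - 1)..χ, 1 / (w - (x : ℂ))

/-- The liquid region: the set of all `(χ,η) ∈ [a,b] × [0,1]` with `b ≥ χ ≥ χ + η - 1 ≥ a`
for which `f'_{(χ,η)}` has a non-real root. -/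
def liquidRegion (μ : Measure ℝ) (a b : ℝ) : Set (ℝ × ℝ) :=
  {p | p.1 ∈ Icc a b ∧ p.2 ∈ Icc (0 : ℝ) 1 ∧ p.1 + p.2 - 1 ≤ p.1 ∧ a ≤ p.1 + p.2 - 1 ∧
    ∃ w : ℂ, w.im ≠ 0 ∧ fDeriv μ p.1 p.2 w = 0}

/-- The open upper half plane. -/
def upperHalf : Set ℂ := {w | 0 < w.im}

/-- The parametrisation `(χ_L, η_L)` of the liquid region by the upper half plane.  Both
expressions are invariant under complex conjugation, hence real: `.re` only changes the type. -/
def liquidPoint (μ : Measure ℝ) (w : ℂ) : ℝ × ℝ :=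
  ((w + (w - conj w) * (Complex.exp (cauchyT μ (conj w)) - 1) /
      (Complex.exp (cauchyT μ w) - Complex.exp (cauchyT μ (conj w)))).re,
   (1 + (w - conj w) * (Complex.exp (cauchyT μ w) - 1) *
        (Complex.exp (cauchyT μ (conj w)) - 1) /
      (Complex.exp (cauchyT μ w) - Complex.exp (cauchyT μ (conj w)))).re)

/-! ### The edge -/

/-- The open set `ℝ \ Supp(μ)`. -/
def voidSet (μ : Measure ℝ) : Set ℝ := (μ.support)ᶜ

/-- The open set `ℝ \ Supp(λ - μ)`, with `λ` Lebesgue measure. -/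
def fullSet (μ : Measure ℝ) : Set ℝ := ((volume - μ).support)ᶜ

/-- `R`: the interior of the closure of `(ℝ \ Supp(μ)) ∪ (ℝ \ Supp(λ - μ))`. -/
def edgeParam (μ : Measure ℝ) : Set ℝ := interior (closure (voidSet μ ∪ fullSet μ))

/-- `t ∈ (t₂,t₁)` with `(t,t₁) ⊆ ℝ \ Supp(μ)` and `(t₂,t) ⊆ ℝ \ Supp(λ - μ)`. -/
def IsFullVoidInterval (μ : Measure ℝ) (t t₂ t₁ : ℝ) : Prop :=
  t₂ < t ∧ t < t₁ ∧ Ioo t t₁ ⊆ voidSet μ ∧ Ioo t₂ t ⊆ fullSet μ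

/-- `t ∈ (t₂,t₁)` with `(t,t₁) ⊆ ℝ \ Supp(λ - μ)` and `(t₂,t) ⊆ ℝ \ Supp(μ)`. -/
def IsVoidFullInterval (μ : Measure ℝ) (t t₂ t₁ : ℝ) : Prop :=
  t₂ < t ∧ t < t₁ ∧ Ioo t t₁ ⊆ fullSet μ ∧ Ioo t₂ t ⊆ voidSet μ

/-- `R₁`: the points which are a common end-point of an interval of `ℝ \ Supp(λ - μ)` on the left
and an interval of `ℝ \ Supp(μ)` on the right.  (For `μ ≤ λ` the two open sets are disjoint, so
that such a point automatically lies on the boundary of both.) -/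
def edgeR₁ (μ : Measure ℝ) : Set ℝ := {t | ∃ t₂ t₁, IsFullVoidInterval μ t t₂ t₁}

/-- `R₂`: as `R₁`, with left and right exchanged. -/
def edgeR₂ (μ : Measure ℝ) : Set ℝ := {t | ∃ t₂ t₁, IsVoidFullInterval μ t t₂ t₁}

/-- The set `(ℝ \ Supp(μ)) ∪ (ℝ \ Supp(λ - μ)) ∪ R₁ ∪ R₂` on which the edge curve is given by the
explicit expressions below. -/
def edgeDomain (μ : Measure ℝ) : Set ℝ := voidSet μ ∪ fullSet μ ∪ edgeR₁ μ ∪ edgeR₂ μ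

/-- `C_I(t) = ∫_{ℝ \ I} μ[dx] / (t - x)` for `I = (t₂,t₁)` and real `t`. -/
def cauchyOff (μ : Measure ℝ) (t₂ t₁ t : ℝ) : ℝ := ∫ x in (Ioo t₂ t₁)ᶜ, 1 / (t - x) ∂μ

/-- `C_I'(t) = - ∫_{ℝ \ I} μ[dx] / (t - x)²` for `I = (t₂,t₁)` and `t ∈ I`. -/
def cauchyOffDeriv (μ : Measure ℝ) (t₂ t₁ t : ℝ) : ℝ :=
  - ∫ x in (Ioo t₂ t₁)ᶜ, 1 / (t - x) ^ 2 ∂μ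

/-- The point `(t + (E - 1) / (E C'), 1 + (E - 1)² / (E C'))`, for `E = e^{C(t)}`, `C' = C'(t)`. -/
def edgeFormula (t E C' : ℝ) : ℝ × ℝ := (t + (E - 1) / (E * C'), 1 + (E - 1) ^ 2 / (E * C'))

/-- `EdgeValue μ t p` says that `p = (χ_E(t), η_E(t))` is the value at `t` of the edge curve.
In `full` the numbers `e^{C_I(t)} (t-t₂)/(t-t₁)` and `C_I'(t) - 1/(t-t₁) + 1/(t-t₂)` are the values
at `t` of the analytic extensions of `e^C` and `C'` across `ℝ \ Supp(λ - μ)`. -/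
inductive EdgeValue (μ : Measure ℝ) (t : ℝ) : ℝ × ℝ → Prop
  | void (ht : t ∈ voidSet μ) :
      EdgeValue μ t
        (edgeFormula t (Real.exp (∫ x, 1 / (t - x) ∂μ)) (- ∫ x, 1 / (t - x) ^ 2 ∂μ))
  | full (t₂ t₁ : ℝ) (ht : t ∈ Ioo t₂ t₁) (hI : Ioo t₂ t₁ ⊆ fullSet μ) :
      EdgeValue μ t
        (edgeFormula t (Real.exp (cauchyOff μ t₂ t₁ t) * ((t - t₂) / (t - t₁)))
          (cauchyOffDeriv μ t₂ t₁ t - 1 / (t - t₁) + 1 / (t - t₂)))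
  | fullVoid (t₂ t₁ : ℝ) (hI : IsFullVoidInterval μ t t₂ t₁) :
      EdgeValue μ t (t, 1 - Real.exp (cauchyOff μ t₂ t₁ t) * (t - t₂))
  | voidFull (t₂ t₁ : ℝ) (hI : IsVoidFullInterval μ t t₂ t₁) :
      EdgeValue μ t
        (t - Real.exp (- cauchyOff μ t₂ t₁ t) * (t - t₁),
          1 + Real.exp (- cauchyOff μ t₂ t₁ t) * (t - t₁))

/-- The edge: the image of the edge curve. -/
def edge (μ : Measure ℝ) : Set (ℝ × ℝ) := {p | ∃ t, EdgeValue μ t p}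

/-- The point `(1/2 + ∫ x μ[dx], 0)`. -/
def bottomPoint (μ : Measure ℝ) : ℝ × ℝ := (1 / 2 + ∫ x, x ∂μ, 0)

/-! ### The cases for the remaining parameters -/

/-- `φ` is a density of `μ` with values in `[0,1]`, extended by zero outside `[a,b]`. -/
def IsDensityOf (φ : ℝ → ℝ) (μ : Measure ℝ) (a b : ℝ) : Prop :=
  Measurable φ ∧ (∀ s, φ s ∈ Icc (0 : ℝ) 1) ∧ (∀ s, s ∉ Icc a b → φ s = 0) ∧
    μ = volume.withDensity (fun s => ENNReal.ofReal (φ s))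

/-- `sup_S φ < 1` and `inf_S φ > 0` (used for non-empty `S` and `φ` with values in `[0,1]`). -/
def StrictlyBetween (φ : ℝ → ℝ) (S : Set ℝ) : Prop := sSup (φ '' S) < 1 ∧ 0 < sInf (φ '' S)

/-- One of the five cases holds at `t`. -/
def DensityCase (φ : ℝ → ℝ) (t : ℝ) : Prop :=
  ∃ ε : ℝ, 0 < ε ∧
    (StrictlyBetween φ (Ioo (t - ε) (t + ε)) ∨
     (StrictlyBetween φ (Ioo (t - ε) t) ∧ ∀ s ∈ Ioo t (t + ε), φ s = 0) ∨
     (StrictlyBetween φ (Ioo (t - ε) t) ∧ ∀ s ∈ Ioo t (t + ε), φ s = 1) ∨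
     (StrictlyBetween φ (Ioo t (t + ε)) ∧ ∀ s ∈ Ioo (t - ε) t, φ s = 0) ∨
     (StrictlyBetween φ (Ioo t (t + ε)) ∧ ∀ s ∈ Ioo (t - ε) t, φ s = 1))

/-! ### Boundary behaviour of the parametrisation -/

/-- `(χ_L(w), η_L(w)) → (1/2 + ∫ x μ[dx], 0)` as `|w| → ∞` in the upper half plane. -/
def TendsToBottom (μ : Measure ℝ) : Prop :=
  Tendsto (liquidPoint μ) (Bornology.cobounded ℂ ⊓ 𝓟 upperHalf) (𝓝 (bottomPoint μ))

/-- The edge curve is defined at every `t ∈ R`, with a single value (whatever intervals are used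
in its definition), and `(χ_L(w), η_L(w))` tends to its value
at `t` as `w → t` in the upper half plane, for every `t ∈ R`. -/
def TendsToEdge (μ : Measure ℝ) : Prop :=
  ∀ t ∈ edgeParam μ, ∃ p, (∀ q, EdgeValue μ t q ↔ q = p) ∧
    Tendsto (liquidPoint μ) (𝓝[upperHalf] (t : ℂ)) (𝓝 p)

/-- `(χ_L(w), η_L(w)) → (t, 1)` as `w → t` in the upper half plane, for every `t ∉ R`. -/
def TendsToTop (μ : Measure ℝ) : Prop :=
  ∀ t, t ∉ edgeParam μ → Tendsto (liquidPoint μ) (𝓝[upperHalf] (t : ℂ)) (𝓝 (t, 1))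

end

/-! ### The Cauchy transform -/

/-! Write `c = χ + η - 1` and `G = e^{C(w)}`. For `w` in the upper half plane, `f'(w) = 0` reads
`C(w) = log (w - c) - log (w - χ)`. Exponentiating gives `G (w - χ) = w - c`. Together with its
conjugate this is a linear system for the real numbers `χ`, `η`, and its solution is `liquidPoint μ
w`. Conversely `0 ≤ φ ≤ 1` forces `Im C(w)` into `(-π, 0)` (`cauchyT_im_mem_Ioo`), so no multiple of
`2πi` is lost when taking logarithms. Hence the liquid region is the image of the half plane
(`liquidRegion_eq_image`).

The signed density `φ - 1_{(c,χ]}` has the sign of `(x - c)(x - χ)`. Integrating it against rational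
weights of matching sign gives positive numbers, whereas a root makes suitable combinations of these
integrals vanish. This yields the side constraints on `(χ, η)` and the uniqueness of the root
(`root_unique`), hence injectivity of the parametrisation. A quantitative open mapping argument
shows that a small ball around `w₀` already covers a neighbourhood of the image of `w₀`
(`eventually_exists_liquidPoint_eq`). So the boundary consists exactly of the limits along `w`
escaping from the half plane, as soon as these exist at infinity and at each real point
(`frontier_liquidRegion_eq`).

It remains to find the limits. At infinity one expands `e^C` in `1/w`. At a point of `edgeDomain`
the function `e^C` or `e^{-C}` extends analytically across the real axis with non-zero derivative,
and the difference quotient between `w` and `conj w` tends to that derivative (`EdgeValue.tendsto`).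
All admissible expressions for the edge curve at `t` are limits of one function, so they agree.

At the other points with a strictly intermediate density, `χ - w` and `η - 1` are bounded by a
multiple of `(Im w / sin(-Im C)) e^{|Re C|}`. At a scale `δ ≤ |w - t|` the first factor is `O(δ)`
and the second `O(δ^{-(1-c)})`, because the density relevant to the logarithmic singularity is at
most `1 - c`. The product is `O(δ^c)`, and the limit is `(t, 1)`
(`tendsto_liquidPoint_top_of_kernel`). -/

theorem integrable_inv_sub (ν : Measure ℝ) [IsFiniteMeasure ν] {w : ℂ} {r : ℝ} (hr : 0 < r)
    (h : ∀ᵐ x : ℝ ∂ν, r ≤ ‖w - x‖) : Integrable (fun x : ℝ => 1 / (w - (x : ℂ))) ν := by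
  refine Integrable.of_bound (C := 1 / r) (Measurable.aestronglyMeasurable (by fun_prop)) ?_
  filter_upwards [h] with x hx
  rw [norm_div, norm_one]
  exact one_div_le_one_div_of_le hr hx

theorem hasDerivAt_cauchyT (ν : Measure ℝ) [IsFiniteMeasure ν] {w : ℂ} {r : ℝ} (hr : 0 < r)
    (h : ∀ᵐ x : ℝ ∂ν, r ≤ ‖w - x‖) :
    HasDerivAt (cauchyT ν) (∫ x : ℝ, -1 / (w - (x : ℂ)) ^ 2 ∂ν) w := by
  have key : ∀ x : ℝ, r ≤ ‖w - x‖ → ∀ z ∈ Metric.ball w (r / 2), r / 2 ≤ ‖z - x‖ := by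
    intro x hx z hz
    rw [Metric.mem_ball, dist_comm, dist_eq_norm] at hz
    have := norm_sub_le_norm_sub_add_norm_sub w z (x : ℂ)
    linarith
  refine (hasDerivAt_integral_of_dominated_loc_of_deriv_le
    (F := fun z (x : ℝ) => 1 / (z - (x : ℂ))) (F' := fun z (x : ℝ) => -1 / (z - (x : ℂ)) ^ 2)
    (bound := fun _ => 1 / (r / 2) ^ 2)
    (Metric.ball_mem_nhds w (half_pos hr)) (.of_forall fun z => Measurable.aestronglyMeasurable (by fun_prop))
    (integrable_inv_sub ν hr h)
    (Measurable.aestronglyMeasurable (by fun_prop)) ?_ (integrable_const _) ?_).2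
  · filter_upwards [h] with x hx z hz
    rw [norm_div, norm_neg, norm_one, norm_pow]
    exact one_div_le_one_div_of_le (by positivity)
      (pow_le_pow_left₀ (by positivity) (key x hx z hz) 2)
  · filter_upwards [h] with x hx z hz
    have hz' : z - x ≠ 0 := norm_pos_iff.1 ((half_pos hr).trans_le (key x hx z hz))
    have := ((hasDerivAt_id z).sub_const (x : ℂ)).inv hz'
    simpa [Pi.inv_def] using this

/-- Differentiability on a disc gives analyticity, hence strict differentiability. The strict form
matters because later difference quotients join two moving points, `w` and `conj w`. -/
theorem hasStrictDerivAt_cauchyT (ν : Measure ℝ) [IsFiniteMeasure ν] {w : ℂ} {r : ℝ} (hr : 0 < r)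
    (h : ∀ᵐ x : ℝ ∂ν, r ≤ ‖w - x‖) :
    HasStrictDerivAt (cauchyT ν) (∫ x : ℝ, -1 / (w - (x : ℂ)) ^ 2 ∂ν) w := by
  have hd : DifferentiableOn ℂ (cauchyT ν) (Metric.ball w (r / 2)) := by
    intro z hz
    refine (hasDerivAt_cauchyT ν (half_pos hr) ?_).differentiableAt.differentiableWithinAt
    filter_upwards [h] with x hx
    rw [Metric.mem_ball, dist_comm, dist_eq_norm] at hz
    have := norm_sub_le_norm_sub_add_norm_sub w z (x : ℂ)
    linarith
  have := (hd.analyticAt (Metric.ball_mem_nhds w (half_pos hr))).hasStrictDerivAt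
  rwa [(hasDerivAt_cauchyT ν hr h).deriv] at this

theorem abs_im_le_norm_sub_ofReal (w : ℂ) (x : ℝ) : |w.im| ≤ ‖w - x‖ := by
  simpa using Complex.abs_im_le_norm (w - x)

theorem differentiableAt_cauchyT (ν : Measure ℝ) [IsFiniteMeasure ν] {w : ℂ} (hw : w.im ≠ 0) :
    DifferentiableAt ℂ (cauchyT ν) w :=
  (hasDerivAt_cauchyT ν (abs_pos.2 hw)
    (.of_forall fun x => abs_im_le_norm_sub_ofReal w x)).differentiableAt

theorem integrable_inv_sub_of_im_ne_zero (ν : Measure ℝ) [IsFiniteMeasure ν] {w : ℂ}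
    (hw : w.im ≠ 0) : Integrable (fun x : ℝ => 1 / (w - (x : ℂ))) ν :=
  integrable_inv_sub ν (abs_pos.2 hw) (.of_forall fun x => abs_im_le_norm_sub_ofReal w x)

theorem cauchyT_conj (ν : Measure ℝ) (w : ℂ) : cauchyT ν (conj w) = conj (cauchyT ν w) := by
  rw [cauchyT, cauchyT, ← integral_conj]
  simp

theorem cauchyT_im (ν : Measure ℝ) [IsFiniteMeasure ν] {w : ℂ} (hw : w.im ≠ 0) :
    (cauchyT ν w).im = ∫ x : ℝ, -(w.im / Complex.normSq (w - x)) ∂ν := by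
  have := integral_im (integrable_inv_sub_of_im_ne_zero ν hw)
  rw [cauchyT]
  refine Eq.trans this.symm (integral_congr_ae (.of_forall fun x => ?_))
  simp [neg_div]

theorem continuousAt_cauchyT (ν : Measure ℝ) [IsFiniteMeasure ν] {w : ℂ} (hw : w.im ≠ 0) :
    ContinuousAt (cauchyT ν) w := (differentiableAt_cauchyT ν hw).continuousAt

/-! ### Limits of the parametrisation -/

/-- As `t` is its own conjugate, `u` and `conj u` both tend to `t`. Strict differentiability
controls the slope between them even though neither point is fixed. -/
theorem HasStrictDerivAt.tendsto_conj_slope {g : ℂ → ℂ} {g' t : ℂ} (hg : HasStrictDerivAt g g' t)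
    {l : Filter ℂ} {u : ℂ → ℂ} (hu : Tendsto u l (𝓝 t)) (ht : conj t = t)
    (hne : ∀ᶠ w in l, u w - conj (u w) ≠ 0) :
    Tendsto (fun w => (g (u w) - g (conj (u w))) / (u w - conj (u w))) l (𝓝 g') := by
  have hc : Tendsto (fun w => conj (u w)) l (𝓝 t) := by
    have := (Complex.continuous_conj.tendsto t).comp hu
    rwa [ht] at this
  have h := (hg.isLittleO.comp_tendsto (hu.prodMk_nhds hc)).tendsto_div_nhds_zero
  have h2 := h.add_const g'
  rw [zero_add] at h2
  refine h2.congr' ?_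
  filter_upwards [hne] with w hw
  simp only [Function.comp_apply, ContinuousLinearMap.toSpanSingleton_apply, smul_eq_mul]
  field_simp
  ring

theorem sub_conj_ne_zero {w : ℂ} (hw : w.im ≠ 0) : w - conj w ≠ 0 := by
  rw [Complex.sub_conj]
  simp [hw]

theorem tendsto_conj_nhdsWithin_ofReal (t : ℝ) (s : Set ℂ) :
    Tendsto (fun w : ℂ => conj w) (𝓝[s] (t : ℂ)) (𝓝 (t : ℂ)) := by
  have := Complex.continuous_conj.tendsto (t : ℂ)
  rw [Complex.conj_ofReal] at this
  exact this.mono_left nhdsWithin_le_nhds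

/-- Dividing numerator and denominator by `w - conj w` leaves the slope of `g` in the denominator,
so only `g t` and `g'` survive in the limit. The extension `g` has to agree with `e^C` only off the
real axis. -/
theorem tendsto_liquidPoint_of_exp {μ : Measure ℝ} {t : ℝ} {g : ℂ → ℂ} {g' : ℂ}
    (hg : HasStrictDerivAt g g' t) (hg' : g' ≠ 0)
    (h : ∀ᶠ w in 𝓝[upperHalf] (t : ℂ), Complex.exp (cauchyT μ w) = g w ∧
      Complex.exp (cauchyT μ (conj w)) = g (conj w)) :
    Tendsto (liquidPoint μ) (𝓝[upperHalf] (t : ℂ))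
      (𝓝 ((t + (g t - 1) / g').re, (1 + (g t - 1) ^ 2 / g').re)) := by
  have hne : ∀ᶠ w in 𝓝[upperHalf] (t : ℂ), w - conj w ≠ 0 := by
    filter_upwards [self_mem_nhdsWithin] with w hw using sub_conj_ne_zero (ne_of_gt hw)
  have hid : Tendsto (fun w : ℂ => w) (𝓝[upperHalf] (t : ℂ)) (𝓝 t) :=
    tendsto_id.mono_left nhdsWithin_le_nhds
  have hs := hg.tendsto_conj_slope hid (Complex.conj_ofReal t) hne
  have h1 : Tendsto g (𝓝[upperHalf] (t : ℂ)) (𝓝 (g t)) :=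
    hg.hasDerivAt.continuousAt.tendsto.comp hid
  have h2 : Tendsto (fun w => g (conj w)) (𝓝[upperHalf] (t : ℂ)) (𝓝 (g t)) :=
    hg.hasDerivAt.continuousAt.tendsto.comp (tendsto_conj_nhdsWithin_ofReal t _)
  refine Tendsto.prodMk_nhds ((Complex.continuous_re.tendsto _).comp ?_)
    ((Complex.continuous_re.tendsto _).comp ?_)
  · refine (hid.add ((h2.sub_const 1).div hs hg')).congr' ?_
    filter_upwards [h, hne] with w hw hw2
    rw [hw.1, hw.2, Pi.div_apply, div_div_eq_mul_div, mul_comm (g (conj w) - 1)]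
  · refine (tendsto_const_nhds.add (((h1.sub_const 1).mul (h2.sub_const 1)).div hs hg')).congr' ?_
      |>.trans (by rw [sq])
    filter_upwards [h, hne] with w hw hw2
    rw [hw.1, hw.2, Pi.div_apply, div_div_eq_mul_div, mul_assoc, mul_assoc,
      mul_comm (w - conj w), mul_assoc]

/-- Serves the points where `e^C` has a pole: its reciprocal is still analytic there, and the
formulas are rewritten in terms of `e^{-C}`. -/
theorem tendsto_liquidPoint_of_exp_neg {μ : Measure ℝ} {t : ℝ} {h : ℂ → ℂ} {h' : ℂ}
    (hh : HasStrictDerivAt h h' t) (hh' : h' ≠ 0)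
    (heq : ∀ᶠ w in 𝓝[upperHalf] (t : ℂ), Complex.exp (-cauchyT μ w) = h w ∧
      Complex.exp (-cauchyT μ (conj w)) = h (conj w)) :
    Tendsto (liquidPoint μ) (𝓝[upperHalf] (t : ℂ))
      (𝓝 ((t - (1 - h t) * h t / h').re, (1 - (1 - h t) ^ 2 / h').re)) := by
  have hne : ∀ᶠ w in 𝓝[upperHalf] (t : ℂ), w - conj w ≠ 0 := by
    filter_upwards [self_mem_nhdsWithin] with w hw using sub_conj_ne_zero (ne_of_gt hw)
  have hid : Tendsto (fun w : ℂ => w) (𝓝[upperHalf] (t : ℂ)) (𝓝 t) :=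
    tendsto_id.mono_left nhdsWithin_le_nhds
  have hs := hh.tendsto_conj_slope hid (Complex.conj_ofReal t) hne
  have h1 : Tendsto h (𝓝[upperHalf] (t : ℂ)) (𝓝 (h t)) :=
    hh.hasDerivAt.continuousAt.tendsto.comp hid
  have h2 : Tendsto (fun w => h (conj w)) (𝓝[upperHalf] (t : ℂ)) (𝓝 (h t)) :=
    hh.hasDerivAt.continuousAt.tendsto.comp (tendsto_conj_nhdsWithin_ofReal t _)
  have hsne : ∀ᶠ w in 𝓝[upperHalf] (t : ℂ), h w - h (conj w) ≠ 0 := by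
    filter_upwards [hs.eventually_ne hh'] with w hw h0
    simp [h0] at hw
  refine Tendsto.prodMk_nhds ((Complex.continuous_re.tendsto _).comp ?_)
    ((Complex.continuous_re.tendsto _).comp ?_)
  · refine (hid.sub (((h2.const_sub 1).mul h1).div hs hh')).congr' ?_
    filter_upwards [heq, hne, hsne] with w hw hw2 hw3
    have e1 : Complex.exp (cauchyT μ w) = (h w)⁻¹ := by rw [← hw.1, Complex.exp_neg, inv_inv]
    have e2 : Complex.exp (cauchyT μ (conj w)) = (h (conj w))⁻¹ := by
      rw [← hw.2, Complex.exp_neg, inv_inv]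
    have n1 : h w ≠ 0 := by rw [← hw.1]; exact Complex.exp_ne_zero _
    have n2 : h (conj w) ≠ 0 := by rw [← hw.2]; exact Complex.exp_ne_zero _
    have n3 : h (conj w) - h w ≠ 0 := fun h0 => hw3 (by rw [← neg_sub, h0, neg_zero])
    rw [e1, e2, Pi.div_apply]
    have e3 : (h w)⁻¹ - (h (conj w))⁻¹ = -(h w - h (conj w)) / (h w * h (conj w)) := by
      field_simp; ring
    rw [e3]
    field_simp
    ring
  · refine (tendsto_const_nhds.sub (((h1.const_sub 1).mul (h2.const_sub 1)).div hs hh')).congr' ?_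
      |>.trans (by rw [sq])
    filter_upwards [heq, hne, hsne] with w hw hw2 hw3
    have e1 : Complex.exp (cauchyT μ w) = (h w)⁻¹ := by rw [← hw.1, Complex.exp_neg, inv_inv]
    have e2 : Complex.exp (cauchyT μ (conj w)) = (h (conj w))⁻¹ := by
      rw [← hw.2, Complex.exp_neg, inv_inv]
    have n1 : h w ≠ 0 := by rw [← hw.1]; exact Complex.exp_ne_zero _
    have n2 : h (conj w) ≠ 0 := by rw [← hw.2]; exact Complex.exp_ne_zero _
    rw [e1, e2, Pi.div_apply]
    have e3 : (h w)⁻¹ - (h (conj w))⁻¹ = -(h w - h (conj w)) / (h w * h (conj w)) := by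
      field_simp; ring
    rw [e3]
    field_simp
    ring

/-! ### Behaviour at infinity -/

theorem hasStrictDerivAt_dslope_exp : HasStrictDerivAt (dslope Complex.exp 0) (1 / 2) 0 := by
  set E : ℂ → ℂ := dslope Complex.exp 0 with hE
  have hd : Differentiable ℂ E := by
    rw [← differentiableOn_univ, hE, Complex.differentiableOn_dslope univ_mem]
    exact Complex.differentiable_exp.differentiableOn
  have hexp : ∀ s, s * E s = Complex.exp s - 1 := fun s => by
    simpa using sub_smul_dslope Complex.exp 0 s
  have hE0 : E 0 = 1 := by simp [hE, dslope_same]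
  -- Differentiating `s E(s) = e^s - 1` once here and a second time at `0` gives `2 E'(0) = 1`.
  have h1 : ∀ s, E s + s * deriv E s = Complex.exp s := fun s => by
    have h2 : HasDerivAt (fun s => s * E s) (1 * E s + s * deriv E s) s :=
      (hasDerivAt_id s).mul (hd s).hasDerivAt
    have h3 : HasDerivAt (fun s => s * E s) (Complex.exp s) s := by
      simp_rw [hexp]
      exact (Complex.hasDerivAt_exp s).sub_const 1
    simpa using h2.unique h3
  have hdd : Differentiable ℂ (deriv E) := by
    rw [← differentiableOn_univ]
    exact hd.differentiableOn.deriv isOpen_univ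
  have h4 : HasDerivAt (fun s => E s + s * deriv E s)
      (deriv E 0 + (1 * deriv E 0 + 0 * deriv (deriv E) 0)) 0 :=
    (hd 0).hasDerivAt.add ((hasDerivAt_id (0 : ℂ)).mul (hdd 0).hasDerivAt)
  have h5 : HasDerivAt (fun s => E s + s * deriv E s) 1 0 := by
    simp_rw [h1]
    simpa using Complex.hasDerivAt_exp 0
  have h6 := h4.unique h5
  have h7 : deriv E 0 = 1 / 2 := by linear_combination h6 / 2
  rw [← h7]
  exact (hd.analyticAt 0).hasStrictDerivAt

/-- The function `z ↦ ∫ μ[dx] / (1 - z x)`, for which `C(w) = w⁻¹ m(w⁻¹)`. -/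
noncomputable def momentT (μ : Measure ℝ) (z : ℂ) : ℂ := ∫ x : ℝ, 1 / (1 - z * (x : ℂ)) ∂μ

theorem hasDerivAt_momentT {μ : Measure ℝ} [IsFiniteMeasure μ] {M : ℝ} (hM : 0 < M)
    (h : ∀ᵐ x : ℝ ∂μ, |x| ≤ M) {z : ℂ} (hz : ‖z‖ < 1 / (4 * M)) :
    HasDerivAt (momentT μ) (∫ x : ℝ, x / (1 - z * (x : ℂ)) ^ 2 ∂μ) z := by
  -- Both `z` and `y - z` have norm below `1/(4M)`, so `|y x| ≤ 1/2` on the support.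
  have key : ∀ x : ℝ, |x| ≤ M → ∀ y ∈ Metric.ball z (1 / (4 * M)), 1 / 2 ≤ ‖1 - y * (x : ℂ)‖ := by
    intro x hx y hy
    rw [Metric.mem_ball, dist_eq_norm] at hy
    have h1 : ‖y‖ ≤ 1 / (2 * M) := by
      have h2 := norm_sub_norm_le y z
      have h3 : 1 / (2 * M) = 1 / (4 * M) + 1 / (4 * M) := by field_simp; norm_num
      linarith
    have h2 : ‖y * (x : ℂ)‖ ≤ 1 / 2 := by
      rw [norm_mul, Complex.norm_real, Real.norm_eq_abs]
      calc ‖y‖ * |x| ≤ 1 / (2 * M) * M := by gcongr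
        _ = 1 / 2 := by field_simp
    have h3 := norm_sub_norm_le (1 : ℂ) (y * (x : ℂ))
    rw [norm_one] at h3
    linarith
  have hb : (0 : ℝ) < 1 / (4 * M) := by positivity
  refine (hasDerivAt_integral_of_dominated_loc_of_deriv_le
    (F := fun z (x : ℝ) => 1 / (1 - z * (x : ℂ))) (F' := fun z (x : ℝ) => x / (1 - z * (x : ℂ)) ^ 2)
    (bound := fun _ => M / (1 / 2) ^ 2)
    (Metric.ball_mem_nhds z hb) (.of_forall fun z => Measurable.aestronglyMeasurable (by fun_prop))
    ?_ (Measurable.aestronglyMeasurable (by fun_prop)) ?_ (integrable_const _) ?_).2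
  · refine Integrable.of_bound (C := 1 / (1 / 2)) (Measurable.aestronglyMeasurable (by fun_prop)) ?_
    filter_upwards [h] with x hx
    rw [norm_div, norm_one]
    exact one_div_le_one_div_of_le (by norm_num) (key x hx z (Metric.mem_ball_self hb))
  · filter_upwards [h] with x hx y hy
    rw [norm_div, norm_pow, Complex.norm_real, Real.norm_eq_abs]
    exact div_le_div₀ hM.le hx (by positivity)
      (pow_le_pow_left₀ (by positivity) (key x hx y hy) 2)
  · filter_upwards [h] with x hx y hy
    have hy' : 1 - y * (x : ℂ) ≠ 0 := norm_pos_iff.1 (one_half_pos.trans_le (key x hx y hy))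
    have := (((hasDerivAt_id y).mul_const (x : ℂ)).const_sub 1).inv hy'
    simpa [Pi.inv_def] using this

theorem hasStrictDerivAt_momentT {μ : Measure ℝ} [IsFiniteMeasure μ] {M : ℝ} (hM : 0 < M)
    (h : ∀ᵐ x : ℝ ∂μ, |x| ≤ M) : HasStrictDerivAt (momentT μ) ((∫ x : ℝ, x ∂μ : ℝ) : ℂ) 0 := by
  have hb : (0 : ℝ) < 1 / (4 * M) := by positivity
  have hd : DifferentiableOn ℂ (momentT μ) (Metric.ball 0 (1 / (4 * M))) := fun z hz =>
    (hasDerivAt_momentT hM h (by simpa using hz)).differentiableAt.differentiableWithinAt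
  have := (hd.analyticAt (Metric.ball_mem_nhds 0 hb)).hasStrictDerivAt
  rw [(hasDerivAt_momentT hM h (by simpa using hb)).deriv] at this
  rw [← integral_complex_ofReal]
  simpa using this

/-- With `z = 1/w` one has `e^{C(w)} = 1 + z k(z)`, where `k` is analytic at `0`, `k(0) = 1` and
`k'(0) = ∫ x dμ + 1/2`. Then `χ` is the quotient of the conjugate slopes of `k` and of `z k(z)`, and
`η` is `1 - k(z) k(conj z)` divided by the latter slope, that is, `1 - (k(z) k(conj z)) / slope`.
The slope of `z k(z)` tends to `1`. -/
theorem tendsToBottom_of_ae_abs_le {μ : Measure ℝ} [IsProbabilityMeasure μ] {M : ℝ} (hM : 0 < M)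
    (h : ∀ᵐ x : ℝ ∂μ, |x| ≤ M) : TendsToBottom μ := by
  set m := momentT μ with hm
  set E : ℂ → ℂ := dslope Complex.exp 0 with hE
  have hE0 : E 0 = 1 := by simp [hE, dslope_same]
  have hexp : ∀ s, s * E s = Complex.exp s - 1 := fun s => by
    simpa using sub_smul_dslope Complex.exp 0 s
  have hm0 : m 0 = 1 := by simp [hm, momentT]
  have hmd : HasStrictDerivAt m _ 0 := hasStrictDerivAt_momentT hM h
  have hid : HasStrictDerivAt (fun z : ℂ => z) 1 0 := hasStrictDerivAt_id 0
  have hzm : HasStrictDerivAt (fun z => z * m z) 1 0 := by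
    have h1 := hid.mul hmd
    rw [hm0, zero_mul, add_zero, one_mul] at h1
    exact h1
  set k : ℂ → ℂ := fun z => m z * E (z * m z) with hk
  have hkd : HasStrictDerivAt k ((∫ x : ℝ, x ∂μ : ℝ) + 1 / 2) 0 := by
    have hE' : HasStrictDerivAt E (1 / 2) (0 * m 0) := by
      rw [zero_mul]; exact hasStrictDerivAt_dslope_exp
    have h1 : HasStrictDerivAt (fun z => E (z * m z)) (1 / 2 * 1) 0 :=
      HasStrictDerivAt.comp (h := fun z => z * m z) 0 hE' hzm
    have h2 := hmd.mul h1
    rw [zero_mul, hm0, hE0, mul_one, one_mul, mul_one] at h2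
    exact h2
  have hk0 : k 0 = 1 := by simp [hk, hm0, hE0]
  have hzk : HasStrictDerivAt (fun z => z * k z) 1 0 := by
    have h1 := hid.mul hkd
    rw [hk0, zero_mul, add_zero, one_mul] at h1
    exact h1
  have hinv : Tendsto (fun w : ℂ => w⁻¹) (Bornology.cobounded ℂ ⊓ 𝓟 upperHalf) (𝓝 0) :=
    tendsto_inv₀_cobounded.mono_left inf_le_left
  have hH : ∀ᶠ w in Bornology.cobounded ℂ ⊓ 𝓟 upperHalf, w ∈ upperHalf :=
    mem_inf_of_right (mem_principal_self _)
  have hne : ∀ᶠ w in Bornology.cobounded ℂ ⊓ 𝓟 upperHalf, w⁻¹ - conj (w⁻¹) ≠ 0 := by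
    filter_upwards [hH] with w hw
    refine sub_conj_ne_zero ?_
    have hw' : (0 : ℝ) < w.im := hw
    have hw0 : w ≠ 0 := fun h0 => by simp [h0] at hw'
    rw [Complex.inv_im]
    exact div_ne_zero (neg_ne_zero.2 hw'.ne') (Complex.normSq_pos.2 hw0).ne'
  have hq := hzk.tendsto_conj_slope hinv (map_zero _) hne
  have hdk := hkd.tendsto_conj_slope hinv (map_zero _) hne
  have hk1 : Tendsto (fun w : ℂ => k w⁻¹) (Bornology.cobounded ℂ ⊓ 𝓟 upperHalf) (𝓝 1) := by
    rw [← hk0]; exact hkd.hasDerivAt.continuousAt.tendsto.comp hinv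
  have hk2 : Tendsto (fun w : ℂ => k (conj w⁻¹)) (Bornology.cobounded ℂ ⊓ 𝓟 upperHalf) (𝓝 1) := by
    rw [← hk0]
    refine hkd.hasDerivAt.continuousAt.tendsto.comp ?_
    have := (Complex.continuous_conj.tendsto 0).comp hinv
    rwa [map_zero] at this
  have hC : ∀ w : ℂ, w ≠ 0 → Complex.exp (cauchyT μ w) = 1 + w⁻¹ * k w⁻¹ := by
    intro w hw
    have h1 : cauchyT μ w = w⁻¹ * m w⁻¹ := by
      rw [cauchyT, hm, momentT, ← integral_const_mul]
      refine integral_congr_ae (.of_forall fun x => ?_)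
      have : 1 - w⁻¹ * (x : ℂ) = w⁻¹ * (w - x) := by field_simp
      simp only [this, one_div, mul_inv, inv_inv]
      field_simp
    have h2 := hexp (w⁻¹ * m w⁻¹)
    rw [h1, hk]
    linear_combination -h2
  have hqne : ∀ᶠ w in Bornology.cobounded ℂ ⊓ 𝓟 upperHalf,
      w⁻¹ * k w⁻¹ - conj w⁻¹ * k (conj w⁻¹) ≠ 0 := by
    filter_upwards [hq.eventually_ne one_ne_zero] with w hw h0
    rw [h0, zero_div] at hw
    exact hw rfl
  have e1 : bottomPoint μ = ((((∫ x : ℝ, x ∂μ : ℝ) + 1 / 2) / 1 : ℂ).re, (1 - 1 * 1 / 1 : ℂ).re) := by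
    simp [bottomPoint]; ring
  rw [TendsToBottom, e1]
  refine Tendsto.prodMk_nhds ((Complex.continuous_re.tendsto _).comp ?_)
    ((Complex.continuous_re.tendsto _).comp ?_)
  · refine (hdk.div hq one_ne_zero).congr' ?_
    filter_upwards [hH, hne, hqne] with w hw hw1 hw2
    have hw0 : w ≠ 0 := fun h0 => by simp [h0, upperHalf] at hw
    have hw0' : conj w ≠ 0 := by simpa using hw0
    rw [hC w hw0, hC _ hw0', Pi.div_apply]
    rw [map_inv₀] at hw1 hw2 ⊢
    have hw4 : w - conj w ≠ 0 := sub_conj_ne_zero (ne_of_gt hw)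
    set v := conj w
    generalize k w⁻¹ = k1 at *
    generalize k v⁻¹ = k2 at *
    have e2 : 1 + w⁻¹ * k1 - (1 + v⁻¹ * k2) = w⁻¹ * k1 - v⁻¹ * k2 := by ring
    have e3 : k1 * v - k2 * w ≠ 0 := fun h0 => hw2 (by field_simp; linear_combination h0)
    rw [e2, div_div_div_cancel_right₀ hw1]
    field_simp
    ring
  · refine ((tendsto_const_nhds (x := (1 : ℂ))).sub ((hk1.mul hk2).div hq one_ne_zero)).congr' ?_
    filter_upwards [hH, hne, hqne] with w hw hw1 hw2
    have hw0 : w ≠ 0 := fun h0 => by simp [h0, upperHalf] at hw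
    have hw0' : conj w ≠ 0 := by simpa using hw0
    rw [hC w hw0, hC _ hw0', Pi.div_apply]
    rw [map_inv₀] at hw1 hw2 ⊢
    have hw4 : w - conj w ≠ 0 := sub_conj_ne_zero (ne_of_gt hw)
    set v := conj w
    generalize k w⁻¹ = k1 at *
    generalize k v⁻¹ = k2 at *
    have e2 : 1 + w⁻¹ * k1 - (1 + v⁻¹ * k2) = w⁻¹ * k1 - v⁻¹ * k2 := by ring
    rw [e2, div_div_eq_mul_div]
    have e3 : (w - v) = -(w⁻¹ - v⁻¹) * (w * v) := by field_simp; ring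
    rw [e3]
    field_simp
    ring

/-! ### Measures with a density bounded by one -/

/-- A probability measure with a density `φ ≤ 1` on `[a,b]`, where `a`, `b` belong to the support
and `b - a > 1`. -/
structure IsLimitDensity (φ : ℝ → ℝ) (μ : Measure ℝ) (a b : ℝ) : Prop where
  isProbabilityMeasure : IsProbabilityMeasure μ
  isDensityOf : IsDensityOf φ μ a b
  left_mem : a ∈ μ.support
  right_mem : b ∈ μ.support
  one_lt : 1 < b - a

theorem IsDensityOf.integral_eq {φ : ℝ → ℝ} {μ : Measure ℝ} {a b : ℝ} (h : IsDensityOf φ μ a b)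
    {E : Type*} [NormedAddCommGroup E] [NormedSpace ℝ E] (f : ℝ → E) :
    ∫ x, f x ∂μ = ∫ x, φ x • f x := by
  obtain ⟨hm, h01, -, rfl⟩ := h
  refine (integral_withDensity_eq_integral_smul (f := fun s => (φ s).toNNReal)
    hm.real_toNNReal f).trans (integral_congr_ae (.of_forall fun x => ?_))
  simp [NNReal.smul_def, (h01 x).1]

theorem IsDensityOf.setIntegral_eq {φ : ℝ → ℝ} {μ : Measure ℝ} {a b : ℝ} (h : IsDensityOf φ μ a b)
    {E : Type*} [NormedAddCommGroup E] [NormedSpace ℝ E] (f : ℝ → E) {s : Set ℝ}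
    (hs : MeasurableSet s) : ∫ x in s, f x ∂μ = ∫ x in s, φ x • f x := by
  rw [← integral_indicator hs, h.integral_eq, ← integral_indicator hs]
  congr 1 with x
  by_cases hx : x ∈ s <;> simp [hx]

theorem IsDensityOf.ae_mem_Icc {φ : ℝ → ℝ} {μ : Measure ℝ} {a b : ℝ} (h : IsDensityOf φ μ a b) :
    ∀ᵐ x ∂μ, x ∈ Icc a b := by
  obtain ⟨hm, h01, h0, rfl⟩ := h
  rw [ae_withDensity_iff hm.ennreal_ofReal]
  refine .of_forall fun x hx => ?_
  by_contra hx2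
  simp [h0 x hx2] at hx

theorem IsDensityOf.le_volume {φ : ℝ → ℝ} {μ : Measure ℝ} {a b : ℝ} (h : IsDensityOf φ μ a b) :
    μ ≤ volume := by
  obtain ⟨hm, h01, h0, rfl⟩ := h
  refine (withDensity_mono (.of_forall fun x => ?_)).trans_eq withDensity_one
  simpa using (h01 x).2

theorem integrable_mul_of_compact {σ : ℝ → ℝ} (hσ : Measurable σ) (h1 : ∀ x, |σ x| ≤ 1) {A B : ℝ}
    (h0 : ∀ x, x ∉ Icc A B → σ x = 0) {f : ℝ → ℂ} (hf : Continuous f) :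
    Integrable fun x => (σ x : ℂ) * f x := by
  have h2 : IntegrableOn (fun x => (σ x : ℂ) * f x) (Icc A B) :=
    (hf.continuousOn.integrableOn_compact isCompact_Icc).bdd_mul (c := 1)
      (Complex.measurable_ofReal.comp hσ).aestronglyMeasurable
      (.of_forall fun x => by simpa using h1 x)
  refine (integrableOn_iff_integrable_of_support_subset fun x hx => ?_).1 h2
  by_contra hx2
  simp [h0 x hx2] at hx

theorem integrable_mul_of_compact_real {σ : ℝ → ℝ} (hσ : Measurable σ) (h1 : ∀ x, |σ x| ≤ 1)
    {A B : ℝ} (h0 : ∀ x, x ∉ Icc A B → σ x = 0) {f : ℝ → ℝ} (hf : Continuous f) :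
    Integrable fun x => σ x * f x := by
  have := (integrable_mul_of_compact hσ h1 h0 (Complex.continuous_ofReal.comp hf)).re
  simpa using this

/-- The density of `μ - λ|_(c,χ]`, where `φ` is the density of `μ`. -/
noncomputable def gapDensity (φ : ℝ → ℝ) (c χ : ℝ) (x : ℝ) : ℝ :=
  φ x - (Ioc c χ).indicator (fun _ => 1) x

/-! ### The signed density of `μ` minus Lebesgue measure on an interval -/

section gap

variable {φ : ℝ → ℝ} {μ : Measure ℝ} {a b c χ : ℝ}

theorem gapDensity_nonpos (h : IsDensityOf φ μ a b) {x : ℝ} (hx : x ∈ Ioc c χ) :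
    gapDensity φ c χ x ≤ 0 := by
  simpa [gapDensity, hx] using (h.2.1 x).2

theorem gapDensity_of_notMem {x : ℝ} (hx : x ∉ Ioc c χ) : gapDensity φ c χ x = φ x := by
  simp only [gapDensity, indicator_of_notMem hx, sub_zero]

theorem gapDensity_nonneg (h : IsDensityOf φ μ a b) {x : ℝ} (hx : x ∉ Ioc c χ) :
    0 ≤ gapDensity φ c χ x := by
  rw [gapDensity_of_notMem hx]
  exact (h.2.1 x).1

theorem measurable_gapDensity (h : IsDensityOf φ μ a b) : Measurable (gapDensity φ c χ) :=
  h.1.sub (measurable_const.indicator measurableSet_Ioc)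

theorem abs_gapDensity_le (h : IsDensityOf φ μ a b) (x : ℝ) : |gapDensity φ c χ x| ≤ 1 := by
  have := h.2.1 x
  by_cases hx : x ∈ Ioc c χ
  · rw [abs_of_nonpos (gapDensity_nonpos h hx), gapDensity, indicator_of_mem hx]
    linarith [this.1]
  · rw [gapDensity_of_notMem hx, abs_of_nonneg this.1]
    exact this.2

theorem gapDensity_eq_zero (h : IsDensityOf φ μ a b) {x : ℝ}
    (hx : x ∉ Icc (min a c) (max b χ)) : gapDensity φ c χ x = 0 := by
  have h1 : x ∉ Ioc c χ := fun h1 =>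
    hx ⟨(min_le_right _ _).trans h1.1.le, h1.2.trans (le_max_right _ _)⟩
  have h2 : x ∉ Icc a b := fun h1 =>
    hx ⟨(min_le_left _ _).trans h1.1, h1.2.trans (le_max_left _ _)⟩
  rw [gapDensity_of_notMem h1, h.2.2.1 x h2]

theorem integrable_gap_mul (h : IsDensityOf φ μ a b) {f : ℝ → ℂ} (hf : Continuous f) :
    Integrable fun x => (gapDensity φ c χ x : ℂ) * f x :=
  integrable_mul_of_compact (measurable_gapDensity h) (abs_gapDensity_le h)
    (fun _ => gapDensity_eq_zero h) hf

theorem integrable_gap_mul_real (h : IsDensityOf φ μ a b) {f : ℝ → ℝ} (hf : Continuous f) :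
    Integrable fun x => gapDensity φ c χ x * f x :=
  integrable_mul_of_compact_real (measurable_gapDensity h) (abs_gapDensity_le h)
    (fun _ => gapDensity_eq_zero h) hf

theorem integrable_density_mul (h : IsDensityOf φ μ a b) {f : ℝ → ℂ} (hf : Continuous f) :
    Integrable fun x => (φ x : ℂ) * f x :=
  integrable_mul_of_compact h.1 (fun x => by
    rw [abs_of_nonneg (h.2.1 x).1]; exact (h.2.1 x).2) h.2.2.1 hf

theorem integrable_density_mul_real (h : IsDensityOf φ μ a b) {f : ℝ → ℝ} (hf : Continuous f) :
    Integrable fun x => φ x * f x :=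
  integrable_mul_of_compact_real h.1 (fun x => by
    rw [abs_of_nonneg (h.2.1 x).1]; exact (h.2.1 x).2) h.2.2.1 hf

/-- Otherwise `μ` would be Lebesgue measure on an interval of length one, whose closure cannot
contain both `a` and `b`. -/
theorem not_ae_gapDensity_eq_zero (h : IsLimitDensity φ μ a b) :
    ¬ gapDensity φ c χ =ᵐ[volume] 0 := by
  intro h0
  have := h.isProbabilityMeasure
  have hμ : μ = volume.restrict (Ioc c χ) := by
    rw [h.isDensityOf.2.2.2, ← withDensity_indicator_one measurableSet_Ioc]
    refine withDensity_congr_ae ?_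
    filter_upwards [h0] with x hx
    have hx' : φ x = (Ioc c χ).indicator (fun _ => 1) x := by
      simpa [gapDensity, sub_eq_zero] using hx
    rw [hx']
    by_cases hx2 : x ∈ Ioc c χ <;> simp [hx2]
  have hs : μ.support ⊆ Icc c χ := by
    rw [hμ]
    refine Measure.support_restrict_subset.trans ?_
    exact closure_minimal Ioc_subset_Icc_self isClosed_Icc |>.trans' inter_subset_left
  have h1 : μ univ = 1 := measure_univ
  rw [hμ, Measure.restrict_apply_univ, Real.volume_Ioc, ENNReal.ofReal_eq_one] at h1
  have ha := hs h.left_mem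
  have hb := hs h.right_mem
  linarith [h.one_lt, ha.1, hb.2]

/-- The source of every contradiction below: a weight `Q` with the sign of the gap density cannot
have zero integral against it. -/
theorem integral_gap_mul_pos (h : IsLimitDensity φ μ a b) {Q : ℝ → ℝ} (hQ : Continuous Q)
    (hpos : ∀ᵐ x, 0 ≤ gapDensity φ c χ x * Q x) (hne : ∀ᵐ x, Q x ≠ 0) :
    0 < ∫ x, gapDensity φ c χ x * Q x := by
  refine (integral_nonneg_of_ae hpos).lt_of_ne fun h0 => not_ae_gapDensity_eq_zero h (c := c) (χ := χ) ?_
  rw [eq_comm, integral_eq_zero_iff_of_nonneg_ae hpos (integrable_gap_mul_real h.isDensityOf hQ)] at h0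
  filter_upwards [h0, hne] with x hx hx2
  exact (mul_eq_zero.1 hx).resolve_right hx2

theorem sub_ofReal_ne_zero {w : ℂ} (hw : w.im ≠ 0) (x : ℝ) : w - x ≠ 0 := by
  intro h0
  apply hw
  simpa using congrArg Complex.im h0

theorem continuous_inv_sub {w : ℂ} (hw : w.im ≠ 0) : Continuous fun x : ℝ => 1 / (w - x) :=
  continuous_const.div (by fun_prop) (sub_ofReal_ne_zero hw)

theorem continuous_div_normSq {w : ℂ} (hw : w.im ≠ 0) {f : ℝ → ℝ} (hf : Continuous f) :
    Continuous fun x : ℝ => f x / Complex.normSq (w - x) :=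
  hf.div (Complex.continuous_normSq.comp (by fun_prop))
    fun x => (Complex.normSq_pos.2 (sub_ofReal_ne_zero hw x)).ne'

theorem cauchyT_eq_integral_density (h : IsDensityOf φ μ a b) (w : ℂ) :
    cauchyT μ w = ∫ x : ℝ, (φ x : ℂ) * (1 / (w - x)) := by
  rw [cauchyT, h.integral_eq]
  simp

theorem fDeriv_eq_integral_gap (h : IsDensityOf φ μ a b) {η : ℝ} (hη : η ≤ 1) {w : ℂ}
    (hw : w.im ≠ 0) :
    fDeriv μ χ η w = ∫ x : ℝ, (gapDensity φ (χ + η - 1) χ x : ℂ) * (1 / (w - x)) := by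
  rw [fDeriv, cauchyT_eq_integral_density h, intervalIntegral.integral_of_le (by linarith),
    ← integral_indicator measurableSet_Ioc, ← integral_sub]
  · congr 1 with x
    by_cases hx : x ∈ Ioc (χ + η - 1) χ
    · simp only [gapDensity, indicator_of_mem hx]; push_cast; ring
    · simp only [gapDensity, indicator_of_notMem hx]; push_cast; ring
  · exact integrable_density_mul h (continuous_inv_sub hw)
  · exact (integrable_indicator_iff measurableSet_Ioc).2
      ((continuous_inv_sub hw).integrableOn_Ioc)

/-- Real and imaginary part of the root equation are the cases with numerators `Re w - x` and `Im
w`, which span the real polynomials of degree at most one. -/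
theorem integral_gap_linear_eq_zero (h : IsDensityOf φ μ a b) {w : ℂ} (hw : w.im ≠ 0)
    (h0 : ∫ x : ℝ, (gapDensity φ c χ x : ℂ) * (1 / (w - x)) = 0) (α β : ℝ) :
    ∫ x : ℝ, gapDensity φ c χ x * ((α * x + β) / Complex.normSq (w - x)) = 0 := by
  have hi := integrable_gap_mul h (c := c) (χ := χ) (continuous_inv_sub hw)
  have hre : ∫ x : ℝ, gapDensity φ c χ x * ((w.re - x) / Complex.normSq (w - x)) = 0 := by
    have h1 := integral_re hi
    have h2 := congrArg Complex.re h0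
    rw [Complex.zero_re] at h2
    refine Eq.trans ?_ (h1.trans h2)
    congr 1 with x
    simp
  have him : ∫ x : ℝ, gapDensity φ c χ x * (w.im / Complex.normSq (w - x)) = 0 := by
    have h1 := integral_im hi
    have h2 := congrArg Complex.im h0
    rw [Complex.zero_im] at h2
    rw [← neg_eq_zero, ← integral_neg]
    refine Eq.trans ?_ (h1.trans h2)
    congr 1 with x
    simp [neg_div]
  have e : ∀ x : ℝ, gapDensity φ c χ x * ((α * x + β) / Complex.normSq (w - x)) =
      (-α) * (gapDensity φ c χ x * ((w.re - x) / Complex.normSq (w - x))) +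
      ((α * w.re + β) / w.im) * (gapDensity φ c χ x * (w.im / Complex.normSq (w - x))) := by
    intro x
    have : Complex.normSq (w - x) ≠ 0 := (Complex.normSq_pos.2 (sub_ofReal_ne_zero hw x)).ne'
    field_simp
    ring
  simp_rw [e]
  rw [integral_add, integral_const_mul, integral_const_mul, hre, him]
  · simp
  · exact (integrable_gap_mul_real h (continuous_div_normSq hw (by fun_prop))).const_mul _
  · exact (integrable_gap_mul_real h (continuous_div_normSq hw (by fun_prop))).const_mul _

end gap

/-- Applied with the poles `w₁`, `conj w₁`, `w₂`, `conj w₂` for two roots. The degree of the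
numerator is below four, so there is no polynomial part. -/
theorem exists_partial_fractions_four {K : Type*} [Field K] {z₁ z₂ z₃ z₄ : K} (p q : K)
    (h12 : z₁ - z₂ ≠ 0) (h13 : z₁ - z₃ ≠ 0) (h14 : z₁ - z₄ ≠ 0) (h23 : z₂ - z₃ ≠ 0)
    (h24 : z₂ - z₄ ≠ 0) (h34 : z₃ - z₄ ≠ 0) :
    ∃ A₁ A₂ A₃ A₄ : K, ∀ x, z₁ - x ≠ 0 → z₂ - x ≠ 0 → z₃ - x ≠ 0 → z₄ - x ≠ 0 →
      (x - p) * (x - q) / ((z₁ - x) * (z₂ - x) * ((z₃ - x) * (z₄ - x))) =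
        A₁ * (1 / (z₁ - x)) + A₂ * (1 / (z₂ - x)) + A₃ * (1 / (z₃ - x)) + A₄ * (1 / (z₄ - x)) := by
  refine ⟨-(z₁ - p) * (z₁ - q) / ((z₁ - z₂) * (z₁ - z₃) * (z₁ - z₄)),
    (z₂ - p) * (z₂ - q) / ((z₁ - z₂) * (z₂ - z₃) * (z₂ - z₄)),
    -(z₃ - p) * (z₃ - q) / ((z₁ - z₃) * (z₂ - z₃) * (z₃ - z₄)),
    (z₄ - p) * (z₄ - q) / ((z₁ - z₄) * (z₂ - z₄) * (z₃ - z₄)), fun x h1 h2 h3 h4 => ?_⟩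
  field_simp
  ring

/-! ### Position and uniqueness of the non-real roots -/

section roots

variable {φ : ℝ → ℝ} {μ : Measure ℝ} {a b c χ : ℝ}

theorem normSq_sub_ofReal_pos {w : ℂ} (hw : w.im ≠ 0) (x : ℝ) : 0 < Complex.normSq (w - x) :=
  Complex.normSq_pos.2 (sub_ofReal_ne_zero hw x)

theorem ae_linear_div_ne_zero {w : ℂ} (hw : w.im ≠ 0) {α β : ℝ} (hα : α ≠ 0) :
    ∀ᵐ x : ℝ, (α * x + β) / Complex.normSq (w - x) ≠ 0 := by
  filter_upwards [Measure.ae_ne volume (-β / α)] with x hx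
  refine div_ne_zero (fun h0 => hx ?_) (normSq_sub_ofReal_pos hw x).ne'
  field_simp
  linarith

/-- If `χ ≥ b`, no mass lies beyond `χ`, so the gap density changes sign only at `c` and the weight
`c - x` matches it. -/
theorem lt_right_of_root (h : IsLimitDensity φ μ a b) {w : ℂ} (hw : w.im ≠ 0)
    (h0 : ∫ x : ℝ, (gapDensity φ c χ x : ℂ) * (1 / (w - x)) = 0) : χ < b := by
  by_contra! hb
  have h1 := integral_gap_linear_eq_zero h.isDensityOf hw h0 (-1) c
  refine (integral_gap_mul_pos h (continuous_div_normSq hw (by fun_prop)) ?_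
    (ae_linear_div_ne_zero hw (by norm_num))).ne' h1
  filter_upwards with x
  rw [← mul_div_assoc]
  refine div_nonneg ?_ (Complex.normSq_nonneg _)
  by_cases hx : x ∈ Ioc c χ
  · exact mul_nonneg_of_nonpos_of_nonpos (gapDensity_nonpos h.isDensityOf hx) (by linarith [hx.1])
  · rw [gapDensity_of_notMem hx]
    rcases le_or_gt x c with hxc | hxc
    · exact mul_nonneg (h.isDensityOf.2.1 x).1 (by linarith)
    · rw [h.isDensityOf.2.2.1 x fun h2 => hx ⟨hxc, h2.2.trans hb⟩, zero_mul]

/-- Mirror image: if `c ≤ a`, the only sign change is at `χ`. -/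
theorem left_lt_of_root (h : IsLimitDensity φ μ a b) {w : ℂ} (hw : w.im ≠ 0)
    (h0 : ∫ x : ℝ, (gapDensity φ c χ x : ℂ) * (1 / (w - x)) = 0) : a < c := by
  by_contra! hb
  have h1 := integral_gap_linear_eq_zero h.isDensityOf hw h0 1 (-χ)
  refine (integral_gap_mul_pos h (continuous_div_normSq hw (by fun_prop)) ?_
    (ae_linear_div_ne_zero hw (by norm_num))).ne' h1
  -- When `c = a`, the point `a` lies in `[a,b]` but not in the half-open interval, so it is
  -- discarded as a null set.
  filter_upwards [Measure.ae_ne volume a] with x hxa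
  rw [← mul_div_assoc]
  refine div_nonneg ?_ (Complex.normSq_nonneg _)
  by_cases hx : x ∈ Ioc c χ
  · exact mul_nonneg_of_nonpos_of_nonpos (gapDensity_nonpos h.isDensityOf hx) (by linarith [hx.2])
  · rw [gapDensity_of_notMem hx]
    rcases le_or_gt x χ with hxc | hxc
    · rw [h.isDensityOf.2.2.1 x fun h2 =>
        hx ⟨hb.trans_lt (h2.1.lt_of_ne (Ne.symm hxa)), hxc⟩, zero_mul]
    · exact mul_nonneg (h.isDensityOf.2.1 x).1 (by linarith)

/-- If `χ ≤ c`, the removed interval is empty and the gap density is `φ ≥ 0`; a constant numerator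
suffices. -/
theorem lt_of_root (h : IsLimitDensity φ μ a b) {w : ℂ} (hw : w.im ≠ 0)
    (h0 : ∫ x : ℝ, (gapDensity φ c χ x : ℂ) * (1 / (w - x)) = 0) : c < χ := by
  by_contra! hb
  have h1 := integral_gap_linear_eq_zero h.isDensityOf hw h0 0 1
  refine (integral_gap_mul_pos h (continuous_div_normSq hw (by fun_prop)) ?_ ?_).ne' h1
  · filter_upwards with x
    refine mul_nonneg (gapDensity_nonneg h.isDensityOf (by simp [hb])) (div_nonneg ?_ ?_)
    · simp
    · exact Complex.normSq_nonneg _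
  · filter_upwards with x
    exact div_ne_zero (by simp) (normSq_sub_ofReal_pos hw x).ne'

theorem gapDensity_mul_quadratic_nonneg (h : IsDensityOf φ μ a b) (hc : c ≤ χ) (x : ℝ) :
    0 ≤ gapDensity φ c χ x * ((x - χ) * (x - c)) := by
  by_cases hx : x ∈ Ioc c χ
  · exact mul_nonneg_of_nonpos_of_nonpos (gapDensity_nonpos h hx)
      (mul_nonpos_of_nonpos_of_nonneg (by linarith [hx.2]) (by linarith [hx.1]))
  · refine mul_nonneg (gapDensity_nonneg h hx) ?_
    rcases le_or_gt x c with hxc | hxc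
    · exact mul_nonneg_of_nonpos_of_nonpos (by linarith) (by linarith)
    · have : χ < x := by
        by_contra! h2
        exact hx ⟨hxc, h2⟩
      exact mul_nonneg (by linarith) (by linarith)

theorem ae_quadratic_ne_zero (c χ : ℝ) : ∀ᵐ x : ℝ, (x - χ) * (x - c) ≠ 0 := by
  filter_upwards [Measure.ae_ne volume c, Measure.ae_ne volume χ] with x h1 h2
  exact mul_ne_zero (sub_ne_zero.2 h2) (sub_ne_zero.2 h1)

theorem integral_density_eq_one (h : IsLimitDensity φ μ a b) : ∫ x, φ x = 1 := by
  have := h.isProbabilityMeasure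
  have h1 := h.isDensityOf.integral_eq (fun _ => (1 : ℝ))
  simpa using h1.symm

theorem integral_gap_eq (h : IsLimitDensity φ μ a b) (hc : c ≤ χ) :
    ∫ x, gapDensity φ c χ x = 1 - (χ - c) := by
  have h1 : Integrable φ := by
    simpa using integrable_density_mul_real h.isDensityOf (continuous_const (y := (1 : ℝ)))
  simp only [gapDensity]
  rw [integral_sub h1, integral_density_eq_one h, integral_indicator measurableSet_Ioc]
  · simp [hc]
  · exact (integrable_indicator_iff measurableSet_Ioc).2 (by simp)

/-- Modulo a linear numerator, which integrates to zero at a root, the weight `(x - χ)(x - c)/|w -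
x|²` equals `1`. Its positive integral is therefore the total mass `1 - (χ - c)`. -/
theorem length_lt_one_of_root (h : IsLimitDensity φ μ a b) {w : ℂ} (hw : w.im ≠ 0)
    (h0 : ∫ x : ℝ, (gapDensity φ c χ x : ℂ) * (1 / (w - x)) = 0) : χ - c < 1 := by
  have hc := lt_of_root h hw h0
  -- The coefficients are those of the remainder of `(x - χ)(x - c)` modulo `|w - x|² = x² - 2 (Re
  -- w) x + |w|²`.
  have h1 := integral_gap_linear_eq_zero h.isDensityOf hw h0 (2 * w.re - χ - c)
    (χ * c - Complex.normSq w)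
  have hpos := integral_gap_mul_pos h (c := c) (χ := χ)
    (continuous_div_normSq hw (f := fun x => (x - χ) * (x - c)) (by fun_prop))
    (.of_forall fun x => by
      rw [← mul_div_assoc]
      exact div_nonneg (gapDensity_mul_quadratic_nonneg h.isDensityOf hc.le x)
        (Complex.normSq_nonneg _))
    (by
      filter_upwards [ae_quadratic_ne_zero c χ] with x hx
      exact div_ne_zero hx (normSq_sub_ofReal_pos hw x).ne')
  have e : ∀ x : ℝ, gapDensity φ c χ x * ((x - χ) * (x - c) / Complex.normSq (w - x)) =
      gapDensity φ c χ x + gapDensity φ c χ x *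
        (((2 * w.re - χ - c) * x + (χ * c - Complex.normSq w)) / Complex.normSq (w - x)) := by
    intro x
    have h2 := (normSq_sub_ofReal_pos hw x).ne'
    have h3 : Complex.normSq (w - x) = Complex.normSq w - 2 * w.re * x + x ^ 2 := by
      simp [Complex.normSq_apply]; ring
    field_simp
    rw [h3]
    ring
  simp_rw [e] at hpos
  rw [integral_add, h1, integral_gap_eq h hc.le] at hpos
  · linarith
  · simpa using integrable_gap_mul_real h.isDensityOf (c := c) (χ := χ)
      (continuous_const (y := (1 : ℝ)))
  · exact integrable_gap_mul_real h.isDensityOf (continuous_div_normSq hw (by fun_prop))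

theorem integral_gap_conj_eq_zero {w : ℂ}
    (h0 : ∫ x : ℝ, (gapDensity φ c χ x : ℂ) * (1 / (w - x)) = 0) :
    ∫ x : ℝ, (gapDensity φ c χ x : ℂ) * (1 / (conj w - x)) = 0 := by
  have h1 := congrArg conj h0
  rw [← integral_conj, map_zero] at h1
  rw [← h1]
  congr 1 with x
  simp

/-- For distinct roots the weight `(x - χ)(x - c)/(|w₁ - x|² |w₂ - x|²)` has the sign of the gap
density. By partial fractions its integral is a combination of the four Cauchy integrals at the
roots and their conjugates, all of which vanish. -/
theorem root_unique (h : IsLimitDensity φ μ a b) {w₁ w₂ : ℂ} (hw₁ : 0 < w₁.im) (hw₂ : 0 < w₂.im)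
    (h₁ : ∫ x : ℝ, (gapDensity φ c χ x : ℂ) * (1 / (w₁ - x)) = 0)
    (h₂ : ∫ x : ℝ, (gapDensity φ c χ x : ℂ) * (1 / (w₂ - x)) = 0) : w₁ = w₂ := by
  by_contra hne
  have hc := lt_of_root h hw₁.ne' h₁
  have hpos := integral_gap_mul_pos h (c := c) (χ := χ)
    (Q := fun x => (x - χ) * (x - c) / Complex.normSq (w₁ - x) / Complex.normSq (w₂ - x))
    (continuous_div_normSq hw₂.ne' (continuous_div_normSq hw₁.ne' (by fun_prop)))
    (.of_forall fun x => by
      rw [← mul_div_assoc, ← mul_div_assoc]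
      exact div_nonneg (div_nonneg (gapDensity_mul_quadratic_nonneg h.isDensityOf hc.le x)
        (Complex.normSq_nonneg _)) (Complex.normSq_nonneg _))
    (by
      filter_upwards [ae_quadratic_ne_zero c χ] with x hx
      exact div_ne_zero (div_ne_zero hx (normSq_sub_ofReal_pos hw₁.ne' x).ne')
        (normSq_sub_ofReal_pos hw₂.ne' x).ne')
  refine hpos.ne' ?_
  have him₁ : (conj w₁).im ≠ 0 := by simpa using hw₁.ne'
  have him₂ : (conj w₂).im ≠ 0 := by simpa using hw₂.ne'
  have hcc : ∀ u v : ℂ, 0 < u.im → 0 < v.im → u - conj v ≠ 0 := fun u v hu hv h0 => by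
    have := congrArg Complex.im h0
    simp at this
    linarith
  have hcc' : ∀ u v : ℂ, 0 < u.im → 0 < v.im → conj u - v ≠ 0 := fun u v hu hv h0 => by
    have := congrArg Complex.im h0
    simp at this
    linarith
  obtain ⟨A₁, A₂, A₃, A₄, hA⟩ := exists_partial_fractions_four (χ : ℂ) (c : ℂ)
    (hcc w₁ w₁ hw₁ hw₁) (sub_ne_zero.2 hne) (hcc w₁ w₂ hw₁ hw₂) (hcc' w₁ w₂ hw₁ hw₂)
    (by rw [← map_sub]; exact (map_ne_zero _).2 (sub_ne_zero.2 hne)) (hcc w₂ w₂ hw₂ hw₂)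
  have e : ∀ x : ℝ, ((gapDensity φ c χ x *
      ((x - χ) * (x - c) / Complex.normSq (w₁ - x) / Complex.normSq (w₂ - x)) : ℝ) : ℂ) =
      A₁ * ((gapDensity φ c χ x : ℂ) * (1 / (w₁ - x))) +
      A₂ * ((gapDensity φ c χ x : ℂ) * (1 / (conj w₁ - x))) +
      A₃ * ((gapDensity φ c χ x : ℂ) * (1 / (w₂ - x))) +
      A₄ * ((gapDensity φ c χ x : ℂ) * (1 / (conj w₂ - x))) := fun x => by
    have h3 := hA x (sub_ofReal_ne_zero hw₁.ne' x)
      (sub_ofReal_ne_zero him₁ x) (sub_ofReal_ne_zero hw₂.ne' x) (sub_ofReal_ne_zero him₂ x)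
    have h4 : ∀ u : ℂ, (u - x) * (conj u - x) = (Complex.normSq (u - x) : ℂ) := fun u => by
      rw [← Complex.mul_conj]
      simp
    rw [h4, h4] at h3
    push_cast
    rw [div_div, h3]
    ring
  have hi : ∀ {u : ℂ} (hu : u.im ≠ 0) (A : ℂ), Integrable fun x : ℝ =>
      A * ((gapDensity φ c χ x : ℂ) * (1 / (u - x))) := fun hu A =>
    (integrable_gap_mul h.isDensityOf (continuous_inv_sub hu)).const_mul A
  rw [← Complex.ofReal_eq_zero, ← integral_complex_ofReal]
  simp_rw [e]
  rw [integral_add, integral_add, integral_add, integral_const_mul, integral_const_mul,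
    integral_const_mul, integral_const_mul, h₁, h₂, integral_gap_conj_eq_zero h₁,
    integral_gap_conj_eq_zero h₂]
  · simp
  · exact hi hw₁.ne' _
  · exact hi him₁ _
  · exact (hi hw₁.ne' _).add (hi him₁ _)
  · exact hi hw₂.ne' _
  · exact ((hi hw₁.ne' _).add (hi him₁ _)).add (hi hw₂.ne' _)
  · exact hi him₂ _

end roots

/-! ### Parametrisation of the liquid region by the upper half plane -/

section parametrisation

variable {φ : ℝ → ℝ} {μ : Measure ℝ} {a b : ℝ}

theorem sub_ofReal_mem_slitPlane {w : ℂ} (hw : w.im ≠ 0) (x : ℝ) : w - x ∈ Complex.slitPlane :=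
  Or.inr (by simpa using hw)

theorem integral_inv_sub_eq_log {w : ℂ} (hw : w.im ≠ 0) (c χ : ℝ) :
    ∫ x in c..χ, 1 / (w - (x : ℂ)) = Complex.log (w - c) - Complex.log (w - χ) := by
  have hd : ∀ x : ℝ, HasDerivAt (fun x : ℝ => -Complex.log (w - x)) (1 / (w - x)) x := fun x => by
    have h1 : HasDerivAt (fun x : ℝ => w - (x : ℂ)) (-1) x := by
      simpa using (Complex.ofRealCLM.hasDerivAt (x := x)).const_sub w
    have h2 := (h1.clog_real (sub_ofReal_mem_slitPlane hw x)).neg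
    rw [neg_div, neg_neg] at h2
    exact h2
  rw [intervalIntegral.integral_eq_sub_of_hasDerivAt (fun x _ => hd x)
    ((continuous_inv_sub hw).intervalIntegrable _ _)]
  ring

theorem fDeriv_eq_log {w : ℂ} (hw : w.im ≠ 0) (χ η : ℝ) :
    fDeriv μ χ η w = cauchyT μ w -
      (Complex.log (w - (χ + η - 1 : ℝ)) - Complex.log (w - χ)) := by
  rw [fDeriv, integral_inv_sub_eq_log hw]

theorem arg_mem_Ioo_of_im_pos {z : ℂ} (hz : 0 < z.im) : z.arg ∈ Ioo 0 Real.pi := by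
  refine ⟨(Complex.arg_nonneg_iff.2 hz.le).lt_of_ne fun h0 => ?_,
    Complex.arg_lt_pi_iff.2 (Or.inr hz.ne')⟩
  rw [eq_comm, Complex.arg_eq_zero_iff] at h0
  exact hz.ne' h0.2

theorem im_integral_gap (h : IsDensityOf φ μ a b) {c χ : ℝ} {w : ℂ} (hw : w.im ≠ 0) :
    (∫ x : ℝ, (gapDensity φ c χ x : ℂ) * (1 / (w - x))).im =
      -∫ x : ℝ, gapDensity φ c χ x * (w.im / Complex.normSq (w - x)) := by
  rw [← integral_neg]
  refine (integral_im (integrable_gap_mul h (continuous_inv_sub hw))).symm.trans ?_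
  congr 1 with x
  simp [neg_div]

/-- `-Im C` is the Poisson integral of `φ`, up to scale. It is positive, and comparison with
Lebesgue measure on `(a,b]` bounds it by the angle under which `[a,b]` is seen from `w`, which is
less than `π`. -/
theorem cauchyT_im_mem_Ioo (h : IsLimitDensity φ μ a b) {w : ℂ} (hw : 0 < w.im) :
    (cauchyT μ w).im ∈ Ioo (-Real.pi) 0 := by
  have hgap := fun c χ => im_integral_gap h.isDensityOf (c := c) (χ := χ) hw.ne'
  constructor
  · have h1 := fDeriv_eq_integral_gap h.isDensityOf (χ := b) (η := 1 + a - b)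
      (by linarith [h.one_lt]) hw.ne'
    have e : b + (1 + a - b) - 1 = a := by ring
    have h2 := congrArg Complex.im h1
    rw [fDeriv_eq_log hw.ne', e, hgap] at h2
    have h3 : ∫ x : ℝ, gapDensity φ a b x * (w.im / Complex.normSq (w - x)) ≤ 0 := by
      refine integral_nonpos_of_ae ?_
      filter_upwards [Measure.ae_ne volume a] with x hx
      refine mul_nonpos_of_nonpos_of_nonneg ?_ (div_nonneg hw.le (Complex.normSq_nonneg _))
      by_cases hx2 : x ∈ Ioc a b
      · exact gapDensity_nonpos h.isDensityOf hx2
      · rw [gapDensity_of_notMem hx2, h.isDensityOf.2.2.1 x fun h4 =>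
          hx2 ⟨h4.1.lt_of_ne (Ne.symm hx), h4.2⟩]
    have ha := arg_mem_Ioo_of_im_pos (z := w - a) (by simpa using hw)
    have hb := arg_mem_Ioo_of_im_pos (z := w - b) (by simpa using hw)
    simp only [Complex.sub_im, Complex.log_im] at h2
    linarith [ha.1, hb.2]
  -- With `η = 1` the removed interval is empty, so the gap density is `φ` itself.
  · have h1 := fDeriv_eq_integral_gap h.isDensityOf (χ := b) (η := 1) le_rfl hw.ne'
    have e : b + 1 - 1 = b := by ring
    have h2 := congrArg Complex.im h1
    rw [fDeriv_eq_log hw.ne', e, hgap, sub_self, sub_zero] at h2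
    rw [h2, neg_lt_zero]
    refine integral_gap_mul_pos h (continuous_div_normSq hw.ne' continuous_const) ?_ ?_
    · filter_upwards with x
      exact mul_nonneg (gapDensity_nonneg h.isDensityOf (by simp))
        (div_nonneg hw.le (Complex.normSq_nonneg _))
    · filter_upwards with x
      exact div_ne_zero hw.ne' (normSq_sub_ofReal_pos hw.ne' x).ne'

theorem exp_cauchyT_im_neg (h : IsLimitDensity φ μ a b) {w : ℂ} (hw : 0 < w.im) :
    (Complex.exp (cauchyT μ w)).im < 0 := by
  have h1 := cauchyT_im_mem_Ioo h hw
  rw [Complex.exp_im]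
  exact mul_neg_of_pos_of_neg (Real.exp_pos _) (Real.sin_neg_of_neg_of_neg_pi_lt h1.2 h1.1)

theorem exp_cauchyT_conj (μ : Measure ℝ) (w : ℂ) :
    Complex.exp (cauchyT μ (conj w)) = conj (Complex.exp (cauchyT μ w)) := by
  rw [cauchyT_conj, Complex.exp_conj]

theorem exp_cauchyT_sub_conj_ne_zero (h : IsLimitDensity φ μ a b) {w : ℂ} (hw : 0 < w.im) :
    Complex.exp (cauchyT μ w) - conj (Complex.exp (cauchyT μ w)) ≠ 0 :=
  sub_conj_ne_zero (exp_cauchyT_im_neg h hw).ne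

theorem liquidPoint_fst (h : IsLimitDensity φ μ a b) {w : ℂ} (hw : 0 < w.im) :
    ((liquidPoint μ w).1 : ℂ) = w + (w - conj w) * (conj (Complex.exp (cauchyT μ w)) - 1) /
      (Complex.exp (cauchyT μ w) - conj (Complex.exp (cauchyT μ w))) := by
  have hne := exp_cauchyT_sub_conj_ne_zero h hw
  rw [liquidPoint, exp_cauchyT_conj]
  dsimp only
  refine Complex.conj_eq_iff_re.1 ?_
  set G := Complex.exp (cauchyT μ w)
  have hne' : conj G - G ≠ 0 := fun h0 => hne (by linear_combination -h0)
  simp only [map_add, map_div₀, map_mul, map_sub, Complex.conj_conj, map_one]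
  field_simp
  ring

theorem liquidPoint_snd (h : IsLimitDensity φ μ a b) {w : ℂ} (hw : 0 < w.im) :
    ((liquidPoint μ w).2 : ℂ) = 1 + (w - conj w) * (Complex.exp (cauchyT μ w) - 1) *
        (conj (Complex.exp (cauchyT μ w)) - 1) /
      (Complex.exp (cauchyT μ w) - conj (Complex.exp (cauchyT μ w))) := by
  have hne := exp_cauchyT_sub_conj_ne_zero h hw
  rw [liquidPoint, exp_cauchyT_conj]
  dsimp only
  refine Complex.conj_eq_iff_re.1 ?_
  set G := Complex.exp (cauchyT μ w)
  have hne' : conj G - G ≠ 0 := fun h0 => hne (by linear_combination -h0)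
  simp only [map_add, map_div₀, map_mul, map_sub, Complex.conj_conj, map_one]
  field_simp
  ring

/-- The formula amounts to `η - 1 = Im w · |G - 1|² / Im G` with `Im G < 0`. -/
theorem liquidPoint_snd_lt_one (h : IsLimitDensity φ μ a b) {w : ℂ} (hw : 0 < w.im) :
    (liquidPoint μ w).2 < 1 := by
  have hne := exp_cauchyT_sub_conj_ne_zero h hw
  have him := exp_cauchyT_im_neg h hw
  have h1 := liquidPoint_snd h hw
  set G := Complex.exp (cauchyT μ w)
  have h2 : ((liquidPoint μ w).2 - 1 : ℂ) * (G - conj G) =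
      (w - conj w) * ((G - 1) * conj (G - 1)) := by
    rw [h1, map_sub, map_one]
    field_simp
    ring
  rw [Complex.mul_conj, Complex.sub_conj, Complex.sub_conj] at h2
  have h3 : ((liquidPoint μ w).2 - 1) * (2 * G.im) = 2 * w.im * Complex.normSq (G - 1) := by
    have h4 := congrArg Complex.im h2
    simpa using h4
  have h4 : 0 < Complex.normSq (G - 1) := Complex.normSq_pos.2 fun h0 => him.ne (by
    simpa using congrArg Complex.im h0)
  have h5 : 0 < 2 * w.im * Complex.normSq (G - 1) := by positivity
  nlinarith

/-- The formulas solve `e^C = (w - c)/(w - χ)`, so the logarithms agree up to `2πi n`. Since `Im C ∈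
(-π, 0)` and the two arguments lie in `(0, π)`, only `n = 0` is possible. -/
theorem fDeriv_liquidPoint (h : IsLimitDensity φ μ a b) {w : ℂ} (hw : 0 < w.im) :
    fDeriv μ (liquidPoint μ w).1 (liquidPoint μ w).2 w = 0 := by
  have hne := exp_cauchyT_sub_conj_ne_zero h hw
  have h1 := liquidPoint_fst h hw
  have h2 := liquidPoint_snd h hw
  have hC := cauchyT_im_mem_Ioo h hw
  rw [fDeriv_eq_log hw.ne', sub_eq_zero]
  set χ := (liquidPoint μ w).1
  set η := (liquidPoint μ w).2
  have n1 := sub_ofReal_ne_zero hw.ne' χ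
  have n2 := sub_ofReal_ne_zero hw.ne' (χ + η - 1)
  have hexp : Complex.exp (cauchyT μ w) =
      Complex.exp (Complex.log (w - (χ + η - 1 : ℝ)) - Complex.log (w - χ)) := by
    rw [Complex.exp_sub, Complex.exp_log n1, Complex.exp_log n2, eq_div_iff n1]
    push_cast
    rw [h1, h2]
    field_simp
    ring
  obtain ⟨n, hn⟩ := Complex.exp_eq_exp_iff_exists_int.1 hexp
  have ha := arg_mem_Ioo_of_im_pos (z := w - χ) (by simpa using hw)
  have hb := arg_mem_Ioo_of_im_pos (z := w - (χ + η - 1 : ℝ)) (by simpa using hw)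
  have h3 := congrArg Complex.im hn
  rw [Complex.add_im, Complex.sub_im, Complex.log_im, Complex.log_im] at h3
  have h4 : ((n : ℂ) * (2 * Real.pi * Complex.I)).im = n * (2 * Real.pi) := by simp
  rw [h4] at h3
  have hpi := Real.pi_pos
  have h5 : (n : ℝ) < 1 := by nlinarith [ha.1, ha.2, hb.1, hb.2, hC.1, hC.2]
  have h6 : (-1 : ℝ) < n := by nlinarith [ha.1, ha.2, hb.1, hb.2, hC.1, hC.2]
  have h7 : n = 0 := by
    have h8 : n < 1 := by exact_mod_cast h5
    have h9 : -1 < n := by exact_mod_cast h6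
    omega
  rw [hn, h7]
  simp

/-- The exponentiated root equation and its conjugate are linear in `χ` and `η`; the system is
solvable uniquely because `G` is not real. -/
theorem eq_liquidPoint_of_fDeriv_eq_zero (h : IsLimitDensity φ μ a b) {w : ℂ} (hw : 0 < w.im)
    {p : ℝ × ℝ} (h0 : fDeriv μ p.1 p.2 w = 0) : p = liquidPoint μ w := by
  have hne := exp_cauchyT_sub_conj_ne_zero h hw
  have h1 := liquidPoint_fst h hw
  have h2 := liquidPoint_snd h hw
  obtain ⟨χ, η⟩ := p
  rw [fDeriv_eq_log hw.ne', sub_eq_zero] at h0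
  have n1 := sub_ofReal_ne_zero hw.ne' χ
  have n2 := sub_ofReal_ne_zero hw.ne' (χ + η - 1)
  have hexp : Complex.exp (cauchyT μ w) * (w - χ) = w - (χ + η - 1 : ℝ) := by
    rw [h0, Complex.exp_sub, Complex.exp_log n1, Complex.exp_log n2, div_mul_cancel₀ _ n1]
  have hexp' := congrArg conj hexp
  simp only [map_mul, map_sub, Complex.conj_ofReal] at hexp'
  push_cast at hexp hexp'
  set G := Complex.exp (cauchyT μ w)
  have e1 : (χ : ℂ) = (liquidPoint μ w).1 := by
    rw [h1]
    field_simp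
    linear_combination hexp' - hexp
  have e2 : (η : ℂ) = (liquidPoint μ w).2 := by
    have h3 : (η : ℂ) = 1 + (w - χ) * (1 - G) := by linear_combination hexp
    rw [h3, e1, h1, h2]
    field_simp
    ring
  exact Prod.ext (Complex.ofReal_injective e1) (Complex.ofReal_injective e2)

theorem root_of_liquidPoint (h : IsLimitDensity φ μ a b) {w : ℂ} (hw : 0 < w.im) :
    ∫ x : ℝ, (gapDensity φ ((liquidPoint μ w).1 + (liquidPoint μ w).2 - 1) (liquidPoint μ w).1 x : ℂ)
      * (1 / (w - x)) = 0 := by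
  rw [← fDeriv_eq_integral_gap h.isDensityOf (liquidPoint_snd_lt_one h hw).le hw.ne']
  exact fDeriv_liquidPoint h hw

theorem liquidPoint_injOn (h : IsLimitDensity φ μ a b) : InjOn (liquidPoint μ) upperHalf := by
  intro w hw z hz hwz
  have h1 := root_of_liquidPoint h hw
  rw [hwz] at h1
  exact root_unique h hw hz h1 (root_of_liquidPoint h hz)

/-- Roots come in conjugate pairs, so one in the upper half plane may be chosen. The inequalities
required of `(χ, η)` follow from the existence of a root. -/
theorem liquidRegion_eq_image (h : IsLimitDensity φ μ a b) :
    liquidRegion μ a b = liquidPoint μ '' upperHalf := by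
  ext p
  constructor
  · rintro ⟨-, -, h1, -, w, hw, hf⟩
    rcases hw.lt_or_gt with hw' | hw'
    · have hc : 0 < (conj w).im := by simpa using hw'
      refine ⟨conj w, hc, (eq_liquidPoint_of_fDeriv_eq_zero h hc ?_).symm⟩
      rw [fDeriv_eq_integral_gap h.isDensityOf (by linarith) hw] at hf
      rw [fDeriv_eq_integral_gap h.isDensityOf (by linarith) hc.ne']
      exact integral_gap_conj_eq_zero hf
    · exact ⟨w, hw', (eq_liquidPoint_of_fDeriv_eq_zero h hw' hf).symm⟩
  · rintro ⟨w, hw, rfl⟩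
    have hw' : 0 < w.im := hw
    have h0 := root_of_liquidPoint h hw'
    have h1 := lt_right_of_root h hw'.ne' h0
    have h2 := left_lt_of_root h hw'.ne' h0
    have h3 := lt_of_root h hw'.ne' h0
    have h4 := length_lt_one_of_root h hw'.ne' h0
    exact ⟨⟨by linarith, h1.le⟩, ⟨by linarith, by linarith⟩, h3.le, h2.le, w, hw'.ne',
      fDeriv_liquidPoint h hw'⟩

/-! ### Openness of the liquid region and its boundary -/

theorem isOpen_upperHalf : IsOpen upperHalf := isOpen_lt continuous_const Complex.continuous_im

theorem continuousAt_liquidPoint (h : IsLimitDensity φ μ a b) {w : ℂ} (hw : 0 < w.im) :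
    ContinuousAt (liquidPoint μ) w := by
  have := h.isProbabilityMeasure
  have hne := exp_cauchyT_sub_conj_ne_zero h hw
  rw [← exp_cauchyT_conj] at hne
  have hconj : ContinuousAt (fun z : ℂ => conj z) w := Complex.continuous_conj.continuousAt
  have h1 : ContinuousAt (fun z => Complex.exp (cauchyT μ z)) w :=
    (continuousAt_cauchyT μ hw.ne').cexp
  have h2 : ContinuousAt (fun z => Complex.exp (cauchyT μ (conj z))) w := by
    simp_rw [exp_cauchyT_conj]
    exact Complex.continuous_conj.continuousAt.comp h1
  refine ContinuousAt.prodMk (Complex.continuous_re.continuousAt.comp ?_)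
    (Complex.continuous_re.continuousAt.comp ?_)
  · exact continuousAt_id.add (((continuousAt_id.sub hconj).mul (h2.sub continuousAt_const)).div
      (h1.sub h2) hne)
  · exact continuousAt_const.add ((((continuousAt_id.sub hconj).mul (h1.sub continuousAt_const)).mul
      (h2.sub continuousAt_const)).div (h1.sub h2) hne)

/-- A Rouché-type argument. At `p₀` the only zero of `F p₀` in the half plane is `w₀`, so `F p₀` is
bounded below on the circle; the bound persists for nearby `p`, while `F p w₀` stays small. The
quantitative open mapping theorem then gives a zero of `F p` in the disc. -/
theorem eventually_exists_liquidPoint_eq (h : IsLimitDensity φ μ a b) {w₀ : ℂ} {r : ℝ} (hr : 0 < r)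
    (hball : Metric.closedBall w₀ r ⊆ upperHalf) :
    ∀ᶠ p in 𝓝 (liquidPoint μ w₀), ∃ w ∈ Metric.closedBall w₀ r, liquidPoint μ w = p := by
  have := h.isProbabilityMeasure
  -- The logarithmic form makes joint continuity and holomorphy in `w` visible.
  set F : ℝ × ℝ → ℂ → ℂ := fun p w => cauchyT μ w -
      (Complex.log (w - (p.1 + p.2 - 1 : ℝ)) - Complex.log (w - p.1)) with hF
  have hFf : ∀ p (w : ℂ), 0 < w.im → F p w = fDeriv μ p.1 p.2 w := fun p w hw =>
    (fDeriv_eq_log hw.ne' p.1 p.2).symm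
  have hw₀ : 0 < w₀.im := hball (Metric.mem_closedBall_self hr.le)
  have hsph : Metric.sphere w₀ r ⊆ upperHalf := Metric.sphere_subset_closedBall.trans hball
  have hcont : ∀ q : (ℝ × ℝ) × ℂ, 0 < q.2.im → ContinuousAt (fun q : (ℝ × ℝ) × ℂ => F q.1 q.2) q := by
    intro q hq
    refine ContinuousAt.sub ((continuousAt_cauchyT μ hq.ne').comp continuousAt_snd)
      (ContinuousAt.sub (ContinuousAt.clog (by fun_prop) (sub_ofReal_mem_slitPlane hq.ne' _))
        (ContinuousAt.clog (by fun_prop) (sub_ofReal_mem_slitPlane hq.ne' _)))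
  have hdiff : ∀ p, DifferentiableOn ℂ (F p) upperHalf := by
    intro p w hw
    have hw' : w.im ≠ 0 := ne_of_gt hw
    refine DifferentiableAt.differentiableWithinAt ?_
    exact (differentiableAt_cauchyT μ hw').sub
      (((differentiableAt_id.sub_const _).clog (sub_ofReal_mem_slitPlane hw' _)).sub
      ((differentiableAt_id.sub_const _).clog (sub_ofReal_mem_slitPlane hw' _)))
  set p₀ := liquidPoint μ w₀ with hp₀
  have hzero : F p₀ w₀ = 0 := by rw [hFf _ _ hw₀]; exact fDeriv_liquidPoint h hw₀
  have hnz : ∀ z ∈ Metric.sphere w₀ r, F p₀ z ≠ 0 := by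
    intro z hz h0
    have hz' : 0 < z.im := hsph hz
    rw [hFf _ _ hz'] at h0
    have h1 := liquidPoint_injOn h hw₀ hz' (eq_liquidPoint_of_fDeriv_eq_zero h hz' h0)
    rw [← h1, Metric.mem_sphere, dist_self] at hz
    exact hr.ne hz
  obtain ⟨z₁, hz₁, hmin⟩ := (isCompact_sphere w₀ r).exists_isMinOn
    (NormedSpace.sphere_nonempty.2 hr.le) (f := fun z => ‖F p₀ z‖) (by
      refine ContinuousOn.norm fun z hz => ((hdiff p₀).continuousOn z (hsph hz)).mono hsph)
  have hε : 0 < ‖F p₀ z₁‖ := norm_pos_iff.2 (hnz z₁ hz₁)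
  set ε := ‖F p₀ z₁‖ / 2 with hεdef
  have hε' : 0 < ε := by positivity
  have hev1 : ∀ᶠ p in 𝓝 p₀, ∀ z ∈ Metric.sphere w₀ r, ε < ‖F p z‖ := by
    refine (isCompact_sphere w₀ r).eventually_forall_of_forall_eventually fun z hz => ?_
    refine (hcont (p₀, z) (hsph hz)).norm.eventually (lt_mem_nhds ?_)
    have : ‖F p₀ z₁‖ ≤ ‖F p₀ z‖ := hmin hz
    change ε < ‖F p₀ z‖
    linarith
  have hev2 : ∀ᶠ p in 𝓝 p₀, ‖F p w₀‖ < ε / 3 := by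
    have h1 : ContinuousAt (fun p => F p w₀) p₀ :=
      ContinuousAt.comp (f := fun p => (p, w₀)) (hcont (p₀, w₀) hw₀) (by fun_prop)
    refine h1.norm.eventually (gt_mem_nhds ?_)
    change ‖F p₀ w₀‖ < ε / 3
    rw [hzero, norm_zero]
    positivity
  filter_upwards [hev1, hev2] with p hp1 hp2
  have hlow : ∀ z ∈ Metric.sphere w₀ r, 2 * ε / 3 ≤ ‖F p z - F p w₀‖ := fun z hz => by
    have := norm_sub_norm_le (F p z) (F p w₀)
    linarith [hp1 z hz]
  -- Were `F p` constant near `w₀`, it would be constant on the half plane by the identity theorem,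
  -- against the lower bound on the circle.
  have hfreq : ∃ᶠ z in 𝓝 w₀, F p z ≠ F p w₀ := by
    intro hev
    have hev' : F p =ᶠ[𝓝 w₀] fun _ => F p w₀ := by
      filter_upwards [hev] with z hz using not_not.1 hz
    have h1 := ((hdiff p).analyticOnNhd isOpen_upperHalf).eqOn_of_preconnected_of_eventuallyEq
      analyticOnNhd_const (convex_halfSpace_im_gt 0).isPreconnected hw₀ hev' (hsph hz₁)
    have h2 := hlow z₁ hz₁
    rw [h1, sub_self, norm_zero] at h2
    linarith
  have hdc : DiffContOnCl ℂ (F p) (Metric.ball w₀ r) :=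
    (hdiff p).diffContOnCl_ball hball
  obtain ⟨w, hw, hw0⟩ := hdc.ball_subset_image_closedBall hr hlow hfreq
    (show (0 : ℂ) ∈ Metric.ball (F p w₀) (2 * ε / 3 / 2) by
      rw [Metric.mem_ball, dist_zero_left]; linarith)
  have hw' : 0 < w.im := hball hw
  rw [hFf _ _ hw'] at hw0
  exact ⟨w, hw, (eq_liquidPoint_of_fDeriv_eq_zero h hw' hw0).symm⟩

theorem isOpen_liquidRegion (h : IsLimitDensity φ μ a b) : IsOpen (liquidRegion μ a b) := by
  rw [liquidRegion_eq_image h, isOpen_iff_eventually]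
  rintro _ ⟨w, hw, rfl⟩
  obtain ⟨r, hr, hball⟩ := Metric.nhds_basis_closedBall.mem_iff.1 (isOpen_upperHalf.mem_nhds hw)
  filter_upwards [eventually_exists_liquidPoint_eq h hr hball] with p hp
  obtain ⟨z, hz, hzp⟩ := hp
  exact ⟨z, hball hz, hzp⟩

/-- If the limit were the image of some `w₀`, values close to it would have preimages in a fixed
closed ball around `w₀`. Injectivity would then keep `w` in that ball, although `w` eventually
leaves it. -/
theorem mem_frontier_liquidRegion (h : IsLimitDensity φ μ a b) {l : Filter ℂ} [l.NeBot]
    (hl : l ≤ 𝓟 upperHalf)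
    (hesc : ∀ w₀ r, Metric.closedBall w₀ r ⊆ upperHalf → ∀ᶠ w in l, w ∉ Metric.closedBall w₀ r)
    {p : ℝ × ℝ} (hp : Tendsto (liquidPoint μ) l (𝓝 p)) : p ∈ frontier (liquidRegion μ a b) := by
  have hlH : ∀ᶠ w in l, w ∈ upperHalf := le_principal_iff.1 hl
  rw [frontier, (isOpen_liquidRegion h).interior_eq, liquidRegion_eq_image h]
  refine ⟨mem_closure_of_tendsto hp (hlH.mono fun w hw => mem_image_of_mem _ hw), ?_⟩
  rintro ⟨w₀, hw₀, rfl⟩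
  obtain ⟨r, hr, hball⟩ := Metric.nhds_basis_closedBall.mem_iff.1 (isOpen_upperHalf.mem_nhds hw₀)
  obtain ⟨w, hw1, hw2, z, hz, hzw⟩ := (hlH.and ((hesc w₀ r hball).and
    (hp.eventually (eventually_exists_liquidPoint_eq h hr hball)))).exists
  exact hw2 (liquidPoint_injOn h (hball hz) hw1 hzw ▸ hz)

theorem ofReal_mem_closure_upperHalf (t : ℝ) : (t : ℂ) ∈ closure upperHalf := by
  have : upperHalf = {z : ℂ | 0 < z.im} := rfl
  rw [this, Complex.closure_setOfPred_lt_im]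
  simp

instance neBot_nhdsWithin_upperHalf (t : ℝ) : (𝓝[upperHalf] (t : ℂ)).NeBot :=
  mem_closure_iff_nhdsWithin_neBot.1 (ofReal_mem_closure_upperHalf t)

instance neBot_cobounded_inf_upperHalf : (Bornology.cobounded ℂ ⊓ 𝓟 upperHalf).NeBot := by
  refine inf_principal_neBot_iff.2 fun s hs => ?_
  have h1 : Tendsto (fun y : ℝ => (y : ℂ) * Complex.I) atTop (Bornology.cobounded ℂ) := by
    rw [← tendsto_norm_atTop_iff_cobounded]
    simpa using tendsto_abs_atTop_atTop
  obtain ⟨y, hy, hy0⟩ := ((h1.eventually hs).and (eventually_gt_atTop 0)).exists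
  exact ⟨_, hy, by simpa [upperHalf] using hy0⟩

/-- A boundary point is a limit along an ultrafilter on the half plane, which either tends to
infinity or converges in the closed half plane. An interior limit is excluded by continuity, since
the open region misses its frontier. -/
theorem frontier_liquidRegion_eq (h : IsLimitDensity φ μ a b) (hbot : TendsToBottom μ)
    {q : ℝ → ℝ × ℝ}
    (hq : ∀ t : ℝ, Tendsto (liquidPoint μ) (𝓝[upperHalf] (t : ℂ)) (𝓝 (q t))) :
    frontier (liquidRegion μ a b) = {bottomPoint μ} ∪ range q := by
  refine Subset.antisymm ?_ ?_
  · intro p hp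
    rw [frontier, (isOpen_liquidRegion h).interior_eq, liquidRegion_eq_image h] at hp
    obtain ⟨hp1, hp2⟩ := hp
    have hne : (comap (liquidPoint μ) (𝓝 p) ⊓ 𝓟 upperHalf).NeBot := by
      refine inf_principal_neBot_iff.2 fun s hs => ?_
      obtain ⟨u, hu, hus⟩ := hs
      obtain ⟨_, hx1, w, hw, rfl⟩ := mem_closure_iff_nhds.1 hp1 u hu
      exact ⟨w, hus hx1, hw⟩
    set U := Ultrafilter.of (comap (liquidPoint μ) (𝓝 p) ⊓ 𝓟 upperHalf) with hU
    have hUle : (U : Filter ℂ) ≤ comap (liquidPoint μ) (𝓝 p) ⊓ 𝓟 upperHalf := Ultrafilter.of_le _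
    have hUp : Tendsto (liquidPoint μ) U (𝓝 p) := tendsto_iff_comap.2 (hUle.trans inf_le_left)
    have hUH : (U : Filter ℂ) ≤ 𝓟 upperHalf := hUle.trans inf_le_right
    by_cases hcob : (U : Filter ℂ) ≤ Bornology.cobounded ℂ
    · left
      exact tendsto_nhds_unique hUp (hbot.mono_left (le_inf hcob hUH))
    · have hb : ∃ s : Set ℂ, Bornology.IsBounded s ∧ s ∈ U := by
        rw [Filter.not_le] at hcob
        obtain ⟨s, hs, hsU⟩ := hcob
        exact ⟨sᶜ, Bornology.isBounded_compl_iff.2 hs, Ultrafilter.compl_mem_iff_notMem.2 hsU⟩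
      obtain ⟨s, hs, hsU⟩ := hb
      obtain ⟨z, -, hz⟩ := isCompact_iff_ultrafilter_le_nhds.1 hs.isCompact_closure U
        (le_principal_iff.2 (mem_of_superset hsU subset_closure))
      have hzim : 0 ≤ z.im := by
        have h1 : z ∈ closure upperHalf :=
          mem_closure_iff_ultrafilter.2 ⟨U, le_principal_iff.1 hUH, hz⟩
        have h2 : upperHalf = {z : ℂ | 0 < z.im} := rfl
        rwa [h2, Complex.closure_setOfPred_lt_im] at h1
      rcases hzim.lt_or_eq with hpos | h0
      · exact absurd ⟨z, hpos, tendsto_nhds_unique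
          ((continuousAt_liquidPoint h hpos).tendsto.mono_left hz) hUp⟩ hp2
      · right
        have hzr : z = (z.re : ℂ) := Complex.ext rfl (by simpa using h0.symm)
        refine ⟨z.re, tendsto_nhds_unique ((hq z.re).mono_left ?_) hUp⟩
        rw [← hzr]
        exact le_inf hz hUH
  · rintro p (rfl | ⟨t, rfl⟩)
    · refine mem_frontier_liquidRegion h inf_le_right ?_ hbot
      intro w₀ r _
      exact mem_inf_of_left (Bornology.isBounded_def.1 Metric.isBounded_closedBall)
    · refine mem_frontier_liquidRegion h (l := 𝓝[upperHalf] (t : ℂ)) inf_le_right ?_ (hq t)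
      intro w₀ r hball
      refine mem_nhdsWithin_of_mem_nhds (Metric.isClosed_closedBall.isOpen_compl.mem_nhds ?_)
      intro ht
      have : (0 : ℝ) < (t : ℂ).im := hball ht
      simp at this

end parametrisation

/-! ### The edge curve as boundary limit -/

theorem cauchyT_ofReal (ν : Measure ℝ) (t : ℝ) :
    cauchyT ν t = ((∫ x, 1 / (t - x) ∂ν : ℝ) : ℂ) := by
  rw [cauchyT, ← integral_complex_ofReal]
  congr 1 with x
  push_cast
  rfl

theorem integral_neg_one_div_sq (ν : Measure ℝ) (t : ℝ) :
    ∫ x : ℝ, -1 / ((t : ℂ) - x) ^ 2 ∂ν = ((-∫ x, 1 / (t - x) ^ 2 ∂ν : ℝ) : ℂ) := by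
  rw [← integral_neg, ← integral_complex_ofReal]
  congr 1 with x
  push_cast
  ring

theorem hasStrictDerivAt_sub_div_sub (l : ℂ) {r z : ℂ} (hr : z - r ≠ 0) :
    HasStrictDerivAt (fun w => (w - l) / (w - r)) ((l - r) / (z - r) ^ 2) z := by
  have h1 : HasDerivAt (fun w => (w - l) / (w - r)) ((1 * (z - r) - (z - l) * 1) / (z - r) ^ 2) z :=
    ((hasDerivAt_id z).sub_const l).div ((hasDerivAt_id z).sub_const r) hr
  have h2 : AnalyticAt ℂ (fun w => (w - l) / (w - r)) z :=
    (analyticAt_id.sub analyticAt_const).div (analyticAt_id.sub analyticAt_const) hr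
  have h3 := h2.hasStrictDerivAt
  rw [h1.deriv] at h3
  exact h3.congr_deriv (by ring)

section edge

variable {φ : ℝ → ℝ} {μ : Measure ℝ} {a b : ℝ}

theorem measure_eq_zero_of_subset_voidSet {s : Set ℝ} (hs : s ⊆ voidSet μ) : μ s = 0 :=
  measure_mono_null hs Measure.measure_compl_support

/-- Restrict the decomposition `λ = (λ - μ) + μ`: the first summand has no mass on `s`. -/
theorem restrict_eq_of_subset_fullSet [IsFiniteMeasure μ] (hμ : μ ≤ volume) {s : Set ℝ}
    (hs : s ⊆ fullSet μ) : μ.restrict s = volume.restrict s := by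
  have h0 : (volume - μ).restrict s = 0 :=
    Measure.restrict_eq_zero.2 (measure_mono_null hs Measure.measure_compl_support)
  conv_rhs => rw [← Measure.sub_add_cancel_of_le hμ, Measure.restrict_add, h0, zero_add]

theorem ae_ne_of_le_volume (hμ : μ ≤ volume) (t : ℝ) : ∀ᵐ x ∂μ, x ≠ t :=
  (Measure.absolutelyContinuous_of_le hμ).ae_le (Measure.ae_ne volume t)

/-- Lebesgue measure on an interval contributes logarithms, whose exponential is a Möbius function;
this continues `e^C` across the axis. The set `I` may exceed `(l, r)`, so that one statement also
covers intervals that are full on one side of `t` and void on the other. -/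
theorem cauchyT_eq_of_restrict_eq [IsFiniteMeasure μ] {I : Set ℝ} (hI : MeasurableSet I)
    {l r : ℝ} (hlr : l ≤ r) (h : μ.restrict I = volume.restrict (Ioo l r)) {w : ℂ} (hw : w.im ≠ 0) :
    cauchyT μ w = cauchyT (μ.restrict Iᶜ) w + (Complex.log (w - l) - Complex.log (w - r)) := by
  rw [cauchyT, ← integral_add_compl hI (integrable_inv_sub_of_im_ne_zero μ hw), h,
    ← integral_inv_sub_eq_log hw, intervalIntegral.integral_of_le hlr,
    ← integral_Ioc_eq_integral_Ioo, add_comm]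
  rfl

theorem exp_log_sub_log {w : ℂ} (hw : w.im ≠ 0) (l r : ℝ) :
    Complex.exp (Complex.log (w - l) - Complex.log (w - r)) = (w - l) / (w - r) := by
  rw [Complex.exp_sub, Complex.exp_log (sub_ofReal_ne_zero hw l),
    Complex.exp_log (sub_ofReal_ne_zero hw r)]

theorem hasStrictDerivAt_cauchyT_restrict [IsFiniteMeasure μ] {t t₂ t₁ : ℝ}
    (ht : t ∈ Ioo t₂ t₁) :
    HasStrictDerivAt (cauchyT (μ.restrict (Ioo t₂ t₁)ᶜ)) ((cauchyOffDeriv μ t₂ t₁ t : ℝ) : ℂ) t := by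
  rw [cauchyOffDeriv, ← integral_neg_one_div_sq]
  refine hasStrictDerivAt_cauchyT _ (r := min (t - t₂) (t₁ - t))
    (lt_min (sub_pos.2 ht.1) (sub_pos.2 ht.2)) ?_
  filter_upwards [ae_restrict_mem measurableSet_Ioo.compl] with x hx
  rw [← Complex.ofReal_sub, Complex.norm_real, Real.norm_eq_abs]
  rcases le_or_gt x t₂ with h1 | h1
  · exact (min_le_left _ _).trans ((by linarith : t - t₂ ≤ t - x).trans (le_abs_self _))
  · have h2 : t₁ ≤ x := by
      by_contra! h2
      exact hx ⟨h1, h2⟩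
    exact (min_le_right _ _).trans ((by linarith : t₁ - t ≤ -(t - x)).trans (neg_le_abs _))

theorem cauchyT_restrict_ofReal (t₂ t₁ t : ℝ) :
    cauchyT (μ.restrict (Ioo t₂ t₁)ᶜ) t = ((cauchyOff μ t₂ t₁ t : ℝ) : ℂ) :=
  cauchyT_ofReal _ t

theorem eventually_upperHalf_and_conj {t : ℝ} {P : ℂ → Prop} (h : ∀ w : ℂ, w.im ≠ 0 → P w) :
    ∀ᶠ w in 𝓝[upperHalf] (t : ℂ), P w ∧ P (conj w) := by
  filter_upwards [self_mem_nhdsWithin] with w hw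
  have hw' : 0 < w.im := hw
  exact ⟨h w hw'.ne', h _ (by simpa using hw'.ne')⟩

theorem tendsto_liquidPoint_edgeFormula {t E C' : ℝ} (hE : E ≠ 0) (hC' : C' ≠ 0) {g : ℂ → ℂ}
    (hg : HasStrictDerivAt g (E * C' : ℝ) t) (hgt : g t = E)
    (h : ∀ w : ℂ, w.im ≠ 0 → Complex.exp (cauchyT μ w) = g w) :
    Tendsto (liquidPoint μ) (𝓝[upperHalf] (t : ℂ)) (𝓝 (edgeFormula t E C')) := by
  have h1 := tendsto_liquidPoint_of_exp hg (Complex.ofReal_ne_zero.2 (mul_ne_zero hE hC'))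
    (eventually_upperHalf_and_conj h)
  rw [hgt] at h1
  refine h1.trans_eq ?_
  rw [edgeFormula]
  congr 2
  · exact_mod_cast Complex.ofReal_re (t + (E - 1) / (E * C'))
  · exact_mod_cast Complex.ofReal_re (1 + (E - 1) ^ (2 : ℕ) / (E * C'))

/-- `C` is analytic near `t`, and `C'(t)` is minus the integral of a positive function against a
non-zero measure. -/
theorem tendsto_liquidPoint_of_mem_voidSet [IsProbabilityMeasure μ] {t : ℝ} (ht : t ∈ voidSet μ) :
    Tendsto (liquidPoint μ) (𝓝[upperHalf] (t : ℂ)) (𝓝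
      (edgeFormula t (Real.exp (∫ x, 1 / (t - x) ∂μ)) (- ∫ x, 1 / (t - x) ^ 2 ∂μ))) := by
  obtain ⟨r, hr, hball⟩ := Metric.isOpen_iff.1 (Measure.isOpen_compl_support (μ := μ)) t ht
  have hae : ∀ᵐ x ∂μ, r ≤ |t - x| := by
    filter_upwards [measure_eq_zero_iff_ae_notMem.1 (measure_eq_zero_of_subset_voidSet hball)]
      with x hx
    rw [Metric.mem_ball, dist_comm, Real.dist_eq] at hx
    exact not_lt.1 hx
  have hae' : ∀ᵐ x : ℝ ∂μ, r ≤ ‖(t : ℂ) - x‖ := by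
    filter_upwards [hae] with x hx
    rwa [← Complex.ofReal_sub, Complex.norm_real]
  have hC' : - ∫ x, 1 / (t - x) ^ 2 ∂μ ≠ 0 := by
    rw [neg_ne_zero]
    intro h0
    have hi : Integrable (fun x => 1 / (t - x) ^ 2) μ := by
      refine Integrable.of_bound (C := 1 / r ^ 2)
        (Measurable.aestronglyMeasurable (by fun_prop)) ?_
      filter_upwards [hae] with x hx
      rw [norm_div, norm_one, norm_pow]
      exact one_div_le_one_div_of_le (by positivity) (pow_le_pow_left₀ hr.le hx 2)
    rw [integral_eq_zero_iff_of_nonneg (fun x => by positivity) hi] at h0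
    obtain ⟨x, hx1, hx2⟩ := (h0.and hae).exists
    have : t - x ≠ 0 := abs_pos.1 (hr.trans_le hx2)
    have h3 : 1 / (t - x) ^ 2 = 0 := hx1
    exact absurd h3 (by positivity)
  refine tendsto_liquidPoint_edgeFormula (Real.exp_pos _).ne' hC'
    (g := fun w => Complex.exp (cauchyT μ w)) ?_ ?_ fun _ _ => rfl
  · have h1 := (hasStrictDerivAt_cauchyT μ hr hae').cexp
    rw [integral_neg_one_div_sq, cauchyT_ofReal] at h1
    exact_mod_cast h1
  · rw [cauchyT_ofReal]
    exact_mod_cast rfl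

theorem setIntegral_inv_sq_eq {t l r : ℝ} (hlr : l ≤ r) (ht : t ∉ Icc l r) :
    ∫ x in Icc l r, 1 / (t - x) ^ 2 = 1 / (t - r) - 1 / (t - l) ∧
      IntegrableOn (fun x => 1 / (t - x) ^ 2) (Icc l r) := by
  have hne : ∀ x ∈ Icc l r, t - x ≠ 0 := fun x hx h0 => ht (by rwa [sub_eq_zero.1 h0])
  have hc : ContinuousOn (fun x => 1 / (t - x) ^ 2) (Icc l r) :=
    continuousOn_const.div (by fun_prop) fun x hx => pow_ne_zero 2 (hne x hx)
  refine ⟨?_, hc.integrableOn_Icc⟩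
  rw [integral_Icc_eq_integral_Ioc, ← intervalIntegral.integral_of_le hlr,
    intervalIntegral.integral_eq_sub_of_hasDerivAt (f := fun x => 1 / (t - x))]
  · intro x hx
    rw [uIcc_of_le hlr] at hx
    have := ((hasDerivAt_id x).const_sub t).inv (hne x hx)
    simpa [Pi.inv_def] using this
  · exact ContinuousOn.intervalIntegrable (by rwa [uIcc_of_le hlr])

/-- As `μ ≤ λ`, the integral of `1/(t - x)²` off `I` is at most the Lebesgue integral over `[A, t₂]
∪ [t₁, B]`. Over the whole complement the latter would be `1/(t - t₂) - 1/(t - t₁)`; the tails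
beyond the finite cut-offs `A`, `B` make the inequality strict. -/
theorem cauchyOffDeriv_add_pos (h : IsLimitDensity φ μ a b) {t t₂ t₁ : ℝ} (ht : t ∈ Ioo t₂ t₁) :
    0 < cauchyOffDeriv μ t₂ t₁ t - 1 / (t - t₁) + 1 / (t - t₂) := by
  set A := min a t₂ - 1
  set B := max b t₁ + 1
  have hAa : A < a := by have := min_le_left a t₂; simp only [A]; linarith
  have hAt : A < t₂ := by have := min_le_right a t₂; simp only [A]; linarith
  have hBb : b < B := by have := le_max_left b t₁; simp only [B]; linarith
  have hBt : t₁ < B := by have := le_max_right b t₁; simp only [B]; linarith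
  obtain ⟨e1, i1⟩ := setIntegral_inv_sq_eq (t := t) hAt.le fun h1 => ht.1.not_ge h1.2
  obtain ⟨e2, i2⟩ := setIntegral_inv_sq_eq (t := t) hBt.le fun h1 => ht.2.not_ge h1.1
  have hle : μ.restrict (Ioo t₂ t₁)ᶜ ≤ volume.restrict (Icc A t₂ ∪ Icc t₁ B) := by
    have h1 : μ.restrict (Ioo t₂ t₁)ᶜ = μ.restrict ((Ioo t₂ t₁)ᶜ ∩ Icc a b) := by
      refine Measure.restrict_congr_set ?_
      filter_upwards [h.isDensityOf.ae_mem_Icc] with x hx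
      exact propext ⟨fun h2 => ⟨h2, hx⟩, fun h2 => h2.1⟩
    rw [h1]
    refine Measure.restrict_mono (fun x hx => ?_) h.isDensityOf.le_volume
    rcases le_or_gt x t₂ with h2 | h2
    · exact Or.inl ⟨hAa.le.trans hx.2.1, h2⟩
    · refine Or.inr ⟨?_, hx.2.2.trans hBb.le⟩
      by_contra! h3
      exact hx.1 ⟨h2, h3⟩
  have h1 : ∫ x in (Ioo t₂ t₁)ᶜ, 1 / (t - x) ^ 2 ∂μ ≤
      ∫ x in Icc A t₂ ∪ Icc t₁ B, 1 / (t - x) ^ 2 :=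
    integral_mono_measure hle (.of_forall fun x => by positivity) (i1.union i2)
  rw [setIntegral_union (Set.disjoint_left.2 fun x h3 h4 => by linarith [h3.2, h4.1, ht.1, ht.2])
    measurableSet_Icc i1 i2, e1, e2] at h1
  have h2 : 0 < 1 / (t - A) := one_div_pos.2 (by linarith [ht.1])
  have h3 : 1 / (t - B) < 0 := one_div_neg.2 (by linarith [ht.2])
  rw [cauchyOffDeriv]
  linarith

theorem tendsto_liquidPoint_of_full (h : IsLimitDensity φ μ a b) {t t₂ t₁ : ℝ}
    (ht : t ∈ Ioo t₂ t₁) (hI : Ioo t₂ t₁ ⊆ fullSet μ) :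
    Tendsto (liquidPoint μ) (𝓝[upperHalf] (t : ℂ)) (𝓝
      (edgeFormula t (Real.exp (cauchyOff μ t₂ t₁ t) * ((t - t₂) / (t - t₁)))
        (cauchyOffDeriv μ t₂ t₁ t - 1 / (t - t₁) + 1 / (t - t₂)))) := by
  have := h.isProbabilityMeasure
  have n2 : t - t₂ ≠ 0 := (sub_pos.2 ht.1).ne'
  have n1 : t - t₁ ≠ 0 := (sub_neg.2 ht.2).ne
  have n2' : (t : ℂ) - t₂ ≠ 0 := by exact_mod_cast n2
  have n1' : (t : ℂ) - t₁ ≠ 0 := by exact_mod_cast n1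
  refine tendsto_liquidPoint_edgeFormula (mul_ne_zero (Real.exp_pos _).ne' (div_ne_zero n2 n1))
    (cauchyOffDeriv_add_pos h ht).ne'
    (g := fun w => Complex.exp (cauchyT (μ.restrict (Ioo t₂ t₁)ᶜ) w) * ((w - t₂) / (w - t₁)))
    ?_ ?_ fun w hw => ?_
  · have h1 := ((hasStrictDerivAt_cauchyT_restrict (μ := μ) ht).cexp).mul
      (hasStrictDerivAt_sub_div_sub (t₂ : ℂ) n1')
    refine h1.congr_deriv ?_
    rw [cauchyT_restrict_ofReal]
    push_cast
    field_simp
    ring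
  · simp only [cauchyT_restrict_ofReal]
    push_cast
    rfl
  · rw [cauchyT_eq_of_restrict_eq measurableSet_Ioo (ht.1.trans ht.2).le
      (restrict_eq_of_subset_fullSet h.isDensityOf.le_volume hI) hw, Complex.exp_add,
      exp_log_sub_log hw]

/-- The right end of the full interval is a simple pole of `e^C`, hence a simple zero of `e^{-C}`.
-/
theorem tendsto_liquidPoint_of_fullVoid (h : IsLimitDensity φ μ a b) {t t₂ t₁ : ℝ}
    (hI : IsFullVoidInterval μ t t₂ t₁) :
    Tendsto (liquidPoint μ) (𝓝[upperHalf] (t : ℂ))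
      (𝓝 (t, 1 - Real.exp (cauchyOff μ t₂ t₁ t) * (t - t₂))) := by
  have := h.isProbabilityMeasure
  obtain ⟨h2, h1, hv, hf⟩ := hI
  have n2 : (t : ℂ) - t₂ ≠ 0 := by exact_mod_cast (sub_pos.2 h2).ne'
  have hr : μ.restrict (Ioo t₂ t₁) = volume.restrict (Ioo t₂ t) := by
    rw [← restrict_eq_of_subset_fullSet h.isDensityOf.le_volume hf]
    refine Measure.restrict_congr_set ?_
    filter_upwards [measure_eq_zero_iff_ae_notMem.1 (measure_eq_zero_of_subset_voidSet hv),
      ae_ne_of_le_volume h.isDensityOf.le_volume t] with x hx hxt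
    refine propext ⟨fun h3 => ⟨h3.1, ?_⟩, fun h3 => ⟨h3.1, h3.2.trans h1⟩⟩
    by_contra! h4
    exact hx ⟨h4.lt_of_ne (Ne.symm hxt), h3.2⟩
  set E := Real.exp (cauchyOff μ t₂ t₁ t) with hE
  have hE0 : (E : ℂ) ≠ 0 := by exact_mod_cast (Real.exp_pos _).ne'
  set k : ℂ → ℂ := fun w =>
    Complex.exp (-cauchyT (μ.restrict (Ioo t₂ t₁)ᶜ) w) * ((w - t) / (w - t₂)) with hk
  have hkt : k t = 0 := by simp [hk]
  have hkd : HasStrictDerivAt k ((E * (t - t₂))⁻¹ : ℂ) t := by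
    have h3 := ((hasStrictDerivAt_cauchyT_restrict (μ := μ) ⟨h2, h1⟩).neg.cexp).mul
      (hasStrictDerivAt_sub_div_sub (t : ℂ) n2)
    refine h3.congr_deriv ?_
    simp only [Pi.neg_apply]
    rw [cauchyT_restrict_ofReal, Complex.exp_neg, ← Complex.ofReal_exp, ← hE, sub_self]
    field_simp
    ring
  have h4 := tendsto_liquidPoint_of_exp_neg hkd (inv_ne_zero (mul_ne_zero hE0 n2))
    (μ := μ) (eventually_upperHalf_and_conj fun w hw => by
      rw [cauchyT_eq_of_restrict_eq measurableSet_Ioo h2.le hr hw, neg_add, neg_sub,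
        Complex.exp_add, exp_log_sub_log hw])
  rw [hkt] at h4
  refine h4.trans_eq ?_
  congr 2
  · simp
  · simp

/-- Here the left end of the full interval is a simple zero of `e^C` itself. -/
theorem tendsto_liquidPoint_of_voidFull (h : IsLimitDensity φ μ a b) {t t₂ t₁ : ℝ}
    (hI : IsVoidFullInterval μ t t₂ t₁) :
    Tendsto (liquidPoint μ) (𝓝[upperHalf] (t : ℂ))
      (𝓝 (t - Real.exp (- cauchyOff μ t₂ t₁ t) * (t - t₁),
          1 + Real.exp (- cauchyOff μ t₂ t₁ t) * (t - t₁))) := by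
  have := h.isProbabilityMeasure
  obtain ⟨h2, h1, hf, hv⟩ := hI
  have n1 : (t : ℂ) - t₁ ≠ 0 := by exact_mod_cast (sub_neg.2 h1).ne
  have hr : μ.restrict (Ioo t₂ t₁) = volume.restrict (Ioo t t₁) := by
    rw [← restrict_eq_of_subset_fullSet h.isDensityOf.le_volume hf]
    refine Measure.restrict_congr_set ?_
    filter_upwards [measure_eq_zero_iff_ae_notMem.1 (measure_eq_zero_of_subset_voidSet hv),
      ae_ne_of_le_volume h.isDensityOf.le_volume t] with x hx hxt
    refine propext ⟨fun h3 => ⟨?_, h3.2⟩, fun h3 => ⟨h2.trans h3.1, h3.2⟩⟩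
    by_contra! h4
    exact hx ⟨h3.1, h4.lt_of_ne hxt⟩
  set E := Real.exp (-cauchyOff μ t₂ t₁ t) with hE
  have hE0 : (E : ℂ) ≠ 0 := by exact_mod_cast (Real.exp_pos _).ne'
  have hE' : Complex.exp (cauchyOff μ t₂ t₁ t) = (E : ℂ)⁻¹ := by
    rw [hE, Real.exp_neg]; push_cast; rw [inv_inv]
  set k : ℂ → ℂ := fun w =>
    Complex.exp (cauchyT (μ.restrict (Ioo t₂ t₁)ᶜ) w) * ((w - t) / (w - t₁)) with hk
  have hkt : k t = 0 := by simp [hk]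
  have hkd : HasStrictDerivAt k ((E * (t - t₁))⁻¹ : ℂ) t := by
    have h3 := ((hasStrictDerivAt_cauchyT_restrict (μ := μ) ⟨h2, h1⟩).cexp).mul
      (hasStrictDerivAt_sub_div_sub (t : ℂ) n1)
    refine h3.congr_deriv ?_
    rw [cauchyT_restrict_ofReal, hE', sub_self]
    field_simp
    ring
  have h4 := tendsto_liquidPoint_of_exp hkd (inv_ne_zero (mul_ne_zero hE0 n1))
    (μ := μ) (eventually_upperHalf_and_conj fun w hw => by
      rw [cauchyT_eq_of_restrict_eq measurableSet_Ioo h1.le hr hw,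
        Complex.exp_add, exp_log_sub_log hw])
  rw [hkt] at h4
  refine h4.trans_eq ?_
  congr 2
  · simp only [zero_sub, div_inv_eq_mul]
    simp [sub_eq_add_neg]
  · simp

theorem EdgeValue.tendsto (h : IsLimitDensity φ μ a b) {t : ℝ} {p : ℝ × ℝ} (hp : EdgeValue μ t p) :
    Tendsto (liquidPoint μ) (𝓝[upperHalf] (t : ℂ)) (𝓝 p) := by
  have := h.isProbabilityMeasure
  cases hp with
  | void ht => exact tendsto_liquidPoint_of_mem_voidSet ht
  | full t₂ t₁ ht hI => exact tendsto_liquidPoint_of_full h ht hI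
  | fullVoid t₂ t₁ hI => exact tendsto_liquidPoint_of_fullVoid h hI
  | voidFull t₂ t₁ hI => exact tendsto_liquidPoint_of_voidFull h hI

theorem EdgeValue.exists_of_mem_edgeDomain {t : ℝ} (ht : t ∈ edgeDomain μ) :
    ∃ p, EdgeValue μ t p := by
  rcases ht with ((ht | ht) | ⟨t₂, t₁, hI⟩) | ⟨t₂, t₁, hI⟩
  · exact ⟨_, .void ht⟩
  · obtain ⟨r, hr, hball⟩ :=
      Metric.isOpen_iff.1 (Measure.isOpen_compl_support (μ := volume - μ)) t ht
    rw [Real.ball_eq_Ioo] at hball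
    exact ⟨_, .full (t - r) (t + r) ⟨by linarith, by linarith⟩ hball⟩
  · exact ⟨_, .fullVoid t₂ t₁ hI⟩
  · exact ⟨_, .voidFull t₂ t₁ hI⟩

/-- Independence of the chosen interval needs no computation: every candidate is the limit of the
same function, and limits are unique. -/
theorem exists_edgeValue_iff_and_tendsto (h : IsLimitDensity φ μ a b) {t : ℝ}
    (ht : t ∈ edgeDomain μ) : ∃ p, (∀ q, EdgeValue μ t q ↔ q = p) ∧
      Tendsto (liquidPoint μ) (𝓝[upperHalf] (t : ℂ)) (𝓝 p) := by
  obtain ⟨p, hp⟩ := EdgeValue.exists_of_mem_edgeDomain ht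
  refine ⟨p, fun q => ⟨fun hq => tendsto_nhds_unique (hq.tendsto h) (hp.tendsto h), ?_⟩,
    hp.tendsto h⟩
  rintro rfl
  exact hp

end edge

/-! ### Boundary behaviour where the density is strictly between zero and one -/

/-! ### A logarithmic bound for the conjugate Poisson kernel -/

section kernel

theorem integral_one_div_max {δ R : ℝ} (hδ : 0 < δ) (hR : δ ≤ R) :
    ∫ r in (0 : ℝ)..R, 1 / max r δ = 1 + Real.log (R / δ) := by
  have hc : Continuous fun r : ℝ => 1 / max r δ :=
    continuous_const.div (by fun_prop) fun r => (hδ.trans_le (le_max_right _ _)).ne'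
  rw [← intervalIntegral.integral_add_adjacent_intervals (b := δ) (hc.intervalIntegrable _ _)
    (hc.intervalIntegrable _ _)]
  congr 1
  · have h1 : ∫ r in (0 : ℝ)..δ, 1 / max r δ = ∫ r in (0 : ℝ)..δ, 1 / δ := by
      refine intervalIntegral.integral_congr fun r hr => ?_
      rw [uIcc_of_le hδ.le] at hr
      simp only [max_eq_right hr.2]
    rw [h1, intervalIntegral.integral_const, sub_zero, smul_eq_mul, mul_one_div_cancel hδ.ne']
  · have h1 : ∫ r in δ..R, 1 / max r δ = ∫ r in δ..R, 1 / r := by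
      refine intervalIntegral.integral_congr fun r hr => ?_
      rw [uIcc_of_le hR] at hr
      simp only [max_eq_left hr.1]
    rw [h1, integral_one_div_of_pos hδ (hδ.trans_le hR)]

variable {ψ : ℝ → ℝ} {κ δ R l r : ℝ} {w : ℂ}

theorem kernel_pointwise_le (h0 : ∀ x, 0 ≤ ψ x) (hκ : ∀ x, ψ x ≤ κ) (hδ : 0 < δ)
    (hsep : ∀ x : ℝ, ψ x ≠ 0 → δ ≤ ‖w - x‖) (x : ℝ) (hx : x ≤ w.re) :
    ψ x * ((w.re - x) / Complex.normSq (w - x)) ≤ κ * (1 / max (w.re - x) δ) := by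
  have hM : 0 < max (w.re - x) δ := hδ.trans_le (le_max_right _ _)
  by_cases hψ : ψ x = 0
  · rw [hψ, zero_mul]
    exact mul_nonneg ((h0 x).trans (hκ x)) (by positivity)
  · have h1 : max (w.re - x) δ ≤ ‖w - x‖ := by
      refine max_le ?_ (hsep x hψ)
      have := Complex.abs_re_le_norm (w - x)
      simp only [Complex.sub_re, Complex.ofReal_re] at this
      exact (le_abs_self _).trans this
    refine mul_le_mul (hκ x) ?_ (div_nonneg (by linarith) (Complex.normSq_nonneg _))
      ((h0 x).trans (hκ x))
    rw [Complex.normSq_eq_norm_sq]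
    calc (w.re - x) / ‖w - x‖ ^ 2 ≤ max (w.re - x) δ / max (w.re - x) δ ^ 2 := by
          gcongr
          exact le_max_left _ _
      _ = 1 / max (w.re - x) δ := by field_simp

theorem integrable_kernel (hw : w.im ≠ 0) (hψ : Measurable ψ) (h0 : ∀ x, 0 ≤ ψ x)
    (hκ : ∀ x, ψ x ≤ κ) :
    IntegrableOn (fun x => ψ x * ((w.re - x) / Complex.normSq (w - x))) (Ioc l r) :=
  (continuous_div_normSq hw (by fun_prop)).integrableOn_Ioc.bdd_mul (c := κ)
    hψ.aestronglyMeasurable (.of_forall fun x => by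
      rw [Real.norm_eq_abs, abs_of_nonneg (h0 x)]; exact hκ x)

/-- Points to the right of `Re w` contribute non-positively and are dropped. On the left the kernel
is dominated by `1 / max(r, δ)`, with `r` the horizontal distance. The factor `κ` in front of the
logarithm becomes the decisive exponent later. -/
theorem kernel_le (hw : w.im ≠ 0) (hψ : Measurable ψ) (h0 : ∀ x, 0 ≤ ψ x) (hκ : ∀ x, ψ x ≤ κ)
    (hδ : 0 < δ) (hR : δ ≤ R) (hsep : ∀ x : ℝ, ψ x ≠ 0 → δ ≤ ‖w - x‖) (hlr : l ≤ r)
    (hl : w.re - R ≤ l) :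
    ∫ x in l..r, ψ x * ((w.re - x) / Complex.normSq (w - x)) ≤ κ * (1 + Real.log (R / δ)) := by
  have hc : Continuous fun x : ℝ => κ * (1 / max (w.re - x) δ) :=
    continuous_const.mul
      (continuous_const.div (by fun_prop) fun r => (hδ.trans_le (le_max_right _ _)).ne')
  have h1 : ∫ x in (w.re - R)..w.re, κ * (1 / max (w.re - x) δ) = κ * (1 + Real.log (R / δ)) := by
    rw [intervalIntegral.integral_const_mul,
      intervalIntegral.integral_comp_sub_left (fun x => 1 / max x δ), sub_self, sub_sub_cancel,
      integral_one_div_max hδ hR]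
  rw [← h1, intervalIntegral.integral_of_le hlr,
    intervalIntegral.integral_of_le (by linarith), ← integral_indicator measurableSet_Ioc,
    ← integral_indicator measurableSet_Ioc]
  refine integral_mono ((integrable_indicator_iff measurableSet_Ioc).2
    (integrable_kernel hw hψ h0 hκ)) ((integrable_indicator_iff measurableSet_Ioc).2
    hc.integrableOn_Ioc) fun x => ?_
  have hκ0 : 0 ≤ κ := (h0 x).trans (hκ x)
  have hnn : 0 ≤ (Ioc (w.re - R) w.re).indicator (fun x => κ * (1 / max (w.re - x) δ)) x :=
    indicator_nonneg (fun x _ => mul_nonneg hκ0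
      (one_div_nonneg.2 (hδ.le.trans (le_max_right _ _)))) x
  by_cases hx : x ∈ Ioc l r
  · rw [indicator_of_mem hx]
    rcases le_or_gt x w.re with hxs | hxs
    · rw [indicator_of_mem (show x ∈ Ioc (w.re - R) w.re from ⟨hl.trans_lt hx.1, hxs⟩)]
      exact kernel_pointwise_le h0 hκ hδ hsep x hxs
    · exact (mul_nonpos_of_nonneg_of_nonpos (h0 x)
        (div_nonpos_of_nonpos_of_nonneg (by linarith) (Complex.normSq_nonneg _))).trans hnn
  · rwa [indicator_of_notMem hx]

theorem abs_kernel_le (hw : w.im ≠ 0) (hψ : Measurable ψ) (h0 : ∀ x, 0 ≤ ψ x)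
    (hκ : ∀ x, ψ x ≤ κ) (hδ : 0 < δ) (hR : δ ≤ R) (hsep : ∀ x : ℝ, ψ x ≠ 0 → δ ≤ ‖w - x‖)
    (hlr : l ≤ r) (hl : w.re - R ≤ l) (hr : r ≤ w.re + R) :
    |∫ x in l..r, ψ x * ((w.re - x) / Complex.normSq (w - x))| ≤ κ * (1 + Real.log (R / δ)) := by
  rw [abs_le']
  refine ⟨kernel_le hw hψ h0 hκ hδ hR hsep hlr hl, ?_⟩
  have hnorm : ∀ x : ℝ, ‖-conj w - x‖ = ‖w - (-x : ℝ)‖ := fun x => by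
    rw [← Complex.norm_conj, ← norm_neg]
    congr 1
    simp [add_comm]
  -- The reflection `x ↦ -x`, `w ↦ -conj w` changes the sign of the kernel.
  have h1 := kernel_le (w := -conj w) (ψ := fun x => ψ (-x)) (κ := κ) (δ := δ) (R := R) (l := -r)
    (r := -l) (by simpa using hw) (hψ.comp measurable_neg) (fun x => h0 _) (fun x => hκ _) hδ hR
    (fun x hx => by rw [hnorm]; exact hsep _ hx) (by linarith) (by simp; linarith)
  refine Eq.trans_le ?_ h1
  rw [← intervalIntegral.integral_neg,
    ← intervalIntegral.integral_comp_neg]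
  refine intervalIntegral.integral_congr fun x _ => ?_
  have h2 : Complex.normSq (-conj w - ((-x : ℝ) : ℂ)) = Complex.normSq (w - x) := by
    rw [Complex.normSq_eq_norm_sq, Complex.normSq_eq_norm_sq, hnorm, neg_neg]
  simp only [h2, neg_neg, Complex.neg_re, Complex.conj_re]
  ring

end kernel

/-! ### A criterion for convergence to `(t, 1)` -/

section top

variable {φ : ℝ → ℝ} {μ : Measure ℝ} {a b : ℝ}

/-- For `C = u - iv` one has `|G - conj G| = 2 e^u sin v` and `|G - 1| ≤ e^u + 1`. Hence `χ - w` and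
`η - 1` are at most a constant times `(Im w / sin v) e^{|u|}`. -/
theorem tendsto_liquidPoint_top (h : IsLimitDensity φ μ a b) {t : ℝ}
    (hY : Tendsto (fun w : ℂ => w.im / Real.sin (-(cauchyT μ w).im) * Real.exp |(cauchyT μ w).re|)
      (𝓝[upperHalf] (t : ℂ)) (𝓝 0)) :
    Tendsto (liquidPoint μ) (𝓝[upperHalf] (t : ℂ)) (𝓝 (t, 1)) := by
  have key : ∀ w ∈ upperHalf,
      ‖((liquidPoint μ w).1 : ℂ) - w‖ ≤
        2 * (w.im / Real.sin (-(cauchyT μ w).im) * Real.exp |(cauchyT μ w).re|) ∧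
      ‖((liquidPoint μ w).2 : ℂ) - 1‖ ≤
        4 * (w.im / Real.sin (-(cauchyT μ w).im) * Real.exp |(cauchyT μ w).re|) := by
    intro w hw
    have hw' : 0 < w.im := hw
    have hIm := cauchyT_im_mem_Ioo h hw'
    set G := Complex.exp (cauchyT μ w) with hG
    set u := (cauchyT μ w).re
    set v := -(cauchyT μ w).im with hv
    have hsin : 0 < Real.sin v :=
      Real.sin_pos_of_pos_of_lt_pi (by linarith [hIm.2]) (by linarith [hIm.1])
    have hGn : ‖G‖ = Real.exp u := Complex.norm_exp _
    have hd : ‖G - conj G‖ = 2 * (Real.exp u * Real.sin v) := by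
      have h1 : G.im = -(Real.exp u * Real.sin v) := by
        rw [hG, Complex.exp_im, hv, Real.sin_neg]; ring
      rw [Complex.sub_conj, h1, norm_mul, Complex.norm_real, Complex.norm_I, mul_one,
        Real.norm_eq_abs, mul_neg, abs_neg, abs_of_pos (by positivity)]
    have hww : ‖w - conj w‖ = 2 * w.im := by
      rw [Complex.sub_conj, norm_mul, Complex.norm_real, Complex.norm_I, mul_one,
        Real.norm_eq_abs, abs_of_pos (by positivity)]
    have hG1 : ‖G - 1‖ ≤ Real.exp u + 1 := by
      have := norm_sub_le G 1
      rwa [hGn, norm_one] at this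
    have hG1' : ‖conj G - 1‖ = ‖G - 1‖ := by
      rw [← Complex.norm_conj]; simp
    have hE := Real.exp_pos u
    have hA : Real.exp u ≤ Real.exp |u| := Real.exp_le_exp.2 (le_abs_self u)
    have hB : Real.exp (-u) ≤ Real.exp |u| := Real.exp_le_exp.2 (neg_le_abs u)
    have h1A : 1 ≤ Real.exp |u| := Real.one_le_exp (abs_nonneg u)
    have huu : Real.exp u * Real.exp (-u) = 1 := by rw [← Real.exp_add]; simp
    constructor
    · rw [liquidPoint_fst h hw', ← hG, add_sub_cancel_left, norm_div, norm_mul, hww, hd, hG1',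
        div_le_iff₀ (by positivity)]
      have h2 : ‖G - 1‖ ≤ 2 * Real.exp |u| * Real.exp u := by nlinarith
      calc 2 * w.im * ‖G - 1‖ ≤ 2 * w.im * (2 * Real.exp |u| * Real.exp u) := by gcongr
        _ = _ := by field_simp
    · rw [liquidPoint_snd h hw', ← hG, add_sub_cancel_left, norm_div, norm_mul, norm_mul, hww, hd,
        hG1', div_le_iff₀ (by positivity)]
      have h2 : ‖G - 1‖ * ‖G - 1‖ ≤ 4 * Real.exp |u| * Real.exp u := by
        calc ‖G - 1‖ * ‖G - 1‖ ≤ (Real.exp u + 1) * (Real.exp u + 1) := by gcongr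
          _ = Real.exp u * (Real.exp u + 2 + Real.exp (-u)) := by linear_combination -huu
          _ ≤ Real.exp u * (4 * Real.exp |u|) := by gcongr; linarith
          _ = _ := by ring
      calc 2 * w.im * ‖G - 1‖ * ‖G - 1‖ = 2 * w.im * (‖G - 1‖ * ‖G - 1‖) := by ring
        _ ≤ 2 * w.im * (4 * Real.exp |u| * Real.exp u) := by gcongr
        _ = _ := by field_simp
  refine Tendsto.prodMk_nhds ?_ ?_
  · have hid : Tendsto (fun w : ℂ => ‖w - t‖) (𝓝[upperHalf] (t : ℂ)) (𝓝 0) := by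
      have h1 : Tendsto (fun w : ℂ => ‖w - t‖) (𝓝 (t : ℂ)) (𝓝 ‖(t : ℂ) - t‖) :=
        (continuous_id.sub continuous_const).norm.tendsto _
      rw [sub_self, norm_zero] at h1
      exact h1.mono_left nhdsWithin_le_nhds
    rw [tendsto_iff_norm_sub_tendsto_zero]
    refine squeeze_zero' (.of_forall fun w => norm_nonneg _) ?_
      (by have h1 := (hY.const_mul 2).add hid; rwa [mul_zero, zero_add] at h1)
    filter_upwards [self_mem_nhdsWithin] with w hw
    have h1 := norm_sub_le_norm_sub_add_norm_sub ((liquidPoint μ w).1 : ℂ) w t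
    rw [← Complex.ofReal_sub, Complex.norm_real] at h1
    exact h1.trans (add_le_add_left (key w hw).1 _)
  · rw [tendsto_iff_norm_sub_tendsto_zero]
    refine squeeze_zero' (.of_forall fun w => norm_nonneg _) ?_
      (by have h1 := hY.const_mul 4; rwa [mul_zero] at h1)
    filter_upwards [self_mem_nhdsWithin] with w hw
    have h1 := (key w hw).2
    rw [← Complex.ofReal_one, ← Complex.ofReal_sub, Complex.norm_real] at h1
    exact h1

end top

/-! ### Estimates from a density bounded away from zero and one -/

section strictlyBetween

variable {φ : ℝ → ℝ} {μ : Measure ℝ} {a b : ℝ}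

theorem mul_length_le_integral {f : ℝ → ℝ} (hf : Integrable f) (h0 : ∀ᵐ x, 0 ≤ f x) {p δ C : ℝ}
    (hδ : 0 ≤ δ) (hC : ∀ x ∈ Ioo p (p + δ), C ≤ f x) : C * δ ≤ ∫ x, f x := by
  have h1 : ∫ x, (Ioo p (p + δ)).indicator (fun _ => C) x = C * δ := by
    rw [integral_indicator measurableSet_Ioo]
    simp [hδ, mul_comm]
  rw [← h1]
  refine integral_mono_ae ((integrable_indicator_iff measurableSet_Ioo).2 (by simp)) hf ?_
  filter_upwards [h0] with x hx
  by_cases hx2 : x ∈ Ioo p (p + δ)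
  · rw [indicator_of_mem hx2]; exact hC x hx2
  · rwa [indicator_of_notMem hx2]

/-- On the given interval of length `δ` the Poisson kernel is at least `Im w/(4δ²)`, and both `φ`
and `1 - φ` are at least `c`. So `v` and `π - v` are both at least `c Im w/(4δ)`, and Jordan's
inequality bounds `sin v` below. -/
theorem im_div_sin_le (h : IsLimitDensity φ μ a b) {w : ℂ} (hw : 0 < w.im) {c δ p : ℝ} (hc : 0 < c)
    (hδ : 0 < δ) (hφ : ∀ x ∈ Ioo p (p + δ), c ≤ φ x ∧ φ x ≤ 1 - c)
    (hn : ∀ x ∈ Ioo p (p + δ), ‖w - (x : ℂ)‖ ≤ 2 * δ) :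
    w.im / Real.sin (-(cauchyT μ w).im) ≤ 2 * Real.pi * δ / c := by
  have := h.isProbabilityMeasure
  have hIm := cauchyT_im_mem_Ioo h hw
  set v := -(cauchyT μ w).im with hv
  have hpi := Real.pi_pos
  have hker : ∀ x ∈ Ioo p (p + δ), w.im / (4 * δ ^ 2) ≤ w.im / Complex.normSq (w - x) := by
    intro x hx
    refine div_le_div_of_nonneg_left hw.le (normSq_sub_ofReal_pos hw.ne' x) ?_
    rw [Complex.normSq_eq_norm_sq]
    calc ‖w - (x : ℂ)‖ ^ 2 ≤ (2 * δ) ^ 2 := pow_le_pow_left₀ (norm_nonneg _) (hn x hx) 2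
      _ = 4 * δ ^ 2 := by ring
  have hq : ∀ x, 0 ≤ w.im / Complex.normSq (w - (x : ℝ)) := fun x =>
    div_nonneg hw.le (Complex.normSq_nonneg _)
  have hq0 : 0 ≤ w.im / (4 * δ ^ 2) := by positivity
  have h1 : c * (w.im / (4 * δ ^ 2)) * δ ≤ v := by
    have e : v = ∫ x : ℝ, φ x * (w.im / Complex.normSq (w - x)) := by
      rw [hv, cauchyT_im μ hw.ne', integral_neg, neg_neg, h.isDensityOf.integral_eq]
      rfl
    rw [e]
    refine mul_length_le_integral (p := p) (integrable_density_mul_real h.isDensityOf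
      (continuous_div_normSq hw.ne' continuous_const))
      (.of_forall fun x => mul_nonneg (h.isDensityOf.2.1 x).1 (hq x)) hδ.le fun x hx => ?_
    exact mul_le_mul (hφ x hx).1 (hker x hx) hq0 (h.isDensityOf.2.1 x).1
  have h2 : c * (w.im / (4 * δ ^ 2)) * δ ≤ Real.pi - v := by
    -- The interval `[A, B]` contains both `[a,b]` and the test interval. Comparing `μ` with
    -- Lebesgue measure on it bounds `π - v` below by the Poisson integral of `1_{(A,B]} - φ`.
    set A := min a p
    set B := max b (p + δ)
    have hAB : A ≤ B := (min_le_right a p).trans ((by linarith : p ≤ p + δ).trans (le_max_right _ _))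
    have e1 := fDeriv_eq_integral_gap h.isDensityOf (χ := B) (η := 1 + A - B) (by linarith) hw.ne'
    have e : B + (1 + A - B) - 1 = A := by ring
    have e2 := congrArg Complex.im e1
    rw [fDeriv_eq_log hw.ne', e, im_integral_gap h.isDensityOf hw.ne', ← integral_neg] at e2
    have ha := arg_mem_Ioo_of_im_pos (z := w - A) (by simpa using hw)
    have hb := arg_mem_Ioo_of_im_pos (z := w - B) (by simpa using hw)
    simp only [Complex.sub_im, Complex.log_im] at e2
    have e3 : c * (w.im / (4 * δ ^ 2)) * δ ≤
        ∫ x : ℝ, -(gapDensity φ A B x * (w.im / Complex.normSq (w - x))) := by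
      refine mul_length_le_integral (p := p)
        (f := fun x => -(gapDensity φ A B x * (w.im / Complex.normSq (w - x))))
        (integrable_gap_mul_real h.isDensityOf
        (continuous_div_normSq hw.ne' continuous_const)).neg ?_ hδ.le fun x hx => ?_
      · filter_upwards [Measure.ae_ne volume a] with x hxa
        rw [Left.nonneg_neg_iff]
        refine mul_nonpos_of_nonpos_of_nonneg ?_ (hq x)
        by_cases hx : x ∈ Ioc A B
        · exact gapDensity_nonpos h.isDensityOf hx
        · rw [gapDensity_of_notMem hx, h.isDensityOf.2.2.1 x fun h4 => hx
            ⟨(min_le_left a p).trans_lt (h4.1.lt_of_ne (Ne.symm hxa)), h4.2.trans (le_max_left _ _)⟩]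
      · have hx' : x ∈ Ioc A B :=
          ⟨(min_le_right a p).trans_lt hx.1, hx.2.le.trans (le_max_right _ _)⟩
        rw [gapDensity, indicator_of_mem hx', ← neg_mul]
        exact mul_le_mul (by linarith [(hφ x hx).2]) (hker x hx) hq0 (by linarith [(hφ x hx).2])
    linarith [ha.1, hb.2]
  have h3 : 2 / Real.pi * (c * (w.im / (4 * δ ^ 2)) * δ) ≤ Real.sin v := by
    have hk : 0 ≤ 2 / Real.pi := by positivity
    rcases le_or_gt v (Real.pi / 2) with hv2 | hv2
    · exact (mul_le_mul_of_nonneg_left h1 hk).trans (Real.mul_le_sin (by linarith [hIm.2]) hv2)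
    · rw [← Real.sin_pi_sub]
      exact (mul_le_mul_of_nonneg_left h2 hk).trans
        (Real.mul_le_sin (by linarith [hIm.1]) (by linarith))
  have h4 : 2 / Real.pi * (c * (w.im / (4 * δ ^ 2)) * δ) = c * w.im / (2 * Real.pi * δ) := by
    field_simp; ring
  rw [h4] at h3
  have h5 : 0 < c * w.im / (2 * Real.pi * δ) := by positivity
  rw [div_le_div_iff₀ (h5.trans_le h3) hc]
  rw [div_le_iff₀ (by positivity)] at h3
  linarith

/-- The conditions on the density near `t` that force `(χ_L, η_L) → (t, 1)`: on `J` the density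
lies in `[c, 1 - c]`, and the real part of the Cauchy transform near `t` is, up to a bounded
term, governed by a kernel integral over `J`. -/
theorem tendsto_liquidPoint_top_of_kernel (h : IsLimitDensity φ μ a b) {t ε c K : ℝ} {J : Set ℝ}
    {ψ : ℝ → ℝ} (hε : 0 < ε) (hc : 0 < c) (hφ : ∀ x ∈ J, c ≤ φ x ∧ φ x ≤ 1 - c)
    (hψ : Measurable ψ) (hψ0 : ∀ x, 0 ≤ ψ x) (hψ1 : ∀ x, ψ x ≤ 1 - c) (hψJ : ∀ x, ψ x ≠ 0 → x ∈ J)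
    (hu : ∀ᶠ w : ℂ in 𝓝[upperHalf] (t : ℂ), |(cauchyT μ w).re| ≤ K +
      |∫ x in (t - ε)..(t + ε), ψ x * ((w.re - x) / Complex.normSq (w - x))|)
    (hgeo : ∀ᶠ w : ℂ in 𝓝[upperHalf] (t : ℂ), ∃ δ, 0 < δ ∧ δ ≤ ‖w - t‖ ∧
      (∀ x ∈ J, δ ≤ ‖w - (x : ℂ)‖) ∧ ∃ p, Ioo p (p + δ) ⊆ J ∧
        ∀ x ∈ Ioo p (p + δ), ‖w - (x : ℂ)‖ ≤ 2 * δ) :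
    Tendsto (liquidPoint μ) (𝓝[upperHalf] (t : ℂ)) (𝓝 (t, 1)) := by
  apply tendsto_liquidPoint_top h
  have hn0 : Tendsto (fun w : ℂ => ‖w - t‖) (𝓝[upperHalf] (t : ℂ)) (𝓝 0) := by
    have h1 : Tendsto (fun w : ℂ => ‖w - t‖) (𝓝 (t : ℂ)) (𝓝 ‖(t : ℂ) - t‖) :=
      (continuous_id.sub continuous_const).norm.tendsto _
    rw [sub_self, norm_zero] at h1
    exact h1.mono_left nhdsWithin_le_nhds
  set M := 2 * Real.pi / c * Real.exp (K + (1 - c) * (1 + Real.log (2 * ε))) with hM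
  have hlim : Tendsto (fun w : ℂ => M * ‖w - t‖ ^ c) (𝓝[upperHalf] (t : ℂ)) (𝓝 0) := by
    have h1 := (Real.continuousAt_rpow_const 0 c (Or.inr hc.le)).tendsto.comp hn0
    rw [Real.zero_rpow hc.ne'] at h1
    simpa using h1.const_mul M
  refine squeeze_zero' ?_ ?_ hlim
  · filter_upwards [self_mem_nhdsWithin] with w hw
    have hw' : 0 < w.im := hw
    have hIm := cauchyT_im_mem_Ioo h hw'
    exact mul_nonneg (div_nonneg hw'.le (Real.sin_nonneg_of_nonneg_of_le_pi
      (by linarith [hIm.2]) (by linarith [hIm.1]))) (Real.exp_pos _).le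
  · filter_upwards [self_mem_nhdsWithin, hu, hgeo, hn0.eventually (gt_mem_nhds hε)]
      with w hw hwu ⟨δ, hδ, hδn, hsep, p, hpJ, hpn⟩ hwε
    have hw' : 0 < w.im := hw
    have hre : |w.re - t| < ε := by
      refine lt_of_le_of_lt ?_ hwε
      simpa using Complex.abs_re_le_norm (w - t)
    rw [abs_lt] at hre
    have h1 := im_div_sin_le h hw' hc hδ (fun x hx => hφ x (hpJ hx)) hpn
    -- Since `|Re w - t| < ε`, the window around `t` lies within distance `2ε` of `Re w`.
    have h2 := abs_kernel_le (l := t - ε) (r := t + ε) hw'.ne' hψ hψ0 hψ1 hδ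
      (R := 2 * ε) (by linarith) (fun x hx => hsep x (hψJ x hx)) (by linarith) (by linarith [hre.2])
      (by linarith [hre.1])
    have h3 : Real.exp |(cauchyT μ w).re| ≤
        Real.exp (K + (1 - c) * (1 + Real.log (2 * ε))) * δ ^ (-(1 - c)) := by
      rw [Real.rpow_def_of_pos hδ, ← Real.exp_add]
      refine Real.exp_le_exp.2 ((hwu.trans (add_le_add_right h2 K)).trans_eq ?_)
      rw [Real.log_div (by positivity) hδ.ne']
      ring
    -- The gain `δ` from the sine beats the loss `δ^{-(1-c)}` from the real part and leaves `δ^c`.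
    calc w.im / Real.sin (-(cauchyT μ w).im) * Real.exp |(cauchyT μ w).re|
        ≤ 2 * Real.pi * δ / c *
          (Real.exp (K + (1 - c) * (1 + Real.log (2 * ε))) * δ ^ (-(1 - c))) := by
          have := Real.pi_pos
          gcongr
      _ = M * (δ * δ ^ (-(1 - c))) := by rw [hM]; ring
      _ = M * δ ^ c := by
          have : δ * δ ^ (-(1 - c)) = δ ^ (1 + -(1 - c)) := by
            rw [Real.rpow_add hδ, Real.rpow_one]
          rw [this]; ring_nf
      _ ≤ M * ‖w - t‖ ^ c := by
          have := Real.pi_pos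
          gcongr

end strictlyBetween

/-! ### The five density cases -/

section densityCase

variable {φ : ℝ → ℝ} {μ : Measure ℝ} {a b : ℝ}

theorem StrictlyBetween.exists_bounds {S : Set ℝ} (h01 : ∀ s, φ s ∈ Icc (0 : ℝ) 1)
    (h : StrictlyBetween φ S) : ∃ c, 0 < c ∧ ∀ x ∈ S, c ≤ φ x ∧ φ x ≤ 1 - c := by
  obtain ⟨h1, h2⟩ := h
  refine ⟨min (sInf (φ '' S)) (1 - sSup (φ '' S)), lt_min h2 (by linarith), fun x hx => ?_⟩
  have hb : BddBelow (φ '' S) := ⟨0, by rintro _ ⟨x, -, rfl⟩; exact (h01 x).1⟩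
  have hb' : BddAbove (φ '' S) := ⟨1, by rintro _ ⟨x, -, rfl⟩; exact (h01 x).2⟩
  have h3 := csInf_le hb (mem_image_of_mem φ hx)
  have h4 := le_csSup hb' (mem_image_of_mem φ hx)
  have h5 := min_le_left (sInf (φ '' S)) (1 - sSup (φ '' S))
  have h6 := min_le_right (sInf (φ '' S)) (1 - sSup (φ '' S))
  constructor <;> linarith

theorem re_intervalIntegral_inv_sub {σ : ℝ → ℝ} (hσ : Measurable σ) (h1 : ∀ x, |σ x| ≤ 1) {w : ℂ}
    (hw : w.im ≠ 0) {l r : ℝ} (hlr : l ≤ r) :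
    (∫ x in l..r, (σ x : ℂ) * (1 / (w - x))).re =
      ∫ x in l..r, σ x * ((w.re - x) / Complex.normSq (w - x)) := by
  have hi : IntegrableOn (fun x : ℝ => (σ x : ℂ) * (1 / (w - x))) (Ioc l r) :=
    (continuous_inv_sub hw).integrableOn_Ioc.bdd_mul (c := 1)
      (Complex.measurable_ofReal.comp hσ).aestronglyMeasurable
      (.of_forall fun x => by simpa using h1 x)
  rw [intervalIntegral.integral_of_le hlr, intervalIntegral.integral_of_le hlr]
  refine (integral_re hi).symm.trans ?_
  congr 1 with x
  simp

theorem cauchyT_re_split (h : IsLimitDensity φ μ a b) {w : ℂ} (hw : w.im ≠ 0) {l r : ℝ}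
    (hlr : l ≤ r) : (cauchyT μ w).re = (cauchyT (μ.restrict (Ioo l r)ᶜ) w).re +
      ∫ x in l..r, φ x * ((w.re - x) / Complex.normSq (w - x)) := by
  have := h.isProbabilityMeasure
  have h01 := h.isDensityOf.2.1
  rw [← re_intervalIntegral_inv_sub h.isDensityOf.1
    (fun x => by rw [abs_of_nonneg (h01 x).1]; exact (h01 x).2) hw hlr, ← Complex.add_re,
    intervalIntegral.integral_of_le hlr, integral_Ioc_eq_integral_Ioo]
  congr 1
  rw [cauchyT, ← integral_add_compl (measurableSet_Ioo (a := l) (b := r))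
    (integrable_inv_sub_of_im_ne_zero μ hw), h.isDensityOf.setIntegral_eq _ measurableSet_Ioo,
    add_comm]
  rfl

theorem exists_eventually_abs_le {t : ℝ} {f : ℂ → ℝ} (hf : ContinuousAt f t) :
    ∃ K, ∀ᶠ w in 𝓝[upperHalf] (t : ℂ), |f w| ≤ K := by
  have h1 : ∀ᶠ w in 𝓝 (t : ℂ), |f w| < |f t| + 1 :=
    hf.abs.eventually (gt_mem_nhds (by linarith))
  exact ⟨_, mem_nhdsWithin_of_mem_nhds (h1.mono fun w hw => hw.le)⟩

theorem continuousAt_re_cauchyT_restrict [IsFiniteMeasure μ] {t ε : ℝ} (hε : 0 < ε) :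
    ContinuousAt (fun w => (cauchyT (μ.restrict (Ioo (t - ε) (t + ε))ᶜ) w).re) t :=
  Complex.continuous_re.continuousAt.comp
    (hasStrictDerivAt_cauchyT_restrict (μ := μ) (t := t)
      ⟨by linarith, by linarith⟩).hasDerivAt.continuousAt

/-- The mass outside the window has a Cauchy transform continuous at `t`, hence bounded nearby. -/
theorem eventually_re_le_of_zero (h : IsLimitDensity φ μ a b) {t ε : ℝ} (hε : 0 < ε) {ψ : ℝ → ℝ}
    (hψ : ∀ᵐ x, x ∈ Ioc (t - ε) (t + ε) → φ x = ψ x) :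
    ∃ K : ℝ, ∀ᶠ w : ℂ in 𝓝[upperHalf] (t : ℂ), |(cauchyT μ w).re| ≤ K +
      |∫ x in (t - ε)..(t + ε), ψ x * ((w.re - x) / Complex.normSq (w - x))| := by
  have := h.isProbabilityMeasure
  obtain ⟨K, hK⟩ := exists_eventually_abs_le (continuousAt_re_cauchyT_restrict (μ := μ) (t := t) hε)
  refine ⟨K, ?_⟩
  filter_upwards [self_mem_nhdsWithin, hK] with w hw hK
  have hw' : 0 < w.im := hw
  rw [cauchyT_re_split h hw'.ne' (by linarith : t - ε ≤ t + ε)]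
  refine (abs_add_le _ _).trans (add_le_add hK (le_of_eq ?_))
  congr 1
  refine intervalIntegral.integral_congr_ae ?_
  filter_upwards [hψ] with x hx hx2
  rw [uIoc_of_le (by linarith)] at hx2
  rw [hx hx2]

/-- Lebesgue measure on the whole window contributes `log |w - (t - ε)| - log |w - (t + ε)|`, which
is bounded near `t`. What remains is the integral of the defect `1 - φ`. -/
theorem eventually_re_le_of_one (h : IsLimitDensity φ μ a b) {t ε : ℝ} (hε : 0 < ε) {ψ : ℝ → ℝ}
    (hm : Measurable ψ) (h1 : ∀ x, |ψ x| ≤ 1)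
    (hψ : ∀ᵐ x, x ∈ Ioc (t - ε) (t + ε) → φ x = 1 - ψ x) :
    ∃ K : ℝ, ∀ᶠ w : ℂ in 𝓝[upperHalf] (t : ℂ), |(cauchyT μ w).re| ≤ K +
      |∫ x in (t - ε)..(t + ε), ψ x * ((w.re - x) / Complex.normSq (w - x))| := by
  have := h.isProbabilityMeasure
  have hlr : t - ε ≤ t + ε := by linarith
  have hne : ∀ s : ℝ, s ≠ t → ContinuousAt (fun w : ℂ => Real.log ‖w - s‖) t := fun s hs => by
    refine ContinuousAt.log (by fun_prop) ?_
    rw [norm_ne_zero_iff, sub_ne_zero]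
    exact_mod_cast hs.symm
  have hlog : ContinuousAt (fun w : ℂ =>
      Real.log ‖w - (t - ε : ℝ)‖ - Real.log ‖w - (t + ε : ℝ)‖) t :=
    (hne _ (by linarith : t - ε < t).ne).sub (hne _ (by linarith : t < t + ε).ne')
  obtain ⟨K, hK⟩ := exists_eventually_abs_le
    ((continuousAt_re_cauchyT_restrict (μ := μ) (t := t) hε).add hlog)
  refine ⟨K, ?_⟩
  filter_upwards [self_mem_nhdsWithin, hK] with w hw hK
  have hw' : 0 < w.im := hw
  have hker : Continuous fun x : ℝ => (w.re - x) / Complex.normSq (w - x) :=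
    continuous_div_normSq hw'.ne' (by fun_prop)
  have e1 : ∫ x in (t - ε)..(t + ε), φ x * ((w.re - x) / Complex.normSq (w - x)) =
      (Real.log ‖w - (t - ε : ℝ)‖ - Real.log ‖w - (t + ε : ℝ)‖) -
        ∫ x in (t - ε)..(t + ε), ψ x * ((w.re - x) / Complex.normSq (w - x)) := by
    have e2 := re_intervalIntegral_inv_sub (σ := fun _ => 1) measurable_const (by simp) hw'.ne' hlr
    simp only [Complex.ofReal_one, one_mul] at e2
    rw [integral_inv_sub_eq_log hw'.ne', Complex.sub_re, Complex.log_re, Complex.log_re] at e2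
    rw [e2, ← intervalIntegral.integral_sub (hker.intervalIntegrable _ _)]
    · refine intervalIntegral.integral_congr_ae ?_
      filter_upwards [hψ] with x hx hx2
      rw [uIoc_of_le hlr] at hx2
      rw [hx hx2]
      ring
    · rw [intervalIntegrable_iff_integrableOn_Ioc_of_le hlr]
      exact hker.integrableOn_Ioc.bdd_mul (c := 1) hm.aestronglyMeasurable
        (.of_forall fun x => by simpa using h1 x)
  rw [cauchyT_re_split h hw'.ne' hlr, e1, ← add_sub_assoc]
  exact (abs_sub _ _).trans (add_le_add_left hK _)

theorem norm_sub_ofReal_le_of_abs_le {w : ℂ} {x y : ℝ} (h : |w.re - x| ≤ |w.re - y|) :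
    ‖w - (x : ℂ)‖ ≤ ‖w - (y : ℂ)‖ := by
  rw [Complex.norm_def, Complex.norm_def]
  refine Real.sqrt_le_sqrt ?_
  have := sq_le_sq.2 h
  simp only [Complex.normSq_apply, Complex.sub_re, Complex.sub_im, Complex.ofReal_re,
    Complex.ofReal_im]
  nlinarith

theorem norm_sub_ofReal_le (w : ℂ) (x : ℝ) : ‖w - (x : ℂ)‖ ≤ |w.re - x| + |w.im| := by
  simpa using Complex.norm_le_abs_re_add_abs_im (w - x)

theorem eventually_near {t ε : ℝ} (hε : 0 < ε) :
    ∀ᶠ w : ℂ in 𝓝[upperHalf] (t : ℂ), 0 < w.im ∧ ‖w - t‖ < ε ∧ w.im ≤ ‖w - t‖ ∧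
      |w.re - t| ≤ ‖w - t‖ := by
  filter_upwards [self_mem_nhdsWithin,
    mem_nhdsWithin_of_mem_nhds (Metric.ball_mem_nhds (t : ℂ) hε)] with w hw hw2
  have hw' : 0 < w.im := hw
  have h1 := abs_im_le_norm_sub_ofReal w t
  rw [abs_of_pos hw'] at h1
  exact ⟨hw, by rwa [Metric.mem_ball, dist_eq_norm] at hw2, h1, by
    simpa using Complex.abs_re_le_norm (w - t)⟩

theorem geometry_both {t ε : ℝ} (hε : 0 < ε) :
    ∀ᶠ w : ℂ in 𝓝[upperHalf] (t : ℂ), ∃ δ, 0 < δ ∧ δ ≤ ‖w - t‖ ∧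
      (∀ x ∈ Ioo (t - ε) (t + ε), δ ≤ ‖w - (x : ℂ)‖) ∧ ∃ p, Ioo p (p + δ) ⊆ Ioo (t - ε) (t + ε) ∧
        ∀ x ∈ Ioo p (p + δ), ‖w - (x : ℂ)‖ ≤ 2 * δ := by
  filter_upwards [eventually_near (half_pos hε)] with w ⟨hw, h1, h2, h3⟩
  have h3' := abs_le.1 h3
  refine ⟨w.im, hw, h2, fun x _ => (le_abs_self _).trans (abs_im_le_norm_sub_ofReal w x),
    w.re, fun x hx => ⟨by linarith [hx.1], by linarith [hx.2]⟩, fun x hx => ?_⟩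
  refine (norm_sub_ofReal_le w x).trans ?_
  rw [abs_of_pos hw, abs_of_neg (by linarith [hx.1])]
  linarith [hx.2]

/-- If `Re w ≤ t`, the scale is the height `Im w`. Otherwise the end-point `t` is nearest to `w`,
and the scale is `|w - t|`; the test interval then ends at `t`. -/
theorem geometry_left {t ε : ℝ} (hε : 0 < ε) :
    ∀ᶠ w : ℂ in 𝓝[upperHalf] (t : ℂ), ∃ δ, 0 < δ ∧ δ ≤ ‖w - t‖ ∧
      (∀ x ∈ Ioo (t - ε) t, δ ≤ ‖w - (x : ℂ)‖) ∧ ∃ p, Ioo p (p + δ) ⊆ Ioo (t - ε) t ∧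
        ∀ x ∈ Ioo p (p + δ), ‖w - (x : ℂ)‖ ≤ 2 * δ := by
  filter_upwards [eventually_near (half_pos hε)] with w ⟨hw, h1, h2, h3⟩
  have h3' := abs_le.1 h3
  rcases le_or_gt w.re t with ht | ht
  · refine ⟨w.im, hw, h2, fun x _ => (le_abs_self _).trans (abs_im_le_norm_sub_ofReal w x),
      w.re - w.im, fun x hx => ⟨by linarith [hx.1], by linarith [hx.2]⟩, fun x hx => ?_⟩
    refine (norm_sub_ofReal_le w x).trans ?_
    rw [abs_of_pos hw, abs_of_pos (by linarith [hx.2])]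
    linarith [hx.1]
  · refine ⟨‖w - t‖, hw.trans_le h2, le_rfl, fun x hx => norm_sub_ofReal_le_of_abs_le ?_,
      t - ‖w - t‖, fun x hx => ⟨by linarith [hx.1], by linarith [hx.2]⟩, fun x hx => ?_⟩
    · rw [abs_of_pos (by linarith), abs_of_pos (by linarith [hx.2])]
      linarith [hx.2]
    · refine (norm_sub_le_norm_sub_add_norm_sub w t x).trans ?_
      rw [← Complex.ofReal_sub, Complex.norm_real, Real.norm_eq_abs,
        abs_of_pos (by linarith [hx.2])]
      linarith [hx.1]

theorem geometry_right {t ε : ℝ} (hε : 0 < ε) :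
    ∀ᶠ w : ℂ in 𝓝[upperHalf] (t : ℂ), ∃ δ, 0 < δ ∧ δ ≤ ‖w - t‖ ∧
      (∀ x ∈ Ioo t (t + ε), δ ≤ ‖w - (x : ℂ)‖) ∧ ∃ p, Ioo p (p + δ) ⊆ Ioo t (t + ε) ∧
        ∀ x ∈ Ioo p (p + δ), ‖w - (x : ℂ)‖ ≤ 2 * δ := by
  filter_upwards [eventually_near (half_pos hε)] with w ⟨hw, h1, h2, h3⟩
  have h3' := abs_le.1 h3
  rcases le_or_gt t w.re with ht | ht
  · refine ⟨w.im, hw, h2, fun x _ => (le_abs_self _).trans (abs_im_le_norm_sub_ofReal w x),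
      w.re, fun x hx => ⟨by linarith [hx.1], by linarith [hx.2]⟩, fun x hx => ?_⟩
    refine (norm_sub_ofReal_le w x).trans ?_
    rw [abs_of_pos hw, abs_of_neg (by linarith [hx.1])]
    linarith [hx.2]
  · refine ⟨‖w - t‖, hw.trans_le h2, le_rfl, fun x hx => norm_sub_ofReal_le_of_abs_le ?_,
      t, fun x hx => ⟨by linarith [hx.1], by linarith [hx.2]⟩, fun x hx => ?_⟩
    · rw [abs_of_neg (by linarith), abs_of_neg (by linarith [hx.1])]
      linarith [hx.1]
    · refine (norm_sub_le_norm_sub_add_norm_sub w t x).trans ?_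
      rw [← Complex.ofReal_sub, Complex.norm_real, Real.norm_eq_abs,
        abs_of_neg (by linarith [hx.1])]
      linarith [hx.2]

theorem tendsto_liquidPoint_top_of_bounds (h : IsLimitDensity φ μ a b) {t ε : ℝ} (hε : 0 < ε)
    {J : Set ℝ} (hJ : MeasurableSet J) (hS : StrictlyBetween φ J)
    (hout : (∀ᵐ x, x ∈ Ioc (t - ε) (t + ε) → x ∉ J → φ x = 0) ∨
      (∀ᵐ x, x ∈ Ioc (t - ε) (t + ε) → x ∉ J → φ x = 1))
    (hgeo : ∀ᶠ w : ℂ in 𝓝[upperHalf] (t : ℂ), ∃ δ, 0 < δ ∧ δ ≤ ‖w - t‖ ∧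
      (∀ x ∈ J, δ ≤ ‖w - (x : ℂ)‖) ∧ ∃ p, Ioo p (p + δ) ⊆ J ∧
        ∀ x ∈ Ioo p (p + δ), ‖w - (x : ℂ)‖ ≤ 2 * δ) :
    Tendsto (liquidPoint μ) (𝓝[upperHalf] (t : ℂ)) (𝓝 (t, 1)) := by
  have h01 := h.isDensityOf.2.1
  obtain ⟨c, hc, hφ⟩ := hS.exists_bounds h01
  -- The geometric condition supplies a point of `J`, where `c ≤ φ ≤ 1 - c`.
  have hc1 : 0 ≤ 1 - c := by
    obtain ⟨w, δ, hδ, -, -, p, hp, -⟩ := hgeo.exists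
    have hx : p + δ / 2 ∈ J := hp ⟨by linarith, by linarith⟩
    linarith [(hφ _ hx).1, (hφ _ hx).2]
  rcases hout with h0 | h1
  · obtain ⟨K, hK⟩ := eventually_re_le_of_zero h hε (t := t) (ψ := J.indicator φ) (by
      filter_upwards [h0] with x hx hx2
      by_cases hxJ : x ∈ J
      · rw [indicator_of_mem hxJ]
      · rw [indicator_of_notMem hxJ, hx hx2 hxJ])
    refine tendsto_liquidPoint_top_of_kernel h hε hc hφ (h.isDensityOf.1.indicator hJ)
      (indicator_nonneg fun x _ => (h01 x).1) (fun x => ?_)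
      (fun x hx => mem_of_indicator_ne_zero hx) hK hgeo
    exact indicator_apply_le' (fun hx => (hφ x hx).2) fun _ => hc1
  · have hm : Measurable (J.indicator fun x => 1 - φ x) :=
      (measurable_const.sub h.isDensityOf.1).indicator hJ
    have hn : ∀ x, 0 ≤ J.indicator (fun x => 1 - φ x) x :=
      indicator_nonneg fun x _ => sub_nonneg.2 (h01 x).2
    have hle : ∀ x, J.indicator (fun x => 1 - φ x) x ≤ 1 - c := fun x =>
      indicator_apply_le' (fun hx => by linarith [(hφ x hx).1]) fun _ => hc1
    obtain ⟨K, hK⟩ := eventually_re_le_of_one h hε (t := t) hm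
      (fun x => by rw [abs_of_nonneg (hn x)]; linarith [hle x]) (by
        filter_upwards [h1] with x hx hx2
        by_cases hxJ : x ∈ J
        · rw [indicator_of_mem hxJ]; ring
        · rw [indicator_of_notMem hxJ, hx hx2 hxJ]; ring)
    exact tendsto_liquidPoint_top_of_kernel h hε hc hφ hm hn hle
      (fun x hx => mem_of_indicator_ne_zero hx) hK hgeo

theorem DensityCase.tendsto (h : IsLimitDensity φ μ a b) {t : ℝ} (ht : DensityCase φ t) :
    Tendsto (liquidPoint μ) (𝓝[upperHalf] (t : ℂ)) (𝓝 (t, 1)) := by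
  obtain ⟨ε, hε, hcase⟩ := ht
  have hleft : ∀ v : ℝ, (∀ s ∈ Ioo t (t + ε), φ s = v) →
      ∀ᵐ x, x ∈ Ioc (t - ε) (t + ε) → x ∉ Ioo (t - ε) t → φ x = v := fun v hv => by
    filter_upwards [Measure.ae_ne volume t, Measure.ae_ne volume (t + ε)] with x h1 h2 h3 h4
    refine hv x ⟨lt_of_le_of_ne ?_ (Ne.symm h1), h3.2.lt_of_ne h2⟩
    by_contra! h5
    exact h4 ⟨h3.1, h5⟩
  have hright : ∀ v : ℝ, (∀ s ∈ Ioo (t - ε) t, φ s = v) →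
      ∀ᵐ x, x ∈ Ioc (t - ε) (t + ε) → x ∉ Ioo t (t + ε) → φ x = v := fun v hv => by
    filter_upwards [Measure.ae_ne volume t, Measure.ae_ne volume (t + ε)] with x h1 h2 h3 h4
    refine hv x ⟨h3.1, lt_of_le_of_ne ?_ h1⟩
    by_contra! h5
    exact h4 ⟨h5, h3.2.lt_of_ne h2⟩
  rcases hcase with hS | ⟨hS, hv⟩ | ⟨hS, hv⟩ | ⟨hS, hv⟩ | ⟨hS, hv⟩
  · refine tendsto_liquidPoint_top_of_bounds h hε measurableSet_Ioo hS (Or.inl ?_)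
      (geometry_both hε)
    filter_upwards [Measure.ae_ne volume (t + ε)] with x h1 h2 h3
    exact absurd ⟨h2.1, h2.2.lt_of_ne h1⟩ h3
  · exact tendsto_liquidPoint_top_of_bounds h hε measurableSet_Ioo hS (Or.inl (hleft 0 hv))
      (geometry_left hε)
  · exact tendsto_liquidPoint_top_of_bounds h hε measurableSet_Ioo hS (Or.inr (hleft 1 hv))
      (geometry_left hε)
  · exact tendsto_liquidPoint_top_of_bounds h hε measurableSet_Ioo hS (Or.inl (hright 0 hv))
      (geometry_right hε)
  · exact tendsto_liquidPoint_top_of_bounds h hε measurableSet_Ioo hS (Or.inr (hright 1 hv))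
      (geometry_right hε)

end densityCase

/-! ### The parameter set of the edge -/

section parameters

variable {φ : ℝ → ℝ} {μ : Measure ℝ} {a b : ℝ}

theorem isOpen_voidSet (μ : Measure ℝ) : IsOpen (voidSet μ) := Measure.isOpen_compl_support

theorem isOpen_fullSet (μ : Measure ℝ) : IsOpen (fullSet μ) := Measure.isOpen_compl_support

theorem edgeDomain_subset_edgeParam (μ : Measure ℝ) : edgeDomain μ ⊆ edgeParam μ := by
  have hsub : voidSet μ ∪ fullSet μ ⊆ edgeParam μ :=
    interior_maximal subset_closure ((isOpen_voidSet μ).union (isOpen_fullSet μ))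
  have key : ∀ t₂ t t₁ : ℝ, t₂ < t → t < t₁ → Ioo t₂ t ⊆ voidSet μ ∪ fullSet μ →
      Ioo t t₁ ⊆ voidSet μ ∪ fullSet μ → t ∈ edgeParam μ := by
    intro t₂ t t₁ h2 h1 hl hr
    refine mem_interior.2 ⟨Ioo t₂ t₁, fun x hx => ?_, isOpen_Ioo, h2, h1⟩
    rcases lt_trichotomy x t with hxt | rfl | hxt
    · exact subset_closure (hl ⟨hx.1, hxt⟩)
    · refine closure_mono hr ?_
      rw [closure_Ioo h1.ne]
      exact left_mem_Icc.2 h1.le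
    · exact subset_closure (hr ⟨hxt, hx.2⟩)
  rintro t ((ht | ⟨t₂, t₁, h2, h1, hv, hf⟩) | ⟨t₂, t₁, h2, h1, hf, hv⟩)
  · exact hsub ht
  · exact key t₂ t t₁ h2 h1 (hf.trans subset_union_right) (hv.trans subset_union_left)
  · exact key t₂ t t₁ h2 h1 (hv.trans subset_union_left) (hf.trans subset_union_right)

theorem exists_mem_of_ae {V : Set ℝ} (hV : IsOpen V) (hne : V.Nonempty) {P : ℝ → Prop}
    (h : ∀ᵐ x, P x) : ∃ x ∈ V, P x := by
  by_contra! h0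
  refine (hV.measure_pos volume hne).ne' (measure_mono_null (fun x hx => ?_) h)
  exact h0 x hx

/-- A density is a.e. `0` on the void set and a.e. `1` on the full set, and non-empty open sets have
positive Lebesgue measure. -/
theorem disjoint_of_strictlyBetween [IsFiniteMeasure μ] (h : IsDensityOf φ μ a b) {S : Set ℝ}
    (hS : IsOpen S) (hφ : StrictlyBetween φ S) : Disjoint S (voidSet μ ∪ fullSet μ) := by
  obtain ⟨c, hc, hb⟩ := hφ.exists_bounds h.2.1
  rw [Set.disjoint_left]
  rintro y hyS (hy | hy)
  · have h1 := measure_eq_zero_iff_ae_notMem.1 (measure_eq_zero_of_subset_voidSet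
      (inter_subset_right (s := S) (t := voidSet μ)))
    rw [h.2.2.2, ae_withDensity_iff h.1.ennreal_ofReal, ← h.2.2.2] at h1
    obtain ⟨x, hx, hx2⟩ := exists_mem_of_ae (hS.inter (isOpen_voidSet μ)) ⟨y, hyS, hy⟩ h1
    refine hx2 ?_ hx
    rw [ne_eq, ENNReal.ofReal_eq_zero, not_le]
    exact hc.trans_le (hb x hx.1).1
  · obtain ⟨V, hVdef⟩ : ∃ V, V = S ∩ fullSet μ := ⟨_, rfl⟩
    have hV : IsOpen V := hVdef ▸ hS.inter (isOpen_fullSet μ)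
    have h1 := restrict_eq_of_subset_fullSet h.le_volume
      (hVdef ▸ inter_subset_right : V ⊆ fullSet μ)
    have hyV : y ∈ V := hVdef ▸ ⟨hyS, hy⟩
    have hVS : V ⊆ S := hVdef ▸ inter_subset_left
    conv_lhs at h1 => rw [h.2.2.2, restrict_withDensity hV.measurableSet]
    conv_rhs at h1 => rw [← withDensity_one (μ := volume.restrict V)]
    replace h1 := (withDensity_eq_iff_of_sigmaFinite h.1.ennreal_ofReal.aemeasurable
      measurable_one.aemeasurable).1 h1
    rw [Filter.EventuallyEq, ae_restrict_iff' hV.measurableSet] at h1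
    obtain ⟨x, hx, hx2⟩ := exists_mem_of_ae hV ⟨y, hyV⟩ h1
    have h3 := hx2 hx
    rw [Pi.one_apply, ENNReal.ofReal_eq_one] at h3
    linarith [(hb x (hVS hx)).2]

theorem DensityCase.exists_isOpen {t : ℝ} (h : DensityCase φ t) :
    ∃ S, IsOpen S ∧ t ∈ closure S ∧ StrictlyBetween φ S := by
  obtain ⟨ε, hε, hcase⟩ := h
  have hl : t ∈ closure (Ioo (t - ε) t) := by
    rw [closure_Ioo (by linarith : t - ε < t).ne]
    exact right_mem_Icc.2 (by linarith)
  have hr : t ∈ closure (Ioo t (t + ε)) := by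
    rw [closure_Ioo (by linarith : t < t + ε).ne]
    exact left_mem_Icc.2 (by linarith)
  rcases hcase with hS | ⟨hS, -⟩ | ⟨hS, -⟩ | ⟨hS, -⟩ | ⟨hS, -⟩
  · exact ⟨_, isOpen_Ioo, subset_closure ⟨by linarith, by linarith⟩, hS⟩
  · exact ⟨_, isOpen_Ioo, hl, hS⟩
  · exact ⟨_, isOpen_Ioo, hl, hS⟩
  · exact ⟨_, isOpen_Ioo, hr, hS⟩
  · exact ⟨_, isOpen_Ioo, hr, hS⟩

/-- The open set `edgeParam μ` lies in the closure of the void and full sets, so an open set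
disjoint from these cannot accumulate at one of its points. -/
theorem DensityCase.notMem_edgeParam [IsFiniteMeasure μ] (h : IsDensityOf φ μ a b) {t : ℝ}
    (ht : DensityCase φ t) : t ∉ edgeParam μ := by
  obtain ⟨S, hS, htS, hφ⟩ := ht.exists_isOpen
  intro htR
  obtain ⟨z, hzR, hzS⟩ := mem_closure_iff.1 htS _ isOpen_interior htR
  obtain ⟨y, hyS, hy⟩ := mem_closure_iff.1 (interior_subset hzR) S hS hzS
  exact Set.disjoint_left.1 (disjoint_of_strictlyBetween h hS hφ) hyS hy

/-! ### Unions of intervals -/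

variable {S : Set ℝ}

theorem subset_fullSet_of_ae_mem (hμ : μ = volume.restrict S) {V : Set ℝ} (hV : IsOpen V)
    (h : ∀ᵐ x, x ∈ V → x ∈ S) : V ⊆ fullSet μ := by
  refine Measure.subset_compl_support_of_isOpen hV ?_
  refine Measure.sub_apply_eq_zero_of_restrict_le_restrict (le_of_eq ?_) hV.measurableSet
  rw [hμ, Measure.restrict_restrict hV.measurableSet]
  refine Measure.restrict_congr_set ?_
  filter_upwards [h] with x hx
  exact propext ⟨fun h1 => ⟨h1, hx h1⟩, fun h1 => h1.1⟩

theorem subset_voidSet_of_ae_notMem (hμ : μ = volume.restrict S) {V : Set ℝ} (hV : IsOpen V)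
    (h : ∀ᵐ x, x ∈ V → x ∉ S) : V ⊆ voidSet μ := by
  refine Measure.subset_compl_support_of_isOpen hV ?_
  rw [hμ, Measure.restrict_apply hV.measurableSet, measure_eq_zero_iff_ae_notMem]
  filter_upwards [h] with x hx h1
  exact hx h1.1 h1.2

/-- If points of `A` accumulate at `t` from the right, convexity fills the gaps between them. The
dichotomy passes to finite unions, which is where finiteness of the family enters. -/
theorem eventually_nhdsGT_mem_or_notMem {A : Set ℝ} (hA : A.OrdConnected) (t : ℝ) :
    (∀ᶠ x in 𝓝[>] t, x ∈ A) ∨ ∀ᶠ x in 𝓝[>] t, x ∉ A := by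
  refine or_iff_not_imp_right.2 fun hf => ?_
  have hf' : ∃ᶠ x in 𝓝[>] t, x ∈ A := by
    intro h0
    exact hf h0
  obtain ⟨p, hpA, hp⟩ := (hf'.and_eventually self_mem_nhdsWithin).exists
  filter_upwards [Ioo_mem_nhdsGT hp] with x hx
  obtain ⟨y, hyA, hy⟩ := (hf'.and_eventually (Ioo_mem_nhdsGT hx.1)).exists
  exact hA.out hyA hpA ⟨hy.2.le, hx.2.le⟩

theorem eventually_nhdsLT_mem_or_notMem {A : Set ℝ} (hA : A.OrdConnected) (t : ℝ) :
    (∀ᶠ x in 𝓝[<] t, x ∈ A) ∨ ∀ᶠ x in 𝓝[<] t, x ∉ A := by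
  refine or_iff_not_imp_right.2 fun hf => ?_
  have hf' : ∃ᶠ x in 𝓝[<] t, x ∈ A := by
    intro h0
    exact hf h0
  obtain ⟨p, hpA, hp⟩ := (hf'.and_eventually self_mem_nhdsWithin).exists
  filter_upwards [Ioo_mem_nhdsLT hp] with x hx
  obtain ⟨y, hyA, hy⟩ := (hf'.and_eventually (Ioo_mem_nhdsLT hx.2)).exists
  exact hA.out hpA hyA ⟨hx.1.le, hy.1.le⟩

theorem eventually_mem_iUnion_or_notMem {ι : Type*} [Finite ι] {A : ι → Set ℝ} {l : Filter ℝ}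
    (h : ∀ k, (∀ᶠ x in l, x ∈ A k) ∨ ∀ᶠ x in l, x ∉ A k) :
    (∀ᶠ x in l, x ∈ ⋃ k, A k) ∨ ∀ᶠ x in l, x ∉ ⋃ k, A k := by
  by_cases h1 : ∃ k, ∀ᶠ x in l, x ∈ A k
  · obtain ⟨k, hk⟩ := h1
    exact Or.inl (hk.mono fun x hx => mem_iUnion.2 ⟨k, hx⟩)
  · right
    have h2 : ∀ k, ∀ᶠ x in l, x ∉ A k := fun k => (h k).resolve_left (not_exists.1 h1 k)
    filter_upwards [eventually_all.2 h2] with x hx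
    simpa using hx

theorem edgeDomain_eq_univ_of_finite {ι : Type*} [Finite ι] {A : ι → Set ℝ}
    (hA : ∀ k, (A k).OrdConnected) (hμ : μ = volume.restrict (⋃ k, A k)) :
    edgeDomain μ = univ := by
  refine eq_univ_of_forall fun t => ?_
  have hex : ∀ {l u : ℝ} {Q : ℝ → Prop}, (∀ x ∈ Ioo l t, Q x) → (∀ x ∈ Ioo t u, Q x) →
      ∀ᵐ x, x ∈ Ioo l u → Q x := fun {l u Q} h1 h2 => by
    filter_upwards [Measure.ae_ne volume t] with x hxt hx
    rcases lt_or_gt_of_ne hxt with h3 | h3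
    · exact h1 x ⟨hx.1, h3⟩
    · exact h2 x ⟨h3, hx.2⟩
  have hR : ∀ {Q : ℝ → Prop}, (∀ᶠ x in 𝓝[>] t, Q x) → ∃ u, t < u ∧ ∀ x ∈ Ioo t u, Q x :=
    fun h => (mem_nhdsGT_iff_exists_Ioo_subset.1 h).imp fun u hu => ⟨hu.1, hu.2⟩
  have hL : ∀ {Q : ℝ → Prop}, (∀ᶠ x in 𝓝[<] t, Q x) → ∃ l, l < t ∧ ∀ x ∈ Ioo l t, Q x :=
    fun h => (mem_nhdsLT_iff_exists_Ioo_subset.1 h).imp fun u hu => ⟨hu.1, hu.2⟩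
  -- The four combinations of one-sided behaviour place `t` in the full set, `R₂`, `R₁` and the void
  -- set, in this order.
  rcases eventually_mem_iUnion_or_notMem fun k => eventually_nhdsGT_mem_or_notMem (hA k) t
    with hr | hr <;>
  rcases eventually_mem_iUnion_or_notMem fun k => eventually_nhdsLT_mem_or_notMem (hA k) t
    with hl | hl <;>
  obtain ⟨u, hu, hr⟩ := hR hr <;> obtain ⟨l, hlt, hl⟩ := hL hl
  · exact Or.inl (Or.inl (Or.inr (subset_fullSet_of_ae_mem hμ isOpen_Ioo (hex hl hr) ⟨hlt, hu⟩)))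
  · exact Or.inr ⟨l, u, hlt, hu, subset_fullSet_of_ae_mem hμ isOpen_Ioo (.of_forall hr),
      subset_voidSet_of_ae_notMem hμ isOpen_Ioo (.of_forall hl)⟩
  · exact Or.inl (Or.inr ⟨l, u, hlt, hu, subset_voidSet_of_ae_notMem hμ isOpen_Ioo (.of_forall hr),
      subset_fullSet_of_ae_mem hμ isOpen_Ioo (.of_forall hl)⟩)
  · exact Or.inl (Or.inl (Or.inl
      (subset_voidSet_of_ae_notMem hμ isOpen_Ioo (hex hl hr) ⟨hlt, hu⟩)))

/-- A ball missing the void set is centred in the support, so by countability it meets some `A k` in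
positive measure. The intersection contains a non-degenerate interval, which lies in the full set.
-/
theorem edgeParam_eq_univ {ι : Type*} [Countable ι] {A : ι → Set ℝ}
    (hA : ∀ k, (A k).OrdConnected) (hμ : μ = volume.restrict (⋃ k, A k)) :
    edgeParam μ = univ := by
  have hd : closure (voidSet μ ∪ fullSet μ) = univ := by
    refine eq_univ_of_forall fun t => ?_
    by_contra ht
    obtain ⟨r, hr, hball⟩ := Metric.isOpen_iff.1 isClosed_closure.isOpen_compl t ht
    have hdis : ∀ x ∈ Metric.ball t r, x ∉ voidSet μ ∪ fullSet μ := fun x hx hx2 =>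
      hball hx (subset_closure hx2)
    have htsupp : t ∈ μ.support := by
      by_contra h1
      exact hdis t (Metric.mem_ball_self hr) (Or.inl h1)
    have hpos := (Measure.mem_support_iff_forall t).1 htsupp _ (Metric.ball_mem_nhds t hr)
    rw [hμ, Measure.restrict_apply measurableSet_ball, inter_iUnion] at hpos
    obtain ⟨k, hk⟩ : ∃ k, volume (Metric.ball t r ∩ A k) ≠ 0 := by
      by_contra! h0
      exact hpos.ne' (measure_iUnion_null h0)
    have hnt : (Metric.ball t r ∩ A k).Nontrivial := by
      rw [← not_subsingleton_iff]
      exact fun h0 => hk (h0.measure_zero volume)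
    obtain ⟨p, hp, q, hq, hpq⟩ := hnt.exists_lt
    have hord : (Metric.ball t r ∩ A k).OrdConnected := by
      rw [Real.ball_eq_Ioo]
      exact ordConnected_Ioo.inter (hA k)
    have hsub : Ioo p q ⊆ Metric.ball t r ∩ A k := Ioo_subset_Icc_self.trans (hord.out hp hq)
    have hfull : Ioo p q ⊆ fullSet μ := subset_fullSet_of_ae_mem hμ isOpen_Ioo
      (.of_forall fun x hx => mem_iUnion.2 ⟨k, (hsub hx).2⟩)
    obtain ⟨z, hz⟩ := nonempty_Ioo.2 hpq
    exact hdis z (hsub hz).1 (Or.inr (hfull hz))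
  rw [edgeParam, hd, interior_univ]

/-- The intersection with `[a,b]` changes `S` only on a null set, but the density must vanish at
every point outside `[a,b]`. -/
theorem isDensityOf_indicator {S : Set ℝ} (hS : MeasurableSet S) (hμ : μ = volume.restrict S)
    (hsupp : μ.support ⊆ Icc a b) :
    IsDensityOf ((S ∩ Icc a b).indicator fun _ => 1) μ a b := by
  refine ⟨measurable_const.indicator (hS.inter measurableSet_Icc), fun s => ?_, fun s hs => ?_, ?_⟩
  · exact ⟨indicator_nonneg (fun _ _ => zero_le_one) s,
      indicator_apply_le' (fun _ => le_rfl) fun _ => zero_le_one⟩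
  · exact indicator_of_notMem (fun h => hs h.2) _
  · have h1 : μ = volume.restrict (S ∩ Icc a b) := by
      have h2 : ∀ᵐ x ∂μ, x ∈ Icc a b := mem_of_superset Measure.support_mem_ae hsupp
      rw [← Measure.restrict_eq_self_of_ae_mem h2, hμ, Measure.restrict_restrict measurableSet_Icc,
        inter_comm]
    rw [h1, ← withDensity_indicator_one (hS.inter measurableSet_Icc)]
    congr 1 with x
    by_cases hx : x ∈ S ∩ Icc a b <;> simp [hx]

/-! ### The boundary of the liquid region -/

theorem tendsToBottom (h : IsLimitDensity φ μ a b) : TendsToBottom μ := by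
  have := h.isProbabilityMeasure
  refine tendsToBottom_of_ae_abs_le (M := |a| + |b| + 1) (by positivity) ?_
  filter_upwards [h.isDensityOf.ae_mem_Icc] with x hx
  rw [abs_le]
  constructor
  · linarith [hx.1, neg_abs_le a, abs_nonneg b]
  · linarith [hx.2, le_abs_self b, abs_nonneg a]

theorem tendsToEdge_of_edgeParam_eq (h : IsLimitDensity φ μ a b)
    (hR : edgeParam μ = edgeDomain μ) : TendsToEdge μ := fun _ ht =>
  exists_edgeValue_iff_and_tendsto h (hR ▸ ht)

theorem frontier_liquidRegion (h : IsLimitDensity φ μ a b)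
    (htop : ∀ t ∉ edgeDomain μ, Tendsto (liquidPoint μ) (𝓝[upperHalf] (t : ℂ)) (𝓝 (t, 1))) :
    frontier (liquidRegion μ a b) =
      {bottomPoint μ} ∪ edge μ ∪ {p | ∃ t, t ∉ edgeDomain μ ∧ p = (t, 1)} := by
  classical
  have hq : ∀ t : ℝ, ∃ p, Tendsto (liquidPoint μ) (𝓝[upperHalf] (t : ℂ)) (𝓝 p) ∧
      (t ∈ edgeDomain μ → EdgeValue μ t p) ∧ (t ∉ edgeDomain μ → p = (t, 1)) := by
    intro t
    by_cases ht : t ∈ edgeDomain μ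
    · obtain ⟨p, hp, hlim⟩ := exists_edgeValue_iff_and_tendsto h ht
      exact ⟨p, hlim, fun _ => (hp p).2 rfl, fun h0 => absurd ht h0⟩
    · exact ⟨(t, 1), htop t ht, fun h0 => absurd h0 ht, fun _ => rfl⟩
  choose q hlim hedge hone using hq
  rw [frontier_liquidRegion_eq h (tendsToBottom h) hlim, union_assoc]
  congr 1
  ext p
  constructor
  · rintro ⟨t, rfl⟩
    by_cases ht : t ∈ edgeDomain μ
    · exact Or.inl ⟨t, hedge t ht⟩
    · exact Or.inr ⟨t, ht, hone t ht⟩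
  · rintro (⟨t, ht⟩ | ⟨t, ht, rfl⟩)
    · exact ⟨t, tendsto_nhds_unique (hlim t) (ht.tendsto h)⟩
    · exact ⟨t, hone t ht⟩

end parameters

theorem mainTheorem12 (μ : Measure ℝ) (a b : ℝ) (x : (n : ℕ) → Fin n → ℤ)
    (hμ : IsLimitOfTopRows μ a b x) :
    (∀ (ι : Type) [Countable ι] (A : ι → Set ℝ), (∀ k, (A k).OrdConnected) →
      Pairwise (fun k l => Disjoint (A k) (A l)) →
      μ = Measure.sum (fun k => volume.restrict (A k)) →
        edgeParam μ = univ ∧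
        (Finite ι → edgeDomain μ = univ) ∧
        (edgeDomain μ = univ →
          frontier (liquidRegion μ a b) = {bottomPoint μ} ∪ edge μ ∧
          TendsToBottom μ ∧ TendsToEdge μ)) ∧
    (∀ φ : ℝ → ℝ, IsDensityOf φ μ a b → (∀ t, t ∉ edgeDomain μ → DensityCase φ t) →
      edgeParam μ = edgeDomain μ ∧
      frontier (liquidRegion μ a b) =
        {bottomPoint μ} ∪ edge μ ∪ {p | ∃ t, t ∉ edgeParam μ ∧ p = (t, 1)} ∧
      TendsToBottom μ ∧ TendsToEdge μ ∧ TendsToTop μ) := by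
  have := hμ.isProbabilityMeasure
  have hlim : ∀ φ, IsDensityOf φ μ a b → IsLimitDensity φ μ a b := fun φ hφ =>
    ⟨hμ.isProbabilityMeasure, hφ, hμ.left_mem, hμ.right_mem, hμ.one_lt⟩
  refine ⟨fun ι _ A hA hdisj hsum => ?_, fun φ hφ hcase => ?_⟩
  · have hμA : μ = volume.restrict (⋃ k, A k) := by
      rw [hsum, Measure.restrict_iUnion hdisj fun k => (hA k).measurableSet]
    have h := hlim _ (isDensityOf_indicator (MeasurableSet.iUnion fun k => (hA k).measurableSet)
      hμA hμ.support_subset)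
    have hR := edgeParam_eq_univ hA hμA
    refine ⟨hR, fun _ => edgeDomain_eq_univ_of_finite hA hμA, fun hD => ⟨?_, tendsToBottom h,
      tendsToEdge_of_edgeParam_eq h (hR.trans hD.symm)⟩⟩
    rw [frontier_liquidRegion h fun t ht => absurd (hD ▸ mem_univ t) ht]
    simp [hD]
  · have h := hlim φ hφ
    have hR : edgeParam μ = edgeDomain μ := by
      refine Subset.antisymm (fun t ht => ?_) (edgeDomain_subset_edgeParam μ)
      by_contra htD
      exact (hcase t htD).notMem_edgeParam hφ ht
    refine ⟨hR, ?_, tendsToBottom h, tendsToEdge_of_edgeParam_eq h hR, fun t ht => ?_⟩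
    · rw [hR]
      exact frontier_liquidRegion h fun t ht => (hcase t ht).tendsto h
    · rw [hR] at ht
      exact (hcase t ht).tendsto h
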